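/- **Setting.** A bidder takes part in $T\ge 2$ first-price auctions with total budget $B=\rho T$, $0<\rho\le 1$. Put $\alpha=1/\rho$. Valuations lie in $V\subseteq[0,1]$. In round $t$, with valuation $v_t\in V$ and highest competing bid $m_t\in[0,1]$, a bid $b$ has utility $f_t(b)=(v_t-b)\mathbf 1[b\ge m_t]$ and payment $c_t(b)=b\,\mathbf 1[b\ge m_t]$. There is also a void action with utility and payment $0$. **Baselines.** Let $\Pi_L$ be the set of $1$-Lipschitz policies $\pi:V\to[0,1]$ and $\Xi$ the set of Borel probability measures on $\Pi_L$. Under a hard budget $B$, utilities are collected in the rounds $t$ for which the payments of rounds $1,\dots,t$ sum to at most $B$. $\mathrm{OPT}^{FD}_\gamma$ is the supremum over $\xi\in\Xi$ of the expected utility collected on the sequence $\gamma=(v_t,m_t)_{t\le T}$ when every round uses an independent draw from $\xi$. For a probability measure $\mathcal D$ on $V\times[0,1]$, $\mathrm{OPT}^{DP}$ is the supremum of the expected utility collected, for i.i.d. requests $(v_t,m_t)\sim\mathcal D$, over all dynamic policies, i.e. (measurable) maps that send the past requests and past drawn policies to the mixture in $\Xi$ of the current round. **Tree.** Let $M=\lfloor\log_2\sqrt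 T\rfloor$, $\epsilon_l=2^{-l}$, $V_{l}=\{0,\epsilon_l,\dots,1\}$, and let $\lfloor x\rfloor_y$ be the largest nonnegative multiple of $y$ that is at most $x$. Let $\hat\Pi_l$ be the set of $\hat\pi:V_l\to\{0,\frac1T,\dots,1\}$ with $|\hat\pi(v)-\hat\pi(v')|\le 2|v-v'|$. Each node $h$ of the tree carries a policy $\sigma_h$, the last one on the path leading to $h$; the root has level $0$ and $\sigma\equiv 1$. At a node $h$ of level $l<M$ the edges $A(h)$ are the $\hat\pi\in\hat\Pi_{l+1}$ that agree with $\sigma_h$ on $V_l$ (all of $\hat\Pi_1$ at the root), leading to nodes of level $l+1$, together with the policy $v\mapsto\sigma_h(\lfloor v\rfloor_{\epsilon_l})+\lfloor 2(v-\lfloor v\rfloor_{\epsilon_l})\rfloor_{1/T}$ on $V_M$, which leads to a terminal node. Nodes whose policy lives on $V_M$ are terminal. The thresholded bid of a terminal policy $\pi$ is $\gamma(\pi)(v,\lambda)=\min\{\pi(\lfloor v\rfloor_{\epsilon_M})+2\epsilon_M,\ v/(1+\lambda)\}$, and its reward in round $t$ is $r_t(\pi)=\mathbf 1[b\ge m_t](v_t-(1+\lambda_t)b)$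 with $b=\gamma(\pi)(v_t,\lambda_t)$. **Primal regret minimizer.** At a terminal node, $p_{t,h}$ is the point mass at $\sigma_h$. At a node $h$ of level $l<M$, $p_{t,h}=\sum_{\pi\in A(h)}q_{t,h}[\pi]\,p_{t,h\cdot\pi}$, where $h\cdot\pi$ is the node reached from $h$ through $\pi$ and $$q_{t,h}[\pi]\propto\exp\Big(\eta_{t,h}\sum_{s<t}\mathbb E_{\pi'\sim p_{s,h\cdot\pi}}[r_s(\pi')]\Big),\qquad \eta_{t,h}=\min\Big\{\tfrac14,\sqrt{\tfrac{\log|A(h)|}{t\,\Delta_l}}\Big\},\qquad \Delta_l=4(1+1/\rho)\epsilon_l .$$ The mixture of round $t$ is $p_t=p_{t,\mathrm{root}}$. **Dual regret minimizer.** Online mirror descent on $[0,1/\rho]$ with the negative entropy $F(x)=x\log x+(\frac1\rho-x)\log(\frac1\rho-x)$, step size $\sqrt{\log 2/T}$ and starting point $\lambda_1=\frac1{2\rho}$ (the minimizer of $F$). Its utility in round $t$ is $\lambda\mapsto-\lambda\,(\rho-\mathbb E_{\pi\sim p_t}[c_t(\gamma(\pi)(v_t,\lambda_t))])$, and $\lambda_{t+1}$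 is the resulting iterate. **Meta-algorithm.** In round $t$, $\lambda_t$ is computed first. Then $\pi_t\sim p_t$ is drawn independently and the bid is $\gamma(\pi_t)(v_t,\lambda_t)$ if the remaining budget is at least $1$; otherwise the void action is played. Then $(v_t,m_t)$ is used to update both regret minimizers. $\mathrm{REW}_\gamma$ is the total utility obtained. **Claim.** There is an absolute constant $C>0$ such that for all $V,T,\rho$ as above and every $\delta>0$: 1. for every sequence $\gamma\in(V\times[0,1])^T$ (oblivious adversary), with probability at least $1-\delta$ over the draws of the algorithm, $$\mathrm{OPT}^{FD}_\gamma-\alpha\,\mathrm{REW}_\gamma\le C\,\alpha^2\sqrt T\,\log^2(T/\delta);$$ 2. for every probability measure $\mathcal D$ on $V\times[0,1]$, if the requests are i.i.d. with law $\mathcal D$, then with probability at least $1-\delta$ over the requests and the draws, $$\mathrm{OPT}^{DP}-\mathrm{REW}_\gamma\le C\,\frac{\sqrt T\,\log^2(T/\delta)}{\rho}.$$ -/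

import Mathlib

open MeasureTheory ProbabilityTheory

namespace FirstPrice

noncomputable section

/-! ### The auction -/

/-- Utility of bidding `b` with valuation `v` against the highest competing bid `m`. -/
def utility (v m b : ℝ) : ℝ := if m ≤ b then v - b else 0

/-- Payment made when bidding `b` against the highest competing bid `m`. -/
def payment (m b : ℝ) : ℝ := if m ≤ b then b else 0

/-- A request: a valuation in `V` and a highest competing bid in `[0,1]`. -/
abbrev Request (V : Set ℝ) := V × unitInterval

/-- Total utility of the bids `b` under a hard budget `B`: the process stops in the first round in
which the total payment exceeds `B`, and nothing is earned from that round on. -/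
def budgetedReward {T : ℕ} (B : ℝ) (v m b : Fin T → ℝ) : ℝ :=
  ∑ t, if ∑ s ∈ Finset.Iic t, payment (m s) (b s) ≤ B then utility (v t) (m t) (b t) else 0

/-! ### The baselines -/

/-- The `1`-Lipschitz static policies `π : V → [0,1]`. -/
def LipPolicy (V : Set ℝ) : Type := {π : V → unitInterval // LipschitzWith 1 π}

/-- Topology of pointwise convergence. -/
instance (V : Set ℝ) : TopologicalSpace (LipPolicy V) :=
  inferInstanceAs (TopologicalSpace {π : V → unitInterval // LipschitzWith 1 π})

instance (V : Set ℝ) : MeasurableSpace (LipPolicy V) := borel _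

instance (V : Set ℝ) : BorelSpace (LipPolicy V) := ⟨rfl⟩

/-- Value of the best fixed strategy mixture: in every round a fresh policy is drawn from the same
mixture `ξ`, until the budget `ρ T` is depleted. -/
def optFD (V : Set ℝ) (T : ℕ) (ρ : ℝ) (γ : Fin T → Request V) : ℝ :=
  ⨆ ξ : ProbabilityMeasure (LipPolicy V),
    ∫ x : Fin T → LipPolicy V,
      budgetedReward (ρ * T) (fun t => (γ t).1) (fun t => (γ t).2) (fun t => (x t).1 (γ t).1)
      ∂(Measure.pi fun _ => (ξ : Measure (LipPolicy V)))

/-- A dynamic policy: the mixture of the current round as a function of the past policies played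
and the past requests. -/
structure DynamicPolicy (V : Set ℝ) where
  mixture : (t : ℕ) → Kernel (Fin t → LipPolicy V × Request V) (LipPolicy V)
  isMarkov : ∀ t, IsMarkovKernel (mixture t)

/-- Law of the first `t` rounds when the requests are i.i.d. with law `𝒟` and the policies are
drawn from the mixtures given by `ψ`: given the past, the policy of a round and its request are
independent. -/
def historyLaw {V : Set ℝ} (𝒟 : Measure (Request V)) (ψ : DynamicPolicy V) :
    (t : ℕ) → Measure (Fin t → LipPolicy V × Request V)
  | 0 => Measure.dirac Fin.elim0
  | t + 1 => (historyLaw 𝒟 ψ t ⊗ₘ (ψ.mixture t ×ₖ Kernel.const _ 𝒟)).map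
      (fun p => Fin.snoc (α := fun _ => LipPolicy V × Request V) p.1 p.2)

/-- Value of the best dynamic policy over `T` rounds with budget `ρ T`, for i.i.d. requests. -/
def optDP (V : Set ℝ) (T : ℕ) (ρ : ℝ) (𝒟 : Measure (Request V)) : ℝ :=
  ⨆ ψ : DynamicPolicy V,
    ∫ h : Fin T → LipPolicy V × Request V,
      budgetedReward (ρ * T) (fun t => (h t).2.1) (fun t => (h t).2.2)
        (fun t => (h t).1.1 (h t).2.1)
      ∂(historyLaw 𝒟 ψ T)

/-! ### Discretized policies and the tree -/

/-- A policy on the grid `{0, ε, …, 1}` with `ε = 2 ^ (-level)`; at the grid point `k ε` it bids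
`bid k / T`. -/
structure GridPolicy where
  level : ℕ
  bid : Fin (2 ^ level + 1) → ℕ

instance : MeasurableSpace GridPolicy := ⊤

instance : DecidableEq GridPolicy := Classical.decEq _

/-- Index of the largest point of the grid of step `2 ^ (-l)` that is at most `v ∈ [0,1]`. -/
def cell (l : ℕ) (v : ℝ) : Fin (2 ^ l + 1) :=
  ⟨min ⌊v * 2 ^ l⌋₊ (2 ^ l), Nat.lt_succ_of_le (min_le_right _ _)⟩

open Classical in
/-- The discretized policies of level `l`: bids in `{0, 1/T, …, 1}`, `2`-Lipschitz on the grid of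
step `2 ^ (-l)`. -/
def discretized (T l : ℕ) : Finset (Fin (2 ^ l + 1) → ℕ) :=
  (Fintype.piFinset fun _ => Finset.range (T + 1)).filter fun π =>
    ∀ k k', |(π k : ℝ) / T - (π k' : ℝ) / T| ≤
      2 * |((k : ℕ) : ℝ) * (1 / 2) ^ l - ((k' : ℕ) : ℝ) * (1 / 2) ^ l|

/-- Number of levels of the tree, `⌊log₂ √T⌋`. -/
def levels (T : ℕ) : ℕ := ⌊Real.logb 2 (Real.sqrt T)⌋₊

/-
A node `h` of the tree is recorded by the last policy `σ_h` on the path that leads to it.  Since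
the policies along a path refine each other, the path to an internal node is determined by `σ_h`,
and so is the subtree below any node.  The root carries the policy of level `0` that always
bids `1`.
-/

/-- The root of the tree. -/
def root (T : ℕ) : GridPolicy := ⟨0, fun _ => T⟩

open Classical in
/-- The refinements `C(h)`: discretized policies of the next level that agree with `σ_h` on the
grid of `σ_h` (all discretized policies of level `1` at the root). -/
def refinements (T : ℕ) (σ : GridPolicy) : Finset GridPolicy :=
  ((discretized T (σ.level + 1)).filter fun π =>
      σ.level = 0 ∨ ∀ k : Fin (2 ^ σ.level + 1),
        π ⟨2 * k, by have := k.2; rw [pow_succ]; omega⟩ = σ.bid k).image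
    fun π => ⟨σ.level + 1, π⟩

/-- The policy `v ↦ σ_h(⌊v⌋_ε) + ⌊2 (v - ⌊v⌋_ε)⌋_{1/T}` on the grid of the last level, where `ε` is
the step of `σ_h`.  For `v = k / 2 ^ M` and `ε = 2 ^ (-l)`, the point `⌊v⌋_ε` has index
`k / 2 ^ (M - l)`, and `v - ⌊v⌋_ε = (k % 2 ^ (M - l)) / 2 ^ M`. -/
def jump (T : ℕ) (σ : GridPolicy) : GridPolicy :=
  ⟨levels T, fun k =>
    σ.bid ⟨min (k / 2 ^ (levels T - σ.level)) (2 ^ σ.level),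
        Nat.lt_succ_of_le (min_le_right _ _)⟩
      + ⌊(T : ℝ) * (2 * ((((k : ℕ) % 2 ^ (levels T - σ.level) : ℕ) : ℝ) * (1 / 2) ^ levels T))⌋₊⟩

/-- The edges `A(h)` available at an internal node. -/
def edges (T : ℕ) (σ : GridPolicy) : Finset GridPolicy := refinements T σ ∪ {jump T σ}

/-- Bid of the thresholded policy of `π`. -/
def thresholdBid (T : ℕ) (π : GridPolicy) (v lam : ℝ) : ℝ :=
  min ((π.bid (cell π.level v) : ℝ) / T + 2 * (1 / 2) ^ π.level) (v / (1 + lam))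

/-! ### The primal regret minimizer -/

/-- Expectation of `g` under a finitely supported mixture. -/
def expect (p : GridPolicy →₀ ℝ) (g : GridPolicy → ℝ) : ℝ := p.sum fun π w => w * g π

/-- Instantaneous reward of `π` for the primal player. -/
def primalReward (T : ℕ) (π : GridPolicy) (lam v m : ℝ) : ℝ :=
  if m ≤ thresholdBid T π v lam then v - (1 + lam) * thresholdBid T π v lam else 0

/-- Learning rate at the node `σ` in the round with index `t = 0, …, T - 1`, i.e. round `t + 1`. -/
def learningRate (T : ℕ) (ρ : ℝ) (t : Fin T) (σ : GridPolicy) : ℝ :=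
  min (1 / 4) (Real.sqrt (Real.log (edges T σ).card /
    (((t : ℕ) + 1 : ℝ) * (4 * (1 + 1 / ρ) * (1 / 2) ^ σ.level))))

/-- The exponential weight of the edge `π` at the node `σ`, when `R π` is its cumulative reward. -/
def expWeight (T : ℕ) (ρ : ℝ) (t : Fin T) (σ : GridPolicy) (R : GridPolicy → ℝ)
    (π : GridPolicy) : ℝ :=
  Real.exp (learningRate T ρ t σ * R π) /
    ∑ π' ∈ edges T σ, Real.exp (learningRate T ρ t σ * R π')

/-- The mixture `p_{t,h}` over final policies at the node `h` with last policy `σ`, for the sequence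
of dual variables `lam`, valuations `v` and highest competing bids `m`; only rounds before `t`
are used.  The first number bounds the depth of the subtree below `h`. -/
def nodeMixture {T : ℕ} (ρ : ℝ) (lam v m : Fin T → ℝ) :
    ℕ → Fin T → GridPolicy → (GridPolicy →₀ ℝ)
  | 0, _, σ => Finsupp.single σ 1
  | n + 1, t, σ =>
    if σ.level = levels T then Finsupp.single σ 1
    else ∑ π ∈ edges T σ,
      expWeight T ρ t σ
        (fun π' => ∑ s ∈ Finset.Iio t,
          expect (nodeMixture ρ lam v m n s π') fun x => primalReward T x (lam s) (v s) (m s)) π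
        • nodeMixture ρ lam v m n t π

/-- The mixture played in round `t`. -/
def rootMixture {T : ℕ} (ρ : ℝ) (lam v m : Fin T → ℝ) (t : Fin T) : GridPolicy →₀ ℝ :=
  nodeMixture ρ lam v m (levels T) t (root T)

/-! ### The dual regret minimizer -/

/-- One step of online mirror descent on `[0, S]` with negative entropy
`F x = x log x + (S - x) log (S - x)` as reference function and step size `η`, from the point `lam`
with the linear utility `x ↦ - x g`; see `omdStep_isMaxOn`. -/
def omdStep (S η lam g : ℝ) : ℝ :=
  S * (lam * Real.exp (-(η * g))) / (lam * Real.exp (-(η * g)) + (S - lam))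

/-- The Bregman divergence of the negative entropy on `[0, S]`. -/
def entropyDivergence (S x y : ℝ) : ℝ :=
  x * Real.log (x / y) + (S - x) * Real.log ((S - x) / (S - y))

theorem omdStep_mem {S lam : ℝ} (η g : ℝ) (h0 : 0 < lam) (h1 : lam < S) :
    omdStep S η lam g ∈ Set.Ioo 0 S := by
  have he := Real.exp_pos (-(η * g))
  have hS : 0 < S := h0.trans h1
  have h2 : 0 < S - lam := sub_pos.2 h1
  have hp : 0 < lam * Real.exp (-(η * g)) := mul_pos h0 he
  refine ⟨by unfold omdStep; positivity, ?_⟩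
  unfold omdStep
  rw [div_lt_iff₀ (by positivity)]
  nlinarith [mul_pos hS h2]

theorem le_mul_log_div {x y : ℝ} (hx : 0 ≤ x) (hy : 0 < y) : x - y ≤ x * Real.log (x / y) := by
  rcases hx.eq_or_lt with rfl | hx
  · simp [hy.le]
  · have h := Real.log_le_sub_one_of_pos (div_pos hy hx)
    have h2 : Real.log (x / y) = -Real.log (y / x) := by rw [← Real.log_inv, inv_div]
    have h3 : x * (y / x) = y := by field_simp
    rw [h2]
    nlinarith [mul_le_mul_of_nonneg_left h hx.le]

/-- The step maximizes the linear utility penalized by the Bregman divergence. -/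
theorem omdStep_isMaxOn {S lam : ℝ} (η g : ℝ) (h0 : 0 < lam) (h1 : lam < S) :
    IsMaxOn (fun x => η * (-(x * g)) - entropyDivergence S x lam) (Set.Icc 0 S)
      (omdStep S η lam g) := by
  obtain ⟨hy0, hyS⟩ := omdStep_mem η g h0 h1
  have he := Real.exp_pos (-(η * g))
  have hS : 0 < S := h0.trans h1
  have h2 : 0 < S - lam := sub_pos.2 h1
  set y := omdStep S η lam g with hy
  set Z := (lam * Real.exp (-(η * g)) + (S - lam)) / S with hZ
  have hZ0 : 0 < Z := by positivity
  have e1 : y = lam * (Real.exp (-(η * g)) / Z) := by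
    rw [hy, hZ, omdStep]; field_simp
  have e2 : S - y = (S - lam) * (1 / Z) := by
    rw [hy, hZ, omdStep]; field_simp; ring
  have hySpos : 0 < S - y := sub_pos.2 hyS
  have key : ∀ x ∈ Set.Icc 0 S, η * (-(x * g)) - entropyDivergence S x lam
      = S * Real.log Z - entropyDivergence S x y := by
    rintro x ⟨hx0, hxS⟩
    have a1 : x * Real.log (x / lam) = x * Real.log (x / y) + x * (-(η * g) - Real.log Z) := by
      rcases hx0.eq_or_lt with rfl | hx
      · simp
      · have : x / lam = x / y * (Real.exp (-(η * g)) / Z) := by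
          rw [e1]; field_simp
        rw [this, Real.log_mul (by positivity) (by positivity),
          Real.log_div he.ne' hZ0.ne', Real.log_exp]
        ring
    have a2 : (S - x) * Real.log ((S - x) / (S - lam))
        = (S - x) * Real.log ((S - x) / (S - y)) + (S - x) * (-Real.log Z) := by
      rcases hxS.eq_or_lt with rfl | hx
      · simp
      · have hx' : 0 < S - x := sub_pos.2 hx
        have : (S - x) / (S - lam) = (S - x) / (S - y) * (1 / Z) := by
          rw [e2]; field_simp
        rw [this, Real.log_mul (by positivity) (by positivity), one_div, Real.log_inv]
        ring
    unfold entropyDivergence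
    rw [a1, a2]
    ring
  intro x hx
  change η * (-(x * g)) - entropyDivergence S x lam
    ≤ η * (-(y * g)) - entropyDivergence S y lam
  rw [key x hx, key y ⟨hy0.le, hyS.le⟩]
  have z : entropyDivergence S y y = 0 := by
    unfold entropyDivergence
    rw [div_self hy0.ne', div_self hySpos.ne']
    simp
  have p : 0 ≤ entropyDivergence S x y := by
    have b1 := le_mul_log_div hx.1 hy0
    have b2 := le_mul_log_div (sub_nonneg.2 hx.2) hySpos
    unfold entropyDivergence
    linarith
  linarith

/-- Step size of the dual regret minimizer. -/
def dualRate (T : ℕ) : ℝ := Real.sqrt (Real.log 2 / T)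

/-- Expected payment in round `t` under the mixture played in that round. -/
def expectedPayment {T : ℕ} (ρ : ℝ) (lam v m : Fin T → ℝ) (t : Fin T) : ℝ :=
  expect (rootMixture ρ lam v m t) fun π => payment (m t) (thresholdBid T π (v t) (lam t))

/-! ### The meta-algorithm -/

/-- Joint run of the two regret minimizers: after `n` updates the entries `0, …, n` are the dual
variables of these rounds.  The dual player starts at the minimizer `1 / (2 ρ)` of the negative
entropy on `[0, 1/ρ]`, and receives the utility `x ↦ - x (ρ - E[payment])`. -/
def dualPath {T : ℕ} (ρ : ℝ) (v m : Fin T → ℝ) : ℕ → Fin T → ℝ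
  | 0 => fun _ => 1 / (2 * ρ)
  | n + 1 =>
    if h : n + 1 < T then
      Function.update (dualPath ρ v m n) ⟨n + 1, h⟩
        (omdStep (1 / ρ) (dualRate T) (dualPath ρ v m n ⟨n, Nat.lt_of_succ_lt h⟩)
          (ρ - expectedPayment ρ (dualPath ρ v m n) v m ⟨n, Nat.lt_of_succ_lt h⟩))
    else dualPath ρ v m n

/-- The dual variables of the run. -/
def dualVar {T : ℕ} (ρ : ℝ) (v m : Fin T → ℝ) : Fin T → ℝ := dualPath ρ v m T

/-- The mixture of round `t` as a measure. -/
def roundLaw {T : ℕ} (ρ : ℝ) (v m : Fin T → ℝ) (t : Fin T) : Measure GridPolicy :=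
  (rootMixture ρ (dualVar ρ v m) v m t).sum fun π w => ENNReal.ofReal w • Measure.dirac π

/-- Law of the policies drawn by the meta-algorithm.  Both regret minimizers are updated with
expectations over the mixtures, so the mixtures depend on the requests only and the draws are
independent. -/
def runLaw {T : ℕ} (ρ : ℝ) (v m : Fin T → ℝ) : Measure (Fin T → GridPolicy) :=
  Measure.pi fun t => roundLaw ρ v m t

/-- Bid of the drawn policy in round `t`. -/
def runBid {T : ℕ} (ρ : ℝ) (v m : Fin T → ℝ) (π : Fin T → GridPolicy) (t : Fin T) : ℝ :=
  thresholdBid T (π t) (v t) (dualVar ρ v m t)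

/-- Reward of the meta-algorithm when the drawn policies are `π`: the bidder bids as long as the
remaining budget is at least `1`, and plays the void action (no reward, no payment) afterwards. -/
def runReward {T : ℕ} (ρ : ℝ) (v m : Fin T → ℝ) (π : Fin T → GridPolicy) : ℝ :=
  ∑ t, if 1 ≤ ρ * T - ∑ s ∈ Finset.Iio t, payment (m s) (runBid ρ v m π s) then
    utility (v t) (m t) (runBid ρ v m π t) else 0

end

end FirstPrice

/-! The run is a Lagrangian game. The primal player picks policies for the penalized reward `u - λ
c`, the dual player picks the price `λ ∈ [0, 1/ρ]` of budget, and both have small regret on every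
prefix of the rounds.

Primal regret. A node of level `l` has `log |A| ≲ ε_l⁻¹ log T`, too much for the standard bound at
deep levels. The jump edge repairs this: its policy is the upper edge of the `2`-Lipschitz cone over
`σ_h`, so it bids at least as much as every final policy below the node and at most `4 ε_l` more.
Overbidding loses only the extra payment, so this one edge is always within `Δ_l` of the best one
(`jump_good_expert`). Exponential weights with such an expert have regret `O(log |A| + √(T Δ_l log
|A|))` (`hedge_regret`), and `Δ_l log |A|` is `O(log T / ρ)` at every level. Summing over at most
`log T` levels and adding the discretization error gives `primal_regret`.

Dual regret. Entropic mirror descent on an interval is exponential weights on its two endpoints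
(`omd_regret`); only the comparators `0` and `1/ρ` are needed.

Reward. Let `n` be the first round with remaining budget below `1`, or `T` if there is none. If the
budget lasts, the dual comparator `0` is used; if not, the comparator `1/ρ` converts the
overspending before `n` into a gain of `T - n`. In both cases, with `N` the expected primal reward
before `n`, `REW ≥ N + ρ ∑_{t<n} λ_t + (T - n) - error` (`runReward_lower_bound`, `run_good`). As
`n` is random, concentration must hold on all prefixes at once (`prefix_concentration`).

Adversarial bound: since `c ≤ 1`, `u⁺ - λ ≤ (u - λ c)⁺`; primal regret bounds the right side, and
multiplying by `ρ ≤ 1` matches the reward bound term by term.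

Stochastic bound: averaging the round laws of a near-optimal dynamic policy gives a static mixture
with the same expected utility and payment up to constants (`exists_static_mixture`). Its per-round
utility `f ≤ 1` and payment `g ≤ ρ + 1/T` turn `n f - g ∑ λ_t ≤ N + error` into the claim, because
each `λ_t` is fixed before request `t`. -/

namespace FirstPrice

noncomputable section

/-! ### Exponential weights with a good expert -/

section Hedge

variable {ι : Type*}

/-- Exponential weights over `A` with learning rate `e` and cumulative gains `R`. -/
def softmax (A : Finset ι) (e : ℝ) (R : ι → ℝ) (i : ι) : ℝ :=
  Real.exp (e * R i) / ∑ j ∈ A, Real.exp (e * R j)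

theorem sum_exp_pos {A : Finset ι} (hA : A.Nonempty) (e : ℝ) (R : ι → ℝ) :
    0 < ∑ j ∈ A, Real.exp (e * R j) :=
  Finset.sum_pos (fun _ _ => Real.exp_pos _) hA

theorem softmax_nonneg (A : Finset ι) (e : ℝ) (R : ι → ℝ) (i : ι) : 0 ≤ softmax A e R i :=
  div_nonneg (Real.exp_pos _).le (Finset.sum_nonneg fun _ _ => (Real.exp_pos _).le)

theorem sum_softmax {A : Finset ι} (hA : A.Nonempty) (e : ℝ) (R : ι → ℝ) :
    ∑ i ∈ A, softmax A e R i = 1 := by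
  unfold softmax
  rw [← Finset.sum_div, div_self (sum_exp_pos hA e R).ne']

/-- Logarithmic potential of the exponential weights. -/
def potential (A : Finset ι) (e : ℝ) (R : ι → ℝ) : ℝ :=
  1 / e * Real.log (∑ j ∈ A, (A.card : ℝ)⁻¹ * Real.exp (e * R j))

/-- Power means increase with the exponent. Lowering the learning rate therefore only lowers the
potential, so decreasing rates cost nothing in the telescoping. -/
theorem potential_mono {A : Finset ι} (hA : A.Nonempty) {e e' : ℝ} (he : 0 < e) (h : e ≤ e')
    (R : ι → ℝ) : potential A e R ≤ potential A e' R := by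
  have hK : (0 : ℝ) < A.card := by exact_mod_cast hA.card_pos
  have he' : 0 < e' := he.trans_le h
  have hp : 1 ≤ e' / e := by rwa [one_le_div he]
  have h1 := Real.rpow_arith_mean_le_arith_mean_rpow A (fun _ => (A.card : ℝ)⁻¹)
    (fun j => Real.exp (e * R j)) (fun _ _ => by positivity)
    (by rw [Finset.sum_const, nsmul_eq_mul, mul_inv_cancel₀ hK.ne'])
    (fun _ _ => (Real.exp_pos _).le) hp
  have h2 : ∀ j, Real.exp (e * R j) ^ (e' / e) = Real.exp (e' * R j) := fun j => by
    rw [← Real.exp_mul]; congr 1; field_simp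
  simp only [h2] at h1
  have hpos : 0 < ∑ j ∈ A, (A.card : ℝ)⁻¹ * Real.exp (e * R j) :=
    Finset.sum_pos (fun _ _ => by positivity) hA
  have h3 := Real.log_le_log (by positivity) h1
  rw [Real.log_rpow hpos] at h3
  unfold potential
  rw [one_div_mul_eq_div, one_div_mul_eq_div, div_le_div_iff₀ he he']
  rw [div_mul_eq_mul_div, div_le_iff₀ he] at h3
  linarith

/-- One round changes the potential by the scaled cumulant of its gains under the weights in force,
which `log_mix_le` estimates. -/
theorem potential_add {A : Finset ι} (hA : A.Nonempty) (e : ℝ) (R g : ι → ℝ) :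
    potential A e (fun j => R j + g j) = potential A e R
      + 1 / e * Real.log (∑ j ∈ A, softmax A e R j * Real.exp (e * g j)) := by
  have hK : (0 : ℝ) < A.card := by exact_mod_cast hA.card_pos
  have hS := sum_exp_pos hA e R
  have hpos : 0 < ∑ j ∈ A, (A.card : ℝ)⁻¹ * Real.exp (e * R j) :=
    Finset.sum_pos (fun _ _ => by positivity) hA
  have hpos' : 0 < ∑ j ∈ A, softmax A e R j * Real.exp (e * g j) :=
    Finset.sum_pos (fun _ _ => mul_pos (div_pos (Real.exp_pos _) hS) (Real.exp_pos _)) hA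
  unfold potential
  rw [← mul_add, ← Real.log_mul hpos.ne' hpos'.ne']
  congr 2
  rw [← Finset.mul_sum, ← Finset.mul_sum, mul_assoc]
  congr 1
  rw [Finset.mul_sum]
  refine Finset.sum_congr rfl fun j _ => ?_
  unfold softmax
  rw [mul_add, Real.exp_add]
  field_simp

/-- A single term of the sum suffices; the uniform prior `1 / |A|` costs `log |A| / e`. -/
theorem le_potential {A : Finset ι} {i : ι} (hi : i ∈ A) {e : ℝ} (he : 0 < e)
    (R : ι → ℝ) : R i ≤ potential A e R + Real.log A.card / e := by
  have hA : A.Nonempty := ⟨i, hi⟩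
  have hK : (0 : ℝ) < A.card := by exact_mod_cast hA.card_pos
  have h1 : Real.exp (e * R i) ≤ ∑ j ∈ A, Real.exp (e * R j) :=
    Finset.single_le_sum (f := fun j => Real.exp (e * R j)) (fun _ _ => (Real.exp_pos _).le) hi
  have h2 := Real.log_le_log (Real.exp_pos _) h1
  rw [Real.log_exp] at h2
  unfold potential
  rw [← Finset.mul_sum, Real.log_mul (by positivity) (sum_exp_pos hA e R).ne', Real.log_inv,
    one_div_mul_eq_div, ← add_div, le_div_iff₀ he]
  linarith

/-- The gap between the exponential and the linear gain is controlled by a good expert. -/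
theorem log_mix_le {A : Finset ι} {w g : ι → ℝ} (hw : ∀ i ∈ A, 0 ≤ w i) (hw1 : ∑ i ∈ A, w i = 1)
    {e a : ℝ} (he : 0 < e) (he' : e ≤ 1 / 4) (h0 : ∀ i ∈ A, 0 ≤ a - g i)
    (h2 : ∀ i ∈ A, a - g i ≤ 2) :
    1 / e * Real.log (∑ i ∈ A, w i * Real.exp (e * g i))
      ≤ ∑ i ∈ A, w i * g i + 2 * e * (a - ∑ i ∈ A, w i * g i) := by
  have key : ∑ i ∈ A, w i * Real.exp (e * g i)
      ≤ Real.exp (e * a) * (1 + (-(e * (a - ∑ i ∈ A, w i * g i))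
        + 2 * e ^ 2 * (a - ∑ i ∈ A, w i * g i))) := by
    have h3 : ∀ i ∈ A, w i * Real.exp (e * g i) ≤ Real.exp (e * a) *
        (w i + (-(e * (w i * a - w i * g i)) + 2 * e ^ 2 * (w i * a - w i * g i))) := by
      intro i hi
      have hx0 := h0 i hi
      have hx2 := h2 i hi
      set x := a - g i with hx
      have hy : |(-(e * x))| ≤ 1 := by
        rw [abs_neg, abs_of_nonneg (by positivity)]; nlinarith
      have h4 := (abs_le.1 (Real.abs_exp_sub_one_sub_id_le hy)).2
      -- Since `0 ≤ x ≤ 2`, the quadratic term is linear in the gap: the second-order loss is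
      -- proportional to the distance below `a`, not to the range of the gains.
      have h5 : Real.exp (-(e * x)) ≤ 1 + (-(e * x) + 2 * e ^ 2 * x) := by
        have : (e * x) ^ 2 ≤ 2 * e ^ 2 * x := by
          have : x ^ 2 ≤ 2 * x := by nlinarith
          nlinarith [mul_le_mul_of_nonneg_left this (sq_nonneg e)]
        nlinarith
      have h6 : Real.exp (e * g i) = Real.exp (e * a) * Real.exp (-(e * x)) := by
        rw [← Real.exp_add]; congr 1; rw [hx]; ring
      rw [h6]
      have := mul_le_mul_of_nonneg_left h5 (mul_nonneg (hw i hi) (Real.exp_pos (e * a)).le)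
      calc _ = w i * Real.exp (e * a) * Real.exp (-(e * x)) := by ring
        _ ≤ _ := this
        _ = _ := by rw [hx]; ring
    refine (Finset.sum_le_sum h3).trans_eq ?_
    rw [← Finset.mul_sum]
    congr 1
    rw [Finset.sum_add_distrib, Finset.sum_add_distrib, hw1, Finset.sum_neg_distrib,
      ← Finset.mul_sum, ← Finset.mul_sum, Finset.sum_sub_distrib, ← Finset.sum_mul, hw1]
    ring
  have hpos : 0 < ∑ i ∈ A, w i * Real.exp (e * g i) := by
    obtain ⟨i, hi, hne⟩ : ∃ i ∈ A, w i ≠ 0 := by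
      by_contra! h
      rw [Finset.sum_eq_zero h] at hw1
      exact zero_ne_one hw1
    exact Finset.sum_pos' (fun i hi => mul_nonneg (hw i hi) (Real.exp_pos _).le)
      ⟨i, hi, mul_pos ((hw i hi).lt_of_ne' hne) (Real.exp_pos _)⟩
  set G := ∑ i ∈ A, w i * g i
  have h7 := Real.log_le_log hpos (key.trans (mul_le_mul_of_nonneg_left
    (by have := Real.add_one_le_exp (-(e * (a - G)) + 2 * e ^ 2 * (a - G)); linarith :
      _ ≤ Real.exp (-(e * (a - G)) + 2 * e ^ 2 * (a - G))) (Real.exp_pos _).le))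
  rw [← Real.exp_add, Real.log_exp] at h7
  rw [one_div_mul_eq_div, div_le_iff₀ he]
  nlinarith

/-- Abel summation against a decreasing sequence. -/
theorem sum_antitone_mul_le {η d : ℕ → ℝ} (hη : Antitone η) (hη0 : ∀ t, 0 ≤ η t) {D : ℝ} {n : ℕ}
    (hD : ∀ k ≤ n, ∑ t ∈ Finset.range k, d t ≤ D) :
    ∑ t ∈ Finset.range n, η t * d t ≤ η 0 * D := by
  -- Each drop of the rate releases `η k - η (k + 1)` times a prefix sum, which is at most `D`.
  have key : ∀ k ≤ n, ∑ t ∈ Finset.range k, η t * d t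
      ≤ η k * ∑ t ∈ Finset.range k, d t + (η 0 - η k) * D := by
    intro k
    induction k with
    | zero => simp
    | succ k ih =>
      intro hk
      have h1 := ih (by omega)
      have h2 := hD (k + 1) hk
      have h3 : 0 ≤ η k - η (k + 1) := sub_nonneg.2 (hη k.le_succ)
      rw [Finset.sum_range_succ] at h2 ⊢
      rw [Finset.sum_range_succ]
      nlinarith
  nlinarith [key n le_rfl, hD n le_rfl, hη0 n]

/-- Regret of exponential weights with decreasing learning rates and a good expert. -/
theorem hedge_regret_rates {A : Finset ι} {η : ℕ → ℝ} {g : ℕ → ι → ℝ} {J : ι} {Δ : ℝ}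
    (hη : Antitone η) (hη0 : ∀ t, 0 < η t) (hη1 : ∀ t, η t ≤ 1 / 4)
    (hg0 : ∀ t, ∀ i ∈ A, 0 ≤ g t i) (hg1 : ∀ t, ∀ i ∈ A, g t i ≤ 1) (hJ : J ∈ A)
    (hΔ0 : 0 ≤ Δ) (hΔ1 : Δ ≤ 1) (hgJ : ∀ t, ∀ i ∈ A, g t i ≤ g t J + Δ) (n : ℕ) {i : ι}
    (hi : i ∈ A) :
    ∑ t ∈ Finset.range n, g t i - ∑ t ∈ Finset.range n, ∑ j ∈ A,
        softmax A (η t) (fun j => ∑ s ∈ Finset.range t, g s j) j * g t j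
      ≤ 2 * (Real.log A.card / η n + 2 * Δ * ∑ t ∈ Finset.range n, η t) := by
  have hA : A.Nonempty := ⟨J, hJ⟩
  have hK : (0 : ℝ) < A.card := by exact_mod_cast hA.card_pos
  have hlogK : 0 ≤ Real.log A.card := Real.log_nonneg (by exact_mod_cast hA.card_pos)
  set E : ℕ → ℝ := fun t => ∑ j ∈ A,
    softmax A (η t) (fun j => ∑ s ∈ Finset.range t, g s j) j * g t j with hE
  have step1 : ∀ k, potential A (η k) (fun j => ∑ s ∈ Finset.range k, g s j)
      ≤ ∑ t ∈ Finset.range k, (E t + 2 * η t * (g t J + Δ - E t)) := by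
    intro k
    induction k with
    | zero =>
      simp only [Finset.range_zero, Finset.sum_empty, potential, mul_zero, Real.exp_zero, mul_one,
        Finset.sum_const, nsmul_eq_mul, mul_inv_cancel₀ hK.ne', Real.log_one, le_refl]
    | succ k ih =>
      have h1 := potential_mono hA (hη0 (k + 1)) (hη k.le_succ)
        (fun j => ∑ s ∈ Finset.range (k + 1), g s j)
      simp only [Finset.sum_range_succ] at h1 ⊢
      rw [potential_add hA (η k)] at h1
      -- The level `a = g J + Δ` lies above all gains by `hgJ`, and by at most `2` because `Δ ≤ 1`.
      have h2 := log_mix_le (A := A) (g := g k) (e := η k) (a := g k J + Δ)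
        (w := softmax A (η k) (fun j => ∑ s ∈ Finset.range k, g s j))
        (fun i _ => softmax_nonneg _ _ _ i) (sum_softmax hA _ _) (hη0 k) (hη1 k)
        (fun i hi => by linarith [hgJ k i hi])
        (fun i hi => by linarith [hg0 k i hi, hg1 k J hJ])
      linarith
  have step2 : ∀ k, ∀ i ∈ A, ∑ t ∈ Finset.range k, g t i - ∑ t ∈ Finset.range k, E t
      ≤ Real.log A.card / η k + 2 * Δ * ∑ t ∈ Finset.range k, η t
        + 2 * ∑ t ∈ Finset.range k, η t * (g t J - E t) := by
    intro k i hi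
    have h1 := le_potential hi (hη0 k) (fun j => ∑ s ∈ Finset.range k, g s j)
    have h2 := step1 k
    have h3 : ∑ t ∈ Finset.range k, (E t + 2 * η t * (g t J + Δ - E t))
        = ∑ t ∈ Finset.range k, E t + 2 * Δ * ∑ t ∈ Finset.range k, η t
          + 2 * ∑ t ∈ Finset.range k, η t * (g t J - E t) := by
      rw [Finset.mul_sum, Finset.mul_sum, ← Finset.sum_add_distrib, ← Finset.sum_add_distrib]
      exact Finset.sum_congr rfl fun t _ => by ring
    linarith
  have mono : ∀ k ≤ n, Real.log A.card / η k + 2 * Δ * ∑ t ∈ Finset.range k, η t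
      ≤ Real.log A.card / η n + 2 * Δ * ∑ t ∈ Finset.range n, η t := by
    intro k hk
    refine add_le_add (div_le_div_of_nonneg_left hlogK (hη0 n) (hη hk))
      (mul_le_mul_of_nonneg_left ?_ (by positivity))
    exact Finset.sum_le_sum_of_subset_of_nonneg (Finset.range_mono hk) fun t _ _ => (hη0 t).le
  -- The leftover term is a weighted regret against `J`, still unknown. On the prefix with the
  -- largest regret `D` against `J`, Abel summation and `η ≤ 1/4` bound it by `D / 4`, so `D ≤ bound
  -- + D / 2`, i.e. `D ≤ 2 * bound`. Any other comparator then pays at most `bound + D / 2`.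
  obtain ⟨k, hk, hmax⟩ := Finset.exists_max_image (Finset.range (n + 1))
    (fun k => ∑ t ∈ Finset.range k, (g t J - E t)) ⟨0, by simp⟩
  rw [Finset.mem_range, Nat.lt_succ_iff] at hk
  set D := ∑ t ∈ Finset.range k, (g t J - E t) with hD
  have hD0 : 0 ≤ D := by simpa using hmax 0 (by simp)
  have abel : ∀ k' ≤ n, ∑ t ∈ Finset.range k', η t * (g t J - E t) ≤ D / 4 := by
    intro k' hk'
    have := sum_antitone_mul_le hη (fun t => (hη0 t).le) (D := D) (d := fun t => g t J - E t) (n := k')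
      (fun j hj => hmax j (by simp; omega))
    nlinarith [hη1 0]
  have h1 := step2 k J hJ
  rw [← Finset.sum_sub_distrib] at h1
  have h2 := abel k hk
  have h3 := mono k hk
  have h4 := step2 n i hi
  have h5 := abel n le_rfl
  linarith

theorem sum_inv_sqrt_le (n : ℕ) : ∑ t ∈ Finset.range n, 1 / Real.sqrt (t + 1) ≤ 2 * Real.sqrt n := by
  induction n with
  | zero => simp
  | succ n ih =>
    rw [Finset.sum_range_succ]
    have h0 : (0 : ℝ) ≤ n := Nat.cast_nonneg n
    have h1 := Real.sq_sqrt h0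
    have h2 := Real.sq_sqrt (show (0 : ℝ) ≤ n + 1 by positivity)
    have h3 : 0 < Real.sqrt ((n : ℝ) + 1) := Real.sqrt_pos.2 (by positivity)
    have h4 := Real.sqrt_nonneg (n : ℝ)
    have h5 : 1 / Real.sqrt ((n : ℝ) + 1) ≤ 2 * Real.sqrt (n + 1) - 2 * Real.sqrt n := by
      rw [div_le_iff₀ h3]
      nlinarith [sq_nonneg (Real.sqrt ((n : ℝ) + 1) - Real.sqrt n)]
    push_cast
    linarith

/-- Regret of exponential weights with a good expert and the rates
`min {1/4, sqrt (log |A| / (t Δ))}`. -/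
theorem hedge_regret {A : Finset ι} {g : ℕ → ι → ℝ} {J : ι} {Δ : ℝ}
    (hg0 : ∀ t, ∀ i ∈ A, 0 ≤ g t i) (hg1 : ∀ t, ∀ i ∈ A, g t i ≤ 1) (hJ : J ∈ A)
    (hΔ0 : 0 < Δ) (hgJ : ∀ t, ∀ i ∈ A, g t i ≤ g t J + Δ) (n : ℕ) {i : ι} (hi : i ∈ A) :
    ∑ t ∈ Finset.range n, g t i - ∑ t ∈ Finset.range n, ∑ j ∈ A,
        softmax A (min (1 / 4) (Real.sqrt (Real.log A.card / ((t + 1 : ℝ) * Δ))))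
          (fun j => ∑ s ∈ Finset.range t, g s j) j * g t j
      ≤ 8 * Real.log A.card + 10 * Real.sqrt (Real.log A.card * Δ * (n + 1)) := by
  have hA : A.Nonempty := ⟨J, hJ⟩
  -- For a single expert `log |A| = 0` makes the rate vanish, so the bound for positive rates does
  -- not apply; the regret is then `0`.
  rcases (Nat.one_le_iff_ne_zero.2 hA.card_pos.ne').eq_or_lt with h1 | h1
  · obtain ⟨a, rfl⟩ := Finset.card_eq_one.1 h1.symm
    rw [Finset.mem_singleton] at hi
    subst hi
    have hz : ∀ (e : ℝ) (R : ι → ℝ), softmax {i} e R i = 1 := fun e R => by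
      simpa using sum_softmax hA e R
    simp [hz]
  have hL : 0 < Real.log A.card := Real.log_pos (by exact_mod_cast h1)
  set L := Real.log A.card
  set η : ℕ → ℝ := fun t => min (1 / 4) (Real.sqrt (L / ((t + 1 : ℝ) * Δ))) with hη
  have hη0 : ∀ t, 0 < η t := fun t => lt_min (by norm_num) (Real.sqrt_pos.2 (by positivity))
  have hanti : Antitone η := by
    intro s t hst
    refine min_le_min le_rfl (Real.sqrt_le_sqrt ?_)
    have : (s : ℝ) ≤ t := by exact_mod_cast hst
    gcongr
  -- Gains lie in `[0,1]`, so `J` is in any case within `1` of every expert.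
  have h2 := hedge_regret_rates (Δ := min Δ 1) hanti hη0 (fun t => min_le_left _ _) hg0 hg1 hJ
    (le_min hΔ0.le zero_le_one) (min_le_right _ _)
    (fun t i hi => by
      rw [← min_add_add_left]
      exact le_min (hgJ t i hi) (by linarith [hg0 t J hJ, hg1 t i hi])) n hi
  refine h2.trans ?_
  have h3 : L / η n ≤ 4 * L + Real.sqrt (L * Δ * (n + 1)) := by
    have hs : L = Real.sqrt (L * Δ * (n + 1)) * Real.sqrt (L / ((n + 1 : ℝ) * Δ)) := by
      rw [← Real.sqrt_mul (by positivity)]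
      have : L * Δ * (n + 1) * (L / ((n + 1 : ℝ) * Δ)) = L ^ 2 := by field_simp
      rw [this, Real.sqrt_sq hL.le]
    rw [div_le_iff₀ (hη0 n)]
    have hq := Real.sqrt_nonneg (L * Δ * (n + 1))
    rcases min_choice (1 / 4 : ℝ) (Real.sqrt (L / ((n + 1 : ℝ) * Δ))) with hm | hm
    · simp only [hη, hm]; linarith
    · have : η n = Real.sqrt (L / ((n + 1 : ℝ) * Δ)) := hm
      rw [this, add_mul, ← hs]
      have := Real.sqrt_nonneg (L / ((n + 1 : ℝ) * Δ))
      nlinarith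
  have h4 : min Δ 1 * ∑ t ∈ Finset.range n, η t ≤ 2 * Real.sqrt (L * Δ * (n + 1)) := by
    calc min Δ 1 * ∑ t ∈ Finset.range n, η t
        ≤ Δ * ∑ t ∈ Finset.range n, η t :=
          mul_le_mul_of_nonneg_right (min_le_left _ _)
            (Finset.sum_nonneg fun t _ => (hη0 t).le)
      _ ≤ ∑ t ∈ Finset.range n, Real.sqrt (L * Δ) * (1 / Real.sqrt (t + 1)) := by
          rw [Finset.mul_sum]
          refine Finset.sum_le_sum fun t _ => ?_
          refine (mul_le_mul_of_nonneg_left (min_le_right _ _) hΔ0.le).trans_eq ?_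
          have hd : Δ = Real.sqrt (Δ ^ 2) := (Real.sqrt_sq hΔ0.le).symm
          conv_lhs => rw [hd]
          rw [← Real.sqrt_mul (by positivity), mul_one_div, ← Real.sqrt_div (by positivity),
            Real.sqrt_sq hΔ0.le]
          congr 1
          field_simp
      _ ≤ Real.sqrt (L * Δ) * (2 * Real.sqrt n) := by
          rw [← Finset.mul_sum]
          exact mul_le_mul_of_nonneg_left (sum_inv_sqrt_le n) (Real.sqrt_nonneg _)
      _ = 2 * Real.sqrt (L * Δ * n) := by rw [Real.sqrt_mul (show 0 ≤ L * Δ by positivity)]; ring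
      _ ≤ _ := by gcongr; linarith
  linarith

end Hedge

/-! ### Expectations under the node mixtures -/

theorem expect_eq_linearCombination (p : GridPolicy →₀ ℝ) (g : GridPolicy → ℝ) :
    expect p g = Finsupp.linearCombination ℝ g p := rfl

theorem expect_single (σ : GridPolicy) (g : GridPolicy → ℝ) :
    expect (Finsupp.single σ 1) g = g σ := by
  simp [expect_eq_linearCombination]

theorem expect_sum_smul {ι : Type*} (A : Finset ι) (w : ι → ℝ) (p : ι → GridPolicy →₀ ℝ)
    (g : GridPolicy → ℝ) : expect (∑ i ∈ A, w i • p i) g = ∑ i ∈ A, w i * expect (p i) g := by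
  simp [expect_eq_linearCombination]

theorem expect_sub (p : GridPolicy →₀ ℝ) (f g : GridPolicy → ℝ) :
    expect p (fun x => f x - g x) = expect p f - expect p g := by
  simp [expect, Finsupp.sum, mul_sub]

theorem expect_const_mul (p : GridPolicy →₀ ℝ) (c : ℝ) (g : GridPolicy → ℝ) :
    expect p (fun x => c * g x) = c * expect p g := by
  simp [expect, Finsupp.sum, Finset.mul_sum, mul_left_comm]

theorem edges_nonempty (T : ℕ) (σ : GridPolicy) : (edges T σ).Nonempty :=
  ⟨jump T σ, by simp [edges]⟩

theorem jump_mem_edges (T : ℕ) (σ : GridPolicy) : jump T σ ∈ edges T σ := by simp [edges]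

theorem expWeight_eq_softmax (T : ℕ) (ρ : ℝ) (t : Fin T) (σ : GridPolicy) (R : GridPolicy → ℝ) :
    expWeight T ρ t σ R = softmax (edges T σ) (learningRate T ρ t σ) R := rfl

/-- Cumulative reward of the node `π` before round `t`. -/
def cumReward {T : ℕ} (ρ : ℝ) (lam v m : Fin T → ℝ) (n : ℕ) (t : Fin T) (π : GridPolicy) : ℝ :=
  ∑ s ∈ Finset.Iio t,
    expect (nodeMixture ρ lam v m n s π) fun x => primalReward T x (lam s) (v s) (m s)

theorem nodeMixture_zero {T : ℕ} (ρ : ℝ) (lam v m : Fin T → ℝ) (t : Fin T) (σ : GridPolicy) :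
    nodeMixture ρ lam v m 0 t σ = Finsupp.single σ 1 := by
  rw [nodeMixture]

theorem nodeMixture_terminal {T : ℕ} (ρ : ℝ) (lam v m : Fin T → ℝ) (n : ℕ) (t : Fin T)
    {σ : GridPolicy} (h : σ.level = levels T) :
    nodeMixture ρ lam v m n t σ = Finsupp.single σ 1 := by
  cases n with
  | zero => exact nodeMixture_zero ..
  | succ n => rw [nodeMixture, if_pos h]

theorem nodeMixture_succ {T : ℕ} (ρ : ℝ) (lam v m : Fin T → ℝ) (n : ℕ) (t : Fin T)
    {σ : GridPolicy} (h : σ.level ≠ levels T) :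
    nodeMixture ρ lam v m (n + 1) t σ = ∑ π ∈ edges T σ,
      expWeight T ρ t σ (cumReward ρ lam v m n t) π • nodeMixture ρ lam v m n t π := by
  rw [nodeMixture, if_neg h]
  rfl

/-- Final policies in the subtree of depth `n` below a node. -/
def leaves (T : ℕ) : ℕ → GridPolicy → Set GridPolicy
  | 0, σ => {σ}
  | n + 1, σ => if σ.level = levels T then {σ} else ⋃ π ∈ edges T σ, leaves T n π

theorem expect_nodeMixture_le {T : ℕ} (ρ : ℝ) (lam v m : Fin T → ℝ) (t : Fin T)
    {g : GridPolicy → ℝ} {b : ℝ} (n : ℕ) (σ : GridPolicy) (h : ∀ x ∈ leaves T n σ, g x ≤ b) :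
    expect (nodeMixture ρ lam v m n t σ) g ≤ b := by
  induction n generalizing σ with
  | zero => rw [nodeMixture_zero, expect_single]; exact h σ rfl
  | succ n ih =>
    by_cases hσ : σ.level = levels T
    · rw [nodeMixture_terminal _ _ _ _ _ _ hσ, expect_single]
      exact h σ (by simp [leaves, hσ])
    · rw [nodeMixture_succ _ _ _ _ _ _ hσ, expect_sum_smul]
      have h1 : ∀ π ∈ edges T σ, expWeight T ρ t σ (cumReward ρ lam v m n t) π
          * expect (nodeMixture ρ lam v m n t π) g
          ≤ expWeight T ρ t σ (cumReward ρ lam v m n t) π * b := fun π hπ =>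
        mul_le_mul_of_nonneg_left (ih π fun x hx => h x (by
          simp only [leaves, if_neg hσ, Set.mem_iUnion]; exact ⟨π, hπ, hx⟩))
          (softmax_nonneg _ _ _ _)
      refine (Finset.sum_le_sum h1).trans_eq ?_
      rw [← Finset.sum_mul, expWeight_eq_softmax, sum_softmax (edges_nonempty T σ), one_mul]

theorem le_expect_nodeMixture {T : ℕ} (ρ : ℝ) (lam v m : Fin T → ℝ) (t : Fin T)
    {g : GridPolicy → ℝ} {b : ℝ} (n : ℕ) (σ : GridPolicy) (h : ∀ x ∈ leaves T n σ, b ≤ g x) :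
    b ≤ expect (nodeMixture ρ lam v m n t σ) g := by
  have h1 := expect_nodeMixture_le ρ lam v m t (g := fun x => -1 * g x) (b := -b) n σ
    fun x hx => by linarith [h x hx]
  rw [expect_const_mul] at h1
  linarith

theorem expect_nodeMixture_const {T : ℕ} (ρ : ℝ) (lam v m : Fin T → ℝ) (t : Fin T) (n : ℕ)
    (σ : GridPolicy) (b : ℝ) : expect (nodeMixture ρ lam v m n t σ) (fun _ => b) = b :=
  le_antisymm (expect_nodeMixture_le _ _ _ _ _ _ _ fun _ _ => le_rfl)
    (le_expect_nodeMixture _ _ _ _ _ _ _ fun _ _ => le_rfl)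

theorem nodeMixture_nonneg {T : ℕ} (ρ : ℝ) (lam v m : Fin T → ℝ) (t : Fin T) (n : ℕ)
    (σ x : GridPolicy) : 0 ≤ nodeMixture ρ lam v m n t σ x := by
  have h := le_expect_nodeMixture ρ lam v m t (g := fun y => if y = x then 1 else 0) (b := 0) n σ
    fun y _ => by split_ifs <;> norm_num
  have h1 : expect (nodeMixture ρ lam v m n t σ) (fun y => if y = x then 1 else 0)
      = nodeMixture ρ lam v m n t σ x := by
    simp only [expect, mul_ite, mul_one, mul_zero, Finsupp.sum_ite_self_eq']
  rwa [h1] at h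

/-- Causality: the weights of round `t` use cumulative rewards of earlier rounds only. This makes
the dual variables predictable, hence usable in a martingale. -/
theorem nodeMixture_congr {T : ℕ} (ρ : ℝ) {lam v m lam' v' m' : Fin T → ℝ} (n : ℕ) (t : Fin T)
    (σ : GridPolicy) (h : ∀ s < t, lam s = lam' s ∧ v s = v' s ∧ m s = m' s) :
    nodeMixture ρ lam v m n t σ = nodeMixture ρ lam' v' m' n t σ := by
  induction n generalizing t σ with
  | zero => rw [nodeMixture_zero, nodeMixture_zero]
  | succ n ih =>
    by_cases hσ : σ.level = levels T
    · rw [nodeMixture_terminal _ _ _ _ _ _ hσ, nodeMixture_terminal _ _ _ _ _ _ hσ]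
    · rw [nodeMixture_succ _ _ _ _ _ _ hσ, nodeMixture_succ _ _ _ _ _ _ hσ]
      have hc : cumReward ρ lam v m n t = cumReward ρ lam' v' m' n t := by
        funext π
        refine Finset.sum_congr rfl fun s hs => ?_
        have hs := Finset.mem_Iio.1 hs
        obtain ⟨h1, h2, h3⟩ := h s hs
        rw [ih s π fun r hr => h r (hr.trans hs), h1, h2, h3]
      rw [hc]
      exact Finset.sum_congr rfl fun π _ => by rw [ih t π h]

/-! ### The dual variables -/

theorem expectedPayment_congr {T : ℕ} (ρ : ℝ) {lam v m lam' v' m' : Fin T → ℝ} (t : Fin T)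
    (h : ∀ s ≤ t, lam s = lam' s ∧ v s = v' s ∧ m s = m' s) :
    expectedPayment ρ lam v m t = expectedPayment ρ lam' v' m' t := by
  obtain ⟨h1, h2, h3⟩ := h t le_rfl
  rw [expectedPayment, expectedPayment, rootMixture, rootMixture,
    nodeMixture_congr ρ (levels T) t (root T) fun s hs => h s hs.le, h1, h2, h3]

theorem dualPath_stable {T : ℕ} (ρ : ℝ) (v m : Fin T → ℝ) {n k : ℕ} (hnk : n ≤ k) {i : Fin T}
    (hi : (i : ℕ) ≤ n) : dualPath ρ v m k i = dualPath ρ v m n i := by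
  induction k, hnk using Nat.le_induction with
  | base => rfl
  | succ k hk ih =>
    rw [dualPath]
    split_ifs with h
    · rw [Function.update_of_ne (by intro he; subst he; simp at hi; omega), ih]
    · exact ih

theorem dualVar_eq {T : ℕ} (ρ : ℝ) (v m : Fin T → ℝ) {n : ℕ} {i : Fin T} (hi : (i : ℕ) ≤ n)
    (hn : n ≤ T) : dualVar ρ v m i = dualPath ρ v m n i := dualPath_stable ρ v m hn hi

theorem dualVar_zero {T : ℕ} (ρ : ℝ) (v m : Fin T → ℝ) (h : 0 < T) :
    dualVar ρ v m ⟨0, h⟩ = 1 / (2 * ρ) := by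
  rw [dualVar_eq ρ v m (n := 0) le_rfl (by omega)]
  rfl

/-- The update sees only the partial path computed so far; by causality of the expected payment it
can be replaced by the complete sequence, which gives a closed recursion. -/
theorem dualVar_succ {T : ℕ} (ρ : ℝ) (v m : Fin T → ℝ) {n : ℕ} (h : n + 1 < T) :
    dualVar ρ v m ⟨n + 1, h⟩ = omdStep (1 / ρ) (dualRate T)
      (dualVar ρ v m ⟨n, Nat.lt_of_succ_lt h⟩)
      (ρ - expectedPayment ρ (dualVar ρ v m) v m ⟨n, Nat.lt_of_succ_lt h⟩) := by
  rw [dualVar_eq ρ v m (n := n + 1) le_rfl h.le, dualPath, dif_pos h, Function.update_self,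
    ← dualVar_eq ρ v m (i := ⟨n, Nat.lt_of_succ_lt h⟩) le_rfl (by omega)]
  congr 2
  refine expectedPayment_congr ρ _ fun s hs => ⟨?_, rfl, rfl⟩
  exact (dualVar_eq ρ v m (Fin.le_def.1 hs) (by omega)).symm

theorem dualVar_mem {T : ℕ} {ρ : ℝ} (hρ : 0 < ρ) (v m : Fin T → ℝ) (t : Fin T) :
    dualVar ρ v m t ∈ Set.Ioo 0 (1 / ρ) := by
  obtain ⟨n, hn⟩ := t
  induction n with
  | zero =>
    rw [dualVar_zero]
    exact ⟨by positivity, by gcongr; linarith⟩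
  | succ n ih =>
    rw [dualVar_succ]
    exact omdStep_mem _ _ (ih _).1 (ih _).2

/-- The dual variable of a round depends on the previous requests only. -/
theorem dualVar_congr {T : ℕ} (ρ : ℝ) {v m v' m' : Fin T → ℝ} (t : Fin T)
    (h : ∀ s < t, v s = v' s ∧ m s = m' s) : dualVar ρ v m t = dualVar ρ v' m' t := by
  obtain ⟨n, hn⟩ := t
  induction n using Nat.strong_induction_on with
  | _ n ih =>
    cases n with
    | zero => rw [dualVar_zero, dualVar_zero]
    | succ n =>
      have hlt : (⟨n, Nat.lt_of_succ_lt hn⟩ : Fin T) < ⟨n + 1, hn⟩ := by simp [Fin.lt_def]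
      have hd : ∀ s ≤ (⟨n, Nat.lt_of_succ_lt hn⟩ : Fin T), dualVar ρ v m s = dualVar ρ v' m' s := by
        intro s hs
        exact ih s (Nat.lt_succ_of_le (Fin.le_def.1 hs)) s.2 fun r hr =>
          h r (lt_of_lt_of_le hr (hs.trans hlt.le))
      rw [dualVar_succ, dualVar_succ, hd _ le_rfl]
      congr 2
      exact expectedPayment_congr ρ _ fun s hs => ⟨hd s hs, h s (lt_of_le_of_lt hs hlt)⟩

/-! ### Regret of the dual player -/

/-- Sum over the first `n` rounds. -/
def prefixSum {T : ℕ} (n : ℕ) (f : Fin T → ℝ) : ℝ := ∑ t : Fin T, if (t : ℕ) < n then f t else 0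

theorem prefixSum_zero {T : ℕ} (f : Fin T → ℝ) : prefixSum 0 f = 0 := by simp [prefixSum]

theorem prefixSum_succ {T : ℕ} (f : Fin T → ℝ) {n : ℕ} (h : n < T) :
    prefixSum (n + 1) f = prefixSum n f + f ⟨n, h⟩ := by
  have h1 : f ⟨n, h⟩ = ∑ t : Fin T, if t = ⟨n, h⟩ then f t else 0 := by simp
  rw [h1, prefixSum, prefixSum, ← Finset.sum_add_distrib]
  refine Finset.sum_congr rfl fun t _ => ?_
  rcases lt_trichotomy (t : ℕ) n with h2 | h2 | h2
  · simp [h2, h2.trans n.lt_succ_self, Fin.ext_iff, h2.ne]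
  · simp [h2, Fin.ext_iff]
  · simp [h2.not_gt, Fin.ext_iff, h2.ne', show ¬ (t : ℕ) < n + 1 by omega]

theorem prefixSum_full {T : ℕ} (f : Fin T → ℝ) : prefixSum T f = ∑ t, f t := by
  simp [prefixSum]

theorem prefixSum_le_prefixSum {T : ℕ} {n : ℕ} {f g : Fin T → ℝ} (h : ∀ t, f t ≤ g t) :
    prefixSum n f ≤ prefixSum n g :=
  Finset.sum_le_sum fun t _ => by split_ifs; exacts [h t, le_rfl]

theorem prefixSum_add {T : ℕ} (n : ℕ) (f g : Fin T → ℝ) :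
    prefixSum n (fun t => f t + g t) = prefixSum n f + prefixSum n g := by
  rw [prefixSum, prefixSum, prefixSum, ← Finset.sum_add_distrib]
  exact Finset.sum_congr rfl fun t _ => by split_ifs <;> simp

theorem prefixSum_sub {T : ℕ} (n : ℕ) (f g : Fin T → ℝ) :
    prefixSum n (fun t => f t - g t) = prefixSum n f - prefixSum n g := by
  rw [prefixSum, prefixSum, prefixSum, ← Finset.sum_sub_distrib]
  exact Finset.sum_congr rfl fun t _ => by split_ifs <;> simp

theorem prefixSum_mul {T : ℕ} (n : ℕ) (c : ℝ) (f : Fin T → ℝ) :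
    prefixSum n (fun t => c * f t) = c * prefixSum n f := by
  rw [prefixSum, prefixSum, Finset.mul_sum]
  exact Finset.sum_congr rfl fun t _ => by split_ifs <;> simp

theorem prefixSum_const {T : ℕ} {n : ℕ} (hn : n ≤ T) (c : ℝ) :
    prefixSum n (fun _ : Fin T => c) = n * c := by
  induction n with
  | zero => simp [prefixSum_zero]
  | succ n ih => rw [prefixSum_succ _ hn, ih (by omega)]; push_cast; ring

theorem prefixSum_congr {T : ℕ} {n : ℕ} {f g : Fin T → ℝ} (h : ∀ t, f t = g t) :
    prefixSum n f = prefixSum n g := by rw [funext h]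

/-- Regret of the dual player against the two extreme dual variables. -/
theorem omd_regret {T : ℕ} (hT : 2 ≤ T) {S : ℝ} (hS : 0 < S) (lam g : Fin T → ℝ)
    (h0 : lam ⟨0, by omega⟩ = S / 2)
    (hstep : ∀ n (h : n + 1 < T), lam ⟨n + 1, h⟩ =
      omdStep S (dualRate T) (lam ⟨n, Nat.lt_of_succ_lt h⟩) (g ⟨n, Nat.lt_of_succ_lt h⟩))
    (hg : ∀ t, |g t| ≤ 1) (n : ℕ) (hn : n ≤ T) :
    prefixSum n (fun t => lam t * g t) ≤ 2 * S * Real.sqrt T ∧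
    prefixSum n (fun t => lam t * g t) ≤ S * prefixSum n g + 2 * S * Real.sqrt T := by
  have hT0 : (0 : ℝ) < T := by exact_mod_cast (by omega : 0 < T)
  have hT2 : (2 : ℝ) ≤ T := by exact_mod_cast hT
  have hl2 : 0 < Real.log 2 := Real.log_pos (by norm_num)
  have hl2' : Real.log 2 ≤ 1 := by linarith [Real.log_two_lt_d9]
  set e := dualRate T with he
  have he0 : 0 < e := Real.sqrt_pos.2 (by positivity)
  have hesq : e ^ 2 * T = Real.log 2 := by
    rw [he, dualRate, Real.sq_sqrt (by positivity)]; field_simp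
  have he1 : e ≤ 1 := by
    rw [he, dualRate, ← Real.sqrt_one]
    exact Real.sqrt_le_sqrt (by rw [div_le_one hT0]; linarith)
  set f : ℝ → ℝ → ℝ := fun l γ => omdStep S e l γ
  -- The step is exponential weights on the endpoints `0` and `S` with weights `1 - l / S` and `l /
  -- S`. Both share the normalizer `Z`, which is estimated to second order.
  have one_step : ∀ l γ : ℝ, 0 < l → l < S → |γ| ≤ 1 →
      Real.log (S - f l γ) ≥ Real.log (S - l) + e * (l / S) * γ - e ^ 2 ∧
      Real.log (f l γ) ≥ Real.log l - e * γ + e * (l / S) * γ - e ^ 2 := by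
    intro l γ hl hlS hγ
    have hp : 0 < S - l := sub_pos.2 hlS
    have hE := Real.exp_pos (-(e * γ))
    set Z := (l * Real.exp (-(e * γ)) + (S - l)) / S with hZ
    have hZ0 : 0 < Z := by positivity
    have hne : l * Real.exp (-(e * γ)) + (S - l) ≠ 0 := by positivity
    have e1 : f l γ = l * Real.exp (-(e * γ)) / Z := by
      simp only [f, hZ, omdStep]; field_simp
    have e2 : S - f l γ = (S - l) / Z := by
      simp only [f, hZ, omdStep]; field_simp; ring
    have hab : |(-(e * γ))| ≤ 1 := by
      rw [abs_neg, abs_mul, abs_of_pos he0]; exact mul_le_one₀ he1 (abs_nonneg _) hγ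
    have h1 := (abs_le.1 (Real.abs_exp_sub_one_sub_id_le hab)).2
    have hγ2 : γ ^ 2 ≤ 1 := (sq_le_one_iff_abs_le_one γ).2 hγ
    have hlS1 : l / S ≤ 1 := (div_le_one hS).2 hlS.le
    have hlS0 : 0 < l / S := by positivity
    have hlogZ : Real.log Z ≤ -(e * (l / S) * γ) + e ^ 2 := by
      have h2 := Real.log_le_sub_one_of_pos hZ0
      have h3 : Z - 1 = l / S * (Real.exp (-(e * γ)) - 1) := by rw [hZ]; field_simp; ring
      have h4 : Real.exp (-(e * γ)) - 1 ≤ -(e * γ) + e ^ 2 := by nlinarith [sq_nonneg e]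
      have h5 := mul_le_mul_of_nonneg_left h4 hlS0.le
      nlinarith [sq_nonneg e]
    rw [e2, e1, Real.log_div hp.ne' hZ0.ne', Real.log_div (by positivity) hZ0.ne',
      Real.log_mul hl.ne' hE.ne', Real.log_exp]
    constructor <;> linarith
  have hmem : ∀ n (h : n < T), lam ⟨n, h⟩ ∈ Set.Ioo 0 S := by
    intro n
    induction n with
    | zero => intro h; rw [h0]; exact ⟨by positivity, by linarith⟩
    | succ n ih =>
      intro h
      rw [hstep]
      exact omdStep_mem _ _ (ih _).1 (ih _).2
  -- The iterate following the last round is not an entry of `lam`, hence the separate witness `y`.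
  have key : ∀ n ≤ T, ∃ y ∈ Set.Ioo 0 S, (∀ h : n < T, y = lam ⟨n, h⟩) ∧
      Real.log (S - y) ≥ Real.log (S / 2) + e / S * prefixSum n (fun t => lam t * g t)
        - n * e ^ 2 ∧
      Real.log y ≥ Real.log (S / 2) - e * prefixSum n g
        + e / S * prefixSum n (fun t => lam t * g t) - n * e ^ 2 := by
    intro n
    induction n with
    | zero =>
      intro _
      refine ⟨S / 2, ⟨by positivity, by linarith⟩, fun _ => h0.symm, ?_, ?_⟩
      · rw [prefixSum_zero]; simp; exact le_of_eq (by ring_nf)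
      · rw [prefixSum_zero, prefixSum_zero]; simp
    | succ n ih =>
      intro h
      obtain ⟨y, hy, hyl, hy1, hy2⟩ := ih (by omega)
      have hyl := hyl h
      obtain ⟨s1, s2⟩ := one_step y (g ⟨n, h⟩) hy.1 hy.2 (hg _)
      refine ⟨f y (g ⟨n, h⟩), omdStep_mem _ _ hy.1 hy.2, fun h' => ?_, ?_, ?_⟩
      · rw [hstep n h', hyl]
      · rw [prefixSum_succ _ h, ← hyl]
        have : e / S * (prefixSum n (fun t => lam t * g t) + y * g ⟨n, h⟩)
          = e / S * prefixSum n (fun t => lam t * g t) + e * (y / S) * g ⟨n, h⟩ := by ring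
        push_cast; linarith
      · rw [prefixSum_succ _ h, prefixSum_succ _ h, ← hyl]
        have : e / S * (prefixSum n (fun t => lam t * g t) + y * g ⟨n, h⟩)
          = e / S * prefixSum n (fun t => lam t * g t) + e * (y / S) * g ⟨n, h⟩ := by ring
        push_cast; linarith
  -- Both weights start at `S / 2` and never exceed `S`: the weight of endpoint `0` yields the first
  -- bound, that of endpoint `S` the second.
  obtain ⟨y, hy, -, hy1, hy2⟩ := key n hn
  have hlogS : Real.log (S / 2) = Real.log S - Real.log 2 := Real.log_div hS.ne' (by norm_num)
  have hu1 : Real.log (S - y) ≤ Real.log S := Real.log_le_log (sub_pos.2 hy.2) (by linarith [hy.1])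
  have hu2 : Real.log y ≤ Real.log S := Real.log_le_log hy.1 hy.2.le
  have hne2 : n * e ^ 2 ≤ Real.log 2 := by
    rw [← hesq, mul_comm]
    exact mul_le_mul_of_nonneg_left (by exact_mod_cast hn) (sq_nonneg e)
  have hsq := Real.sq_sqrt hT0.le
  have hsT : 0 ≤ Real.sqrt T := Real.sqrt_nonneg _
  have hfin : 2 * Real.log 2 ≤ e / S * (2 * S * Real.sqrt T) := by
    have h1 : e / S * (2 * S * Real.sqrt T) = 2 * (e * Real.sqrt T) := by field_simp
    have h2 : e * Real.sqrt T = Real.sqrt (Real.log 2) := by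
      rw [he, dualRate, ← Real.sqrt_mul (by positivity)]; congr 1; field_simp
    have h3 : Real.log 2 ≤ Real.sqrt (Real.log 2) := by
      rw [Real.le_sqrt hl2.le hl2.le]; nlinarith
    rw [h1, h2]; linarith
  have heS : 0 < e / S := by positivity
  constructor
  · refine le_of_mul_le_mul_left ?_ heS
    linarith
  · refine le_of_mul_le_mul_left ?_ heS
    have : e / S * (S * prefixSum n g + 2 * S * Real.sqrt T)
      = e * prefixSum n g + e / S * (2 * S * Real.sqrt T) := by field_simp
    linarith

/-! ### Final policies below a node -/

/-- Bid of `σ` at the grid point of index `k`, truncated to the grid. -/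
def bidAt (σ : GridPolicy) (k : ℕ) : ℕ :=
  σ.bid ⟨min k (2 ^ σ.level), Nat.lt_succ_of_le (min_le_right _ _)⟩

theorem bidAt_of_le (σ : GridPolicy) {k : ℕ} (hk : k ≤ 2 ^ σ.level) :
    bidAt σ k = σ.bid ⟨k, Nat.lt_succ_of_le hk⟩ := by
  unfold bidAt
  congr 2
  exact min_eq_left hk

/-- One-sided `2`-Lipschitz comparison (from above for `s = 1`, from below for `s = -1`) of a finer
policy `x` with the values of `σ` on its coarser grid. -/
def Near (T : ℕ) (s : ℝ) (σ x : GridPolicy) : Prop :=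
  σ.level ≤ x.level ∧ ∀ k ≤ 2 ^ x.level,
    s * (bidAt x k : ℝ) ≤ s * (bidAt σ (k / 2 ^ (x.level - σ.level)) : ℝ)
      + 2 * T * ((k % 2 ^ (x.level - σ.level) : ℕ) : ℝ) / 2 ^ x.level

theorem near_refl (T : ℕ) (s : ℝ) (σ : GridPolicy) : Near T s σ σ := by
  refine ⟨le_rfl, fun k _ => ?_⟩
  simp [Nat.mod_one]

/-- Offsets add: the offset of `k` in its coarse cell is its offset in the intermediate cell plus
the offset of that cell. Hence the slope `2` is preserved along a chain of refinements. -/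
theorem Near.trans {T : ℕ} {s : ℝ} {σ τ x : GridPolicy} (h1 : Near T s σ τ) (h2 : Near T s τ x) :
    Near T s σ x := by
  obtain ⟨l1, h1⟩ := h1
  obtain ⟨l2, h2⟩ := h2
  refine ⟨l1.trans l2, fun k hk => ?_⟩
  obtain ⟨a, ha⟩ := Nat.exists_eq_add_of_le l1
  obtain ⟨b, hb⟩ := Nat.exists_eq_add_of_le l2
  have e1 : τ.level - σ.level = a := by omega
  have e2 : x.level - τ.level = b := by omega
  have e3 : x.level - σ.level = b + a := by omega
  have hk' : k / 2 ^ b ≤ 2 ^ τ.level := by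
    rw [Nat.div_le_iff_le_mul_add_pred (by positivity)]
    have : 2 ^ x.level = 2 ^ b * 2 ^ τ.level := by rw [hb, pow_add, mul_comm]
    omega
  have i1 := h1 _ hk'
  have i2 := h2 k hk
  rw [e1, Nat.div_div_eq_div_mul, ← pow_add] at i1
  rw [e2] at i2
  rw [e3]
  have hmod : k % 2 ^ (b + a) = k % 2 ^ b + 2 ^ b * (k / 2 ^ b % 2 ^ a) := by
    rw [pow_add, Nat.mod_mul]
  have e4 : (2 : ℝ) * T * ((k % 2 ^ (b + a) : ℕ) : ℝ) / 2 ^ x.level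
      = 2 * T * ((k % 2 ^ b : ℕ) : ℝ) / 2 ^ x.level
        + 2 * T * ((k / 2 ^ b % 2 ^ a : ℕ) : ℝ) / 2 ^ τ.level := by
    rw [hmod, hb, pow_add]
    push_cast
    field_simp
  linarith

theorem mem_edges_iff {T : ℕ} {σ π : GridPolicy} :
    π ∈ edges T σ ↔ π ∈ refinements T σ ∨ π = jump T σ := by
  simp [edges, or_comm]

theorem mem_discretized {T l : ℕ} {π : Fin (2 ^ l + 1) → ℕ} :
    π ∈ discretized T l ↔ (∀ k, π k ≤ T) ∧ ∀ k k', |(π k : ℝ) / T - (π k' : ℝ) / T| ≤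
      2 * |((k : ℕ) : ℝ) * (1 / 2) ^ l - ((k' : ℕ) : ℝ) * (1 / 2) ^ l| := by
  simp [discretized, Fintype.mem_piFinset]

theorem level_of_mem_refinements {T : ℕ} {σ π : GridPolicy} (h : π ∈ refinements T σ) :
    π.level = σ.level + 1 := by
  simp only [refinements, Finset.mem_image] at h
  obtain ⟨p, -, rfl⟩ := h
  rfl

/-- Policies of level `1` need not agree with the root, but the root bids the maximum `T`; only the
upper comparison holds there. -/
theorem near_root_of_mem_refinements {T : ℕ} {π : GridPolicy} (h : π ∈ refinements T (root T)) :
    Near T 1 (root T) π := by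
  simp only [refinements, Finset.mem_image, Finset.mem_filter, mem_discretized] at h
  obtain ⟨p, ⟨⟨hp, -⟩, -⟩, rfl⟩ := h
  refine ⟨by simp [root], fun k hk => ?_⟩
  have h1 : (p ⟨min k _, Nat.lt_succ_of_le (min_le_right _ _)⟩ : ℝ) ≤ T := by exact_mod_cast hp _
  have h2 : (0 : ℝ) ≤ 2 * T * ((k % 2 ^ ((root T).level + 1 - (root T).level) : ℕ) : ℝ)
    / 2 ^ ((root T).level + 1) := by positivity
  simp only [bidAt, one_mul]
  change _ ≤ (T : ℝ) + _
  linarith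

/-- A point of the finer grid is either an even point, where the bids coincide, or one step to the
right of one. -/
theorem near_of_mem_refinements {T : ℕ} (hT : 0 < T) {σ π : GridPolicy} (h : π ∈ refinements T σ)
    (h0 : σ.level ≠ 0) {s : ℝ} (hs : |s| = 1) : Near T s σ π := by
  simp only [refinements, Finset.mem_image, Finset.mem_filter, mem_discretized] at h
  obtain ⟨p, ⟨⟨-, hp⟩, hσ⟩, rfl⟩ := h
  replace hσ := hσ.resolve_left h0
  refine ⟨by simp, fun k hk => ?_⟩
  simp only at hk ⊢
  rw [bidAt_of_le _ hk]
  simp only [Nat.add_sub_cancel_left, pow_one]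
  have hk2 : k / 2 ≤ 2 ^ σ.level := by rw [pow_succ] at hk; omega
  rw [bidAt_of_le _ hk2, ← hσ]
  have h1 := hp ⟨k, Nat.lt_succ_of_le hk⟩ ⟨2 * (k / 2), by rw [pow_succ] at hk ⊢; omega⟩
  have hT' : (0 : ℝ) < T := by exact_mod_cast hT
  rw [← sub_div, abs_div, abs_of_pos hT', div_le_iff₀ hT', ← sub_mul, abs_mul] at h1
  simp only at h1
  have hk3 : ((k : ℕ) : ℝ) - ((2 * (k / 2) : ℕ) : ℝ) = ((k % 2 : ℕ) : ℝ) := by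
    rw [sub_eq_iff_eq_add]
    exact_mod_cast (by omega)
  rw [hk3, abs_of_nonneg (a := ((k % 2 : ℕ) : ℝ)) (by positivity),
    abs_of_nonneg (a := (1 / 2 : ℝ) ^ (σ.level + 1)) (by positivity)] at h1
  set a : ℝ := (p ⟨k, Nat.lt_succ_of_le hk⟩ : ℝ)
  set b : ℝ := (p ⟨2 * (k / 2), by rw [pow_succ] at hk ⊢; omega⟩ : ℝ)
  have h2 : s * (a - b) ≤ |a - b| := by
    calc s * (a - b) ≤ |s * (a - b)| := le_abs_self _
      _ = |a - b| := by rw [abs_mul, hs, one_mul]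
  have h3 : 2 * (((k % 2 : ℕ) : ℝ) * (1 / 2) ^ (σ.level + 1)) * T
      = 2 * T * ((k % 2 : ℕ) : ℝ) / 2 ^ (σ.level + 1) := by
    rw [one_div, inv_pow]; ring
  rw [h3] at h1
  linarith

theorem bidAt_jump (T : ℕ) (σ : GridPolicy) {k : ℕ} (hk : k ≤ 2 ^ levels T) :
    bidAt (jump T σ) k = bidAt σ (k / 2 ^ (levels T - σ.level))
      + ⌊2 * T * ((k % 2 ^ (levels T - σ.level) : ℕ) : ℝ) / 2 ^ levels T⌋₊ := by
  rw [bidAt_of_le (jump T σ) (k := k) hk]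
  change bidAt σ (k / 2 ^ (levels T - σ.level)) + ⌊_⌋₊ = _
  congr 2
  simp only
  rw [one_div, inv_pow]
  ring

theorem near_jump {T : ℕ} {σ : GridPolicy} (h : σ.level ≤ levels T) :
    Near T 1 σ (jump T σ) ∧ Near T (-1) σ (jump T σ) := by
  refine ⟨⟨h, fun k hk => ?_⟩, ⟨h, fun k hk => ?_⟩⟩
  all_goals
    rw [bidAt_jump T σ hk]
    change _ ≤ _ + 2 * T * ((k % 2 ^ (levels T - σ.level) : ℕ) : ℝ) / 2 ^ levels T
    have h1 := Nat.floor_le (show (0 : ℝ) ≤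
      2 * T * ((k % 2 ^ (levels T - σ.level) : ℕ) : ℝ) / 2 ^ levels T by positivity)
    have h2 : (0 : ℝ) ≤ (⌊2 * T * ((k % 2 ^ (levels T - σ.level) : ℕ) : ℝ) / 2 ^ levels T⌋₊ : ℝ) :=
      Nat.cast_nonneg _
    push_cast
    change _ ≤ _ * (bidAt σ (k / 2 ^ (levels T - σ.level)) : ℝ) + _
    linarith

/-- The nodes at which the depth of the remaining subtree is `n`. -/
structure IsNode (T n : ℕ) (σ : GridPolicy) : Prop where
  level : σ.level + n = levels T ∨ σ.level = levels T
  root : σ.level = 0 → σ = root T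

theorem IsNode.child {T n : ℕ} {σ π : GridPolicy} (h : IsNode T (n + 1) σ)
    (hσ : σ.level ≠ levels T) (hπ : π ∈ edges T σ) : IsNode T n π := by
  have hl := h.level.resolve_right hσ
  rcases mem_edges_iff.1 hπ with hr | rfl
  · have := level_of_mem_refinements hr
    exact ⟨Or.inl (by omega), fun h0 => by omega⟩
  · exact ⟨Or.inr rfl, fun h0 => by change levels T = 0 at h0; omega⟩

/-- Each edge stays in the cone of slope `2` to the right of every coarse grid point, and
`Near.trans` chains the edges. The root has no lower cone. -/
theorem leaves_near {T : ℕ} (hT : 0 < T) {n : ℕ} {σ : GridPolicy} (h : IsNode T n σ)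
    {x : GridPolicy} (hx : x ∈ leaves T n σ) :
    x.level = levels T ∧ Near T 1 σ x ∧ (σ.level ≠ 0 → Near T (-1) σ x) := by
  induction n generalizing σ with
  | zero =>
    obtain rfl : x = σ := hx
    exact ⟨by rcases h.level with h | h <;> simpa using h, near_refl _ _ _,
      fun _ => near_refl _ _ _⟩
  | succ n ih =>
    rw [leaves] at hx
    split_ifs at hx with hσ
    · obtain rfl : x = σ := hx
      exact ⟨hσ, near_refl _ _ _, fun _ => near_refl _ _ _⟩
    · simp only [Set.mem_iUnion] at hx
      obtain ⟨π, hπ, hx⟩ := hx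
      obtain ⟨h1, h2, h3⟩ := ih (h.child hσ hπ) hx
      have hl := h.level.resolve_right hσ
      refine ⟨h1, ?_, ?_⟩
      · refine Near.trans ?_ h2
        rcases mem_edges_iff.1 hπ with hr | rfl
        · by_cases h0 : σ.level = 0
          · obtain rfl := h.root h0
            exact near_root_of_mem_refinements hr
          · exact near_of_mem_refinements hT hr h0 (by simp)
        · exact (near_jump (by omega)).1
      · intro h0
        have hπ0 : π.level ≠ 0 := by
          rcases mem_edges_iff.1 hπ with hr | rfl
          · have := level_of_mem_refinements hr
            omega
          · change levels T ≠ 0; omega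
        refine Near.trans ?_ (h3 hπ0)
        rcases mem_edges_iff.1 hπ with hr | rfl
        · exact near_of_mem_refinements hT hr h0 (by simp)
        · exact (near_jump (by omega)).2

/-! ### The primal rewards -/

theorem thresholdBid_eq (T : ℕ) (x : GridPolicy) (v lam : ℝ) :
    thresholdBid T x v lam
      = min ((bidAt x ⌊v * 2 ^ x.level⌋₊ : ℝ) / T + 2 * (1 / 2) ^ x.level) (v / (1 + lam)) := rfl

theorem thresholdBid_nonneg (T : ℕ) (x : GridPolicy) {v lam : ℝ} (hv : 0 ≤ v) (hl : 0 ≤ lam) :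
    0 ≤ thresholdBid T x v lam := by
  rw [thresholdBid_eq]
  exact le_min (by positivity) (by positivity)

theorem one_add_mul_thresholdBid_le (T : ℕ) (x : GridPolicy) {v lam : ℝ} (hl : 0 ≤ lam) :
    (1 + lam) * thresholdBid T x v lam ≤ v := by
  have h : thresholdBid T x v lam ≤ v / (1 + lam) := min_le_right _ _
  rwa [le_div_iff₀ (by positivity), mul_comm] at h

theorem thresholdBid_le (T : ℕ) (x : GridPolicy) {v lam : ℝ} (hv : 0 ≤ v) (hl : 0 ≤ lam) :
    thresholdBid T x v lam ≤ v := by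
  nlinarith [one_add_mul_thresholdBid_le T x (v := v) hl, thresholdBid_nonneg T x hv hl]

theorem primalReward_nonneg (T : ℕ) (x : GridPolicy) {lam v m : ℝ} (hl : 0 ≤ lam) :
    0 ≤ primalReward T x lam v m := by
  unfold primalReward
  split_ifs
  · linarith [one_add_mul_thresholdBid_le T x (v := v) hl]
  · exact le_rfl

theorem primalReward_le_one (T : ℕ) (x : GridPolicy) {lam v m : ℝ} (hv0 : 0 ≤ v) (hv1 : v ≤ 1)
    (hl : 0 ≤ lam) : primalReward T x lam v m ≤ 1 := by
  unfold primalReward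
  split_ifs
  · nlinarith [thresholdBid_nonneg T x hv0 hl]
  · norm_num

theorem primalReward_eq (T : ℕ) (x : GridPolicy) (lam v m : ℝ) :
    primalReward T x lam v m = utility v m (thresholdBid T x v lam)
      - lam * payment m (thresholdBid T x v lam) := by
  unfold primalReward utility payment
  split_ifs <;> ring

/-- Bidding more is worse by at most the additional payment. -/
theorem primalReward_le_add {T : ℕ} {x y : GridPolicy} {lam v m S c : ℝ} (hl : 0 ≤ lam)
    (hS : lam ≤ S) (hc : 0 ≤ c) (h1 : thresholdBid T x v lam ≤ thresholdBid T y v lam)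
    (h2 : thresholdBid T y v lam ≤ thresholdBid T x v lam + c) :
    primalReward T x lam v m ≤ primalReward T y lam v m + (1 + S) * c := by
  by_cases hm : m ≤ thresholdBid T x v lam
  · unfold primalReward
    rw [if_pos hm, if_pos (hm.trans h1)]
    nlinarith
  -- If `x` loses, the higher bid may win, but the threshold `v / (1 + lam)` keeps its reward
  -- nonnegative.
  · have h3 := primalReward_nonneg T y (v := v) (m := m) hl
    have h4 : primalReward T x lam v m = 0 := by unfold primalReward; rw [if_neg hm]
    rw [h4]
    nlinarith

/-- All final policies below `σ` lie in a cone of height `2 ε` on each side of `σ`, and the jump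
policy is its upper edge. It dominates each of them, by at most `4 ε`, so its loss is at most `1 +
S` times that. -/
theorem jump_good_expert {T : ℕ} (hT : 0 < T) {n : ℕ} {σ x : GridPolicy} (h : IsNode T n σ)
    (hx : x ∈ leaves T n σ) {lam v m S : ℝ} (hl : 0 ≤ lam) (hS : lam ≤ S) (hv0 : 0 ≤ v)
    (hv1 : v ≤ 1) : primalReward T x lam v m
      ≤ primalReward T (jump T σ) lam v m + 4 * (1 + S) * (1 / 2) ^ σ.level := by
  have hT' : (0 : ℝ) < T := by exact_mod_cast hT
  obtain ⟨hxl, hup, hlo⟩ := leaves_near hT h hx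
  -- At the root the lower cone is missing, but rewards lie in `[0,1]` and the allowed gap is at
  -- least `4`.
  by_cases h0 : σ.level = 0
  · have h1 := primalReward_le_one T x (m := m) hv0 hv1 hl
    have h2 := primalReward_nonneg T (jump T σ) (v := v) (m := m) hl
    rw [h0, pow_zero]
    linarith
  have hle : σ.level ≤ levels T := hxl ▸ hup.1
  have hup := hup.2
  have hlo := (hlo h0).2
  rw [hxl] at hup hlo
  set k := ⌊v * 2 ^ levels T⌋₊ with hk
  have hkM : k ≤ 2 ^ levels T := by
    rw [hk]
    refine Nat.floor_le_of_le ?_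
    push_cast
    nlinarith [pow_pos (show (0 : ℝ) < 2 by norm_num) (levels T)]
  have e1 := hup k hkM
  have e2 := hlo k hkM
  have e3 := bidAt_jump T σ hkM
  set a : ℝ := 2 * T * ((k % 2 ^ (levels T - σ.level) : ℕ) : ℝ) / 2 ^ levels T with ha
  have ha0 : 0 ≤ a := by positivity
  have hfl := Nat.floor_le ha0
  have ha1 : a ≤ 2 * T * (1 / 2) ^ σ.level := by
    have h5 : ((k % 2 ^ (levels T - σ.level) : ℕ) : ℝ) ≤ 2 ^ (levels T - σ.level) := by
      exact_mod_cast (Nat.mod_lt _ (by positivity)).le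
    have h6 : (2 : ℝ) ^ levels T = 2 ^ (levels T - σ.level) * 2 ^ σ.level := by
      rw [← pow_add]; congr 1; omega
    rw [ha, div_le_iff₀ (by positivity), one_div, inv_pow, h6]
    calc 2 * T * ((k % 2 ^ (levels T - σ.level) : ℕ) : ℝ)
        ≤ 2 * T * 2 ^ (levels T - σ.level) := by gcongr
      _ = _ := by field_simp
  -- Bids are integers in units of `1 / T`, so an excess of at most `a` is one of at most `⌊a⌋₊`:
  -- the rounding in `jump` does not destroy domination.
  have hge : bidAt x k ≤ bidAt (jump T σ) k := by
    rw [e3]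
    rcases le_or_gt (bidAt x k) (bidAt σ (k / 2 ^ (levels T - σ.level))) with h7 | h7
    · omega
    · obtain ⟨b, hb⟩ := Nat.exists_eq_add_of_lt h7
      have : b + 1 ≤ ⌊a⌋₊ := Nat.le_floor (by rw [hb] at e1; push_cast at e1 ⊢; linarith)
      omega
  have hge' : (bidAt x k : ℝ) ≤ bidAt (jump T σ) k := by exact_mod_cast hge
  have hle' : (bidAt (jump T σ) k : ℝ) ≤ bidAt x k + 4 * T * (1 / 2) ^ σ.level := by
    rw [e3]; push_cast; linarith
  have hbx : thresholdBid T x v lam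
      = min ((bidAt x k : ℝ) / T + 2 * (1 / 2) ^ levels T) (v / (1 + lam)) := by
    rw [thresholdBid_eq, hxl]
  have hbj : thresholdBid T (jump T σ) v lam
      = min ((bidAt (jump T σ) k : ℝ) / T + 2 * (1 / 2) ^ levels T) (v / (1 + lam)) := rfl
  have hc : (0 : ℝ) ≤ 4 * (1 / 2) ^ σ.level := by positivity
  have hle2 : (bidAt (jump T σ) k : ℝ) / T ≤ (bidAt x k : ℝ) / T + 4 * (1 / 2) ^ σ.level := by
    rw [div_add' _ _ _ hT'.ne']; gcongr; linarith
  have := primalReward_le_add (T := T) (x := x) (y := jump T σ) (m := m) hl hS hc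
    (by rw [hbx, hbj]; gcongr)
    (by
      rw [hbx, hbj, ← min_add_add_right]
      exact min_le_min (by linarith) (by linarith))
  linarith

/-! ### Regret at a node -/

/-- Expected reward in round `t` of the mixture of the node `σ`. -/
def nodeReward {T : ℕ} (ρ : ℝ) (lam v m : Fin T → ℝ) (n : ℕ) (t : Fin T) (σ : GridPolicy) : ℝ :=
  expect (nodeMixture ρ lam v m n t σ) fun x => primalReward T x (lam t) (v t) (m t)

theorem sum_range_dite {T : ℕ} (f : Fin T → ℝ) {n : ℕ} (hn : n ≤ T) :
    ∑ t ∈ Finset.range n, (if h : t < T then f ⟨t, h⟩ else 0) = prefixSum n f := by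
  induction n with
  | zero => simp [prefixSum_zero]
  | succ n ih => rw [Finset.sum_range_succ, ih (by omega), prefixSum_succ _ hn, dif_pos]

theorem sum_Iio_eq_prefixSum {T : ℕ} (f : Fin T → ℝ) (t : Fin T) :
    ∑ s ∈ Finset.Iio t, f s = prefixSum t f := by
  rw [prefixSum, ← Finset.sum_filter]
  refine Finset.sum_congr ?_ fun _ _ => rfl
  ext s
  simp

/-- The experts of `hedge_regret` are the children, each with the expected reward of its own
mixture, set to `0` after round `T`. The jump child is terminal, hence a fixed policy, and it is
compared with each mixture leaf by leaf. -/
theorem node_regret {T : ℕ} (hT : 0 < T) {ρ : ℝ} (hρ : 0 < ρ) {lam v m : Fin T → ℝ}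
    (hl0 : ∀ t, 0 ≤ lam t) (hl1 : ∀ t, lam t ≤ 1 / ρ) (hv0 : ∀ t, 0 ≤ v t) (hv1 : ∀ t, v t ≤ 1)
    {n : ℕ} {σ π : GridPolicy} (h : IsNode T (n + 1) σ) (hσ : σ.level ≠ levels T)
    (hπ : π ∈ edges T σ) {k : ℕ} (hk : k ≤ T) :
    prefixSum k (fun t => nodeReward ρ lam v m n t π)
        - prefixSum k (fun t => nodeReward ρ lam v m (n + 1) t σ)
      ≤ 8 * Real.log (edges T σ).card + 10 * Real.sqrt (Real.log (edges T σ).card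
          * (4 * (1 + 1 / ρ) * (1 / 2) ^ σ.level) * (k + 1)) := by
  set g : ℕ → GridPolicy → ℝ := fun t π =>
    if h : t < T then nodeReward ρ lam v m n ⟨t, h⟩ π else 0 with hg
  have hg0 : ∀ t, ∀ i ∈ edges T σ, 0 ≤ g t i := fun t i _ => by
    simp only [hg]
    split_ifs
    · exact le_expect_nodeMixture _ _ _ _ _ _ _ fun x _ => primalReward_nonneg T x (hl0 _)
    · exact le_rfl
  have hg1 : ∀ t, ∀ i ∈ edges T σ, g t i ≤ 1 := fun t i _ => by
    simp only [hg]
    split_ifs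
    · exact expect_nodeMixture_le _ _ _ _ _ _ _ fun x _ =>
        primalReward_le_one T x (hv0 _) (hv1 _) (hl0 _)
    · exact zero_le_one
  have hΔ : 0 < 4 * (1 + 1 / ρ) * (1 / 2 : ℝ) ^ σ.level := by positivity
  have hgJ : ∀ t, ∀ i ∈ edges T σ,
      g t i ≤ g t (jump T σ) + 4 * (1 + 1 / ρ) * (1 / 2) ^ σ.level := fun t i hi => by
    simp only [hg]
    split_ifs with ht
    · have e : nodeReward ρ lam v m n ⟨t, ht⟩ (jump T σ)
          = primalReward T (jump T σ) (lam ⟨t, ht⟩) (v ⟨t, ht⟩) (m ⟨t, ht⟩) := by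
        rw [nodeReward, nodeMixture_terminal _ _ _ _ _ _ rfl, expect_single]
      rw [e]
      refine expect_nodeMixture_le _ _ _ _ _ _ _ fun x hx => ?_
      exact jump_good_expert hT h (by
        simp only [leaves, if_neg hσ, Set.mem_iUnion]; exact ⟨i, hi, hx⟩)
        (hl0 _) (hl1 _) (hv0 _) (hv1 _)
    · linarith
  have main := hedge_regret hg0 hg1 (jump_mem_edges T σ) hΔ hgJ k hπ
  rw [sum_range_dite (fun t => nodeReward ρ lam v m n t π) hk] at main
  convert main using 2
  rw [← sum_range_dite (fun t => nodeReward ρ lam v m (n + 1) t σ) hk]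
  refine Finset.sum_congr rfl fun t ht => ?_
  have htT : t < T := (Finset.mem_range.1 ht).trans_le hk
  rw [dif_pos htT, nodeReward, nodeMixture_succ _ _ _ _ _ _ hσ, expect_sum_smul]
  have hc : cumReward ρ lam v m n ⟨t, htT⟩ = fun j => ∑ s ∈ Finset.range t, g s j := by
    funext j
    exact (sum_Iio_eq_prefixSum _ _).trans
      (sum_range_dite (fun t => nodeReward ρ lam v m n t j) htT.le).symm
  refine Finset.sum_congr rfl fun j _ => ?_
  rw [expWeight_eq_softmax, hc]
  simp only [hg, dif_pos htT]
  rfl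

/-- An edge is given by at most `2 ^ (l + 1) + 1` bids out of `T + 1`. The growth `2 ^ l` cancels
against `Δ_l`, so that the square-root term of the regret is the same at all levels. -/
theorem log_card_edges_le {T : ℕ} (hT : 2 ≤ T) (σ : GridPolicy) :
    Real.log (edges T σ).card ≤ 8 * 2 ^ σ.level * Real.log T := by
  have h1 : (edges T σ).card ≤ (T + 1) ^ (2 ^ (σ.level + 1) + 1) + 1 := by
    refine (Finset.card_union_le _ _).trans ?_
    rw [Finset.card_singleton]
    refine Nat.add_le_add_right ?_ 1
    refine Finset.card_image_le.trans ((Finset.card_filter_le _ _).trans ?_)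
    refine (Finset.card_filter_le _ _).trans ?_
    simp [Fintype.card_piFinset]
  have h2 : (edges T σ).card ≤ (T ^ 2) ^ (2 ^ (σ.level + 1) + 2) := by
    have h3 : 1 ≤ (T + 1) ^ (2 ^ (σ.level + 1) + 1) := Nat.one_le_pow _ _ (by omega)
    calc _ ≤ (T + 1) ^ (2 ^ (σ.level + 1) + 1) + 1 := h1
      _ ≤ (T + 1) ^ (2 ^ (σ.level + 1) + 1) * (T + 1) := by nlinarith
      _ = (T + 1) ^ (2 ^ (σ.level + 1) + 2) := by rw [← pow_succ]
      _ ≤ _ := Nat.pow_le_pow_left (by nlinarith) _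
  have hT0 : 0 ≤ Real.log T := Real.log_natCast_nonneg T
  have h4 : Real.log (edges T σ).card ≤ Real.log (((T ^ 2) ^ (2 ^ (σ.level + 1) + 2) : ℕ) : ℝ) :=
    Real.log_le_log (by exact_mod_cast (edges_nonempty T σ).card_pos) (by exact_mod_cast h2)
  refine h4.trans ?_
  push_cast
  rw [Real.log_pow, Real.log_pow]
  push_cast
  have h5 : (1 : ℝ) ≤ 2 ^ σ.level := one_le_pow₀ (by norm_num)
  rw [pow_succ]
  nlinarith

/-! ### The comparator -/

/-- Grid points need not lie in `V`, so a policy is extended to the line before it is discretized;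
clipping to `[0,1]` keeps it `1`-Lipschitz. -/
theorem exists_lipschitz_extension {V : Set ℝ} (π : LipPolicy V) :
    ∃ g : ℝ → ℝ, (∀ x y, |g x - g y| ≤ |x - y|) ∧ (∀ x, 0 ≤ g x) ∧ (∀ x, g x ≤ 1) ∧
      ∀ v : V, g v = (π.1 v : ℝ) := by
  classical
  have h : LipschitzOnWith 1 (fun x : ℝ => if hx : x ∈ V then (π.1 ⟨x, hx⟩ : ℝ) else 0) V := by
    refine LipschitzOnWith.of_dist_le_mul fun x hx y hy => ?_
    rw [dif_pos hx, dif_pos hy]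
    exact π.2.dist_le_mul ⟨x, hx⟩ ⟨y, hy⟩
  obtain ⟨g, hg, hgV⟩ := h.extend_real
  refine ⟨fun x => max 0 (min 1 (g x)), fun x y => ?_, fun x => le_max_left _ _,
    fun x => max_le zero_le_one (min_le_left _ _), fun v => ?_⟩
  · have h2 := hg.dist_le_mul x y
    rw [Real.dist_eq, Real.dist_eq, NNReal.coe_one, one_mul] at h2
    calc |max 0 (min 1 (g x)) - max 0 (min 1 (g y))|
        ≤ |min 1 (g x) - min 1 (g y)| := by
          simpa using abs_max_sub_max_le_max (0 : ℝ) (min 1 (g x)) 0 (min 1 (g y))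
      _ ≤ |g x - g y| := by
          simpa using abs_min_sub_min_le_max (1 : ℝ) (g x) 1 (g y)
      _ ≤ _ := h2
  · have h3 := hgV v.2
    simp only [dif_pos v.2] at h3
    change max 0 (min 1 (g v)) = _
    rw [← h3]
    exact (congrArg _ (min_eq_right (π.1 v).2.2)).trans (max_eq_right (π.1 v).2.1)

/-- Discretization of `g` on the grid of level `l`. -/
def gridOf (T : ℕ) (g : ℝ → ℝ) (l : ℕ) : GridPolicy :=
  ⟨l, fun k => ⌊T * g (((k : ℕ) : ℝ) * (1 / 2) ^ l)⌋₊⟩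

/-- The path of the tree that leads to the discretization of `g`. -/
def pathNode (T : ℕ) (g : ℝ → ℝ) (l : ℕ) : GridPolicy := if l = 0 then root T else gridOf T g l

theorem pathNode_level (T : ℕ) (g : ℝ → ℝ) (l : ℕ) : (pathNode T g l).level = l := by
  unfold pathNode
  split_ifs with h
  · exact h.symm
  · rfl

theorem two_pow_levels_le {T : ℕ} (hT : 1 ≤ T) : (2 : ℝ) ^ levels T ≤ Real.sqrt T := by
  have hs : 1 ≤ Real.sqrt T := Real.one_le_sqrt.2 (by exact_mod_cast hT)
  have h1 : (levels T : ℝ) ≤ Real.logb 2 (Real.sqrt T) :=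
    Nat.floor_le (Real.logb_nonneg (by norm_num) hs)
  rwa [Real.le_logb_iff_rpow_le (by norm_num) (by linarith), Real.rpow_natCast] at h1

theorem sqrt_lt_two_pow_levels {T : ℕ} (hT : 1 ≤ T) : Real.sqrt T < 2 ^ (levels T + 1) := by
  have hs : 1 ≤ Real.sqrt T := Real.one_le_sqrt.2 (by exact_mod_cast hT)
  have h1 : Real.logb 2 (Real.sqrt T) < levels T + 1 := Nat.lt_floor_add_one _
  rw [Real.logb_lt_iff_lt_rpow (by norm_num) (by linarith)] at h1
  rw [← Real.rpow_natCast]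
  exact_mod_cast h1

/-- Rounding changes a difference of bids by at most `1 / T`, and distinct grid points are at least
`ε_l ≥ 1 / T` apart; the slope `2` instead of `1` absorbs this. -/
theorem gridOf_mem_discretized {T : ℕ} (hT : 1 ≤ T) {g : ℝ → ℝ} (hg : ∀ x y, |g x - g y| ≤ |x - y|)
    (hg0 : ∀ x, 0 ≤ g x) (hg1 : ∀ x, g x ≤ 1) {l : ℕ} (hl : l ≤ levels T) :
    (gridOf T g l).bid ∈ discretized T l := by
  have hT' : (0 : ℝ) < T := by exact_mod_cast hT
  have hstep : 1 / (T : ℝ) ≤ (1 / 2) ^ l := by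
    have h1 := two_pow_levels_le hT
    have h2 : (2 : ℝ) ^ l ≤ 2 ^ levels T := pow_le_pow_right₀ (by norm_num) hl
    have h3 : Real.sqrt T ≤ T := by
      rw [Real.sqrt_le_left hT'.le]
      have : (1 : ℝ) ≤ T := by exact_mod_cast hT
      nlinarith
    rw [one_div_pow]
    exact one_div_le_one_div_of_le (by positivity) (h2.trans (h1.trans h3))
  refine mem_discretized.2 ⟨fun k => Nat.floor_le_of_le (by nlinarith [hg1 (((k : ℕ) : ℝ) * (1 / 2) ^ l)]),
    fun k k' => ?_⟩
  by_cases hk : k = k'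
  · subst hk; simp
  set u := ((k : ℕ) : ℝ) * (1 / 2) ^ l
  set u' := ((k' : ℕ) : ℝ) * (1 / 2) ^ l
  have hsep : (1 / 2 : ℝ) ^ l ≤ |u - u'| := by
    rw [← sub_mul, abs_mul, abs_of_nonneg (a := (1 / 2 : ℝ) ^ l) (by positivity)]
    have h1 : (1 : ℝ) ≤ |((k : ℕ) : ℝ) - ((k' : ℕ) : ℝ)| := by
      have h2 : ((k : ℕ) : ℤ) - ((k' : ℕ) : ℤ) ≠ 0 := by
        rw [sub_ne_zero]; exact_mod_cast fun h => hk (Fin.ext h)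
      have h3 := Int.one_le_abs h2
      exact_mod_cast h3
    have h4 : (0 : ℝ) < (1 / 2) ^ l := by positivity
    nlinarith
  have hgu := abs_le.1 (hg u u')
  have ha := Nat.floor_le (mul_nonneg hT'.le (hg0 u))
  have hb := Nat.lt_floor_add_one (T * g u)
  have ha' := Nat.floor_le (mul_nonneg hT'.le (hg0 u'))
  have hb' := Nat.lt_floor_add_one (T * g u')
  change |(⌊T * g u⌋₊ : ℝ) / T - (⌊T * g u'⌋₊ : ℝ) / T| ≤ _
  have h5 : 1 ≤ T * |u - u'| := by
    have := mul_le_mul_of_nonneg_left (hstep.trans hsep) hT'.le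
    rwa [mul_one_div_cancel hT'.ne'] at this
  rw [← sub_div, abs_div, abs_of_pos hT', div_le_iff₀ hT', abs_le]
  have h6 := mul_le_mul_of_nonneg_left hgu.1 hT'.le
  have h7 := mul_le_mul_of_nonneg_left hgu.2 hT'.le
  constructor <;> linarith

theorem pathNode_succ_mem_edges {T : ℕ} (hT : 1 ≤ T) {g : ℝ → ℝ}
    (hg : ∀ x y, |g x - g y| ≤ |x - y|) (hg0 : ∀ x, 0 ≤ g x) (hg1 : ∀ x, g x ≤ 1) {l : ℕ}
    (hl : l < levels T) : pathNode T g (l + 1) ∈ edges T (pathNode T g l) := by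
  rw [mem_edges_iff]
  left
  have h1 := gridOf_mem_discretized hT hg hg0 hg1 (l := l + 1) hl
  unfold pathNode
  rw [if_neg l.succ_ne_zero]
  split_ifs with h0
  · subst h0
    refine Finset.mem_image.2 ⟨(gridOf T g 1).bid, Finset.mem_filter.2 ⟨h1, Or.inl rfl⟩, rfl⟩
  · refine Finset.mem_image.2 ⟨(gridOf T g (l + 1)).bid,
      Finset.mem_filter.2 ⟨h1, Or.inr fun k => ?_⟩, rfl⟩
    simp only [gridOf]
    congr 3
    push_cast
    rw [pow_succ]
    ring

/-- The discretization of a `1`-Lipschitz policy is almost as good as the policy. -/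
theorem le_primalReward_gridOf {T : ℕ} (hT : 1 ≤ T) {g : ℝ → ℝ}
    (hg : ∀ x y, |g x - g y| ≤ |x - y|) (hg0 : ∀ x, 0 ≤ g x) {lam v m S : ℝ} (hl : 0 ≤ lam)
    (hS : lam ≤ S) (hv0 : 0 ≤ v) (hv1 : v ≤ 1) :
    max 0 (utility v m (g v) - lam * payment m (g v))
      ≤ primalReward T (gridOf T g (levels T)) lam v m + 3 * (1 + S) * (1 / 2) ^ levels T := by
  have hT' : (0 : ℝ) < T := by exact_mod_cast hT
  set M := levels T
  have hpow : (0 : ℝ) < (1 / 2) ^ M := by positivity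
  have hr := primalReward_nonneg T (gridOf T g M) (v := v) (m := m) hl
  have hS0 : 0 ≤ S := hl.trans hS
  have hpos : 0 ≤ primalReward T (gridOf T g M) lam v m + 3 * (1 + S) * (1 / 2) ^ M := by positivity
  refine max_le hpos ?_
  by_cases hm : m ≤ g v
  swap
  · simpa [utility, payment, hm] using hpos
  rw [utility, payment, if_pos hm, if_pos hm]
  -- Above the threshold the penalized utility is negative, and the comparator is truncated at `0`.
  by_cases hb : g v ≤ v / (1 + lam)
  swap
  · have h1 : v < g v * (1 + lam) := by rwa [not_le, div_lt_iff₀ (by positivity)] at hb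
    linarith
  set k := ⌊v * 2 ^ M⌋₊ with hk
  have hkM : k ≤ 2 ^ M := by
    rw [hk]
    refine Nat.floor_le_of_le ?_
    push_cast
    nlinarith [pow_pos (show (0 : ℝ) < 2 by norm_num) M]
  set u : ℝ := (k : ℝ) * (1 / 2) ^ M with hu
  have hvu : |v - u| ≤ (1 / 2) ^ M := by
    have h1 := Nat.floor_le (show 0 ≤ v * 2 ^ M by positivity)
    have h2 := Nat.lt_floor_add_one (v * 2 ^ M)
    rw [← hk] at h1 h2
    have h3 : v = v * 2 ^ M * (1 / 2) ^ M := by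
      rw [mul_assoc, ← mul_pow]; norm_num
    have h4 : v - u = (v * 2 ^ M - k) * (1 / 2) ^ M := by rw [sub_mul, ← h3]
    rw [h4, abs_mul, abs_of_pos hpow, abs_of_nonneg (by linarith)]
    nlinarith
  have hgu := abs_le.1 ((hg v u).trans hvu)
  have hbid : bidAt (gridOf T g M) k = ⌊T * g u⌋₊ := bidAt_of_le (gridOf T g M) hkM
  have hthr : thresholdBid T (gridOf T g M) v lam
      = min ((⌊T * g u⌋₊ : ℝ) / T + 2 * (1 / 2) ^ M) (v / (1 + lam)) := by
    rw [← hbid, thresholdBid_eq]; rfl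
  have hf1 : (⌊T * g u⌋₊ : ℝ) / T ≤ g u := by
    rw [div_le_iff₀ hT', mul_comm (g u)]
    exact Nat.floor_le (mul_nonneg hT'.le (hg0 u))
  have hf2 : g u ≤ (⌊T * g u⌋₊ : ℝ) / T + (1 / 2) ^ M := by
    have h1 : 1 / (T : ℝ) ≤ (1 / 2) ^ M := by
      have h1 := two_pow_levels_le hT
      have h3 : Real.sqrt T ≤ T := by
        rw [Real.sqrt_le_left hT'.le]
        have : (1 : ℝ) ≤ T := by exact_mod_cast hT
        nlinarith
      rw [one_div_pow]
      exact one_div_le_one_div_of_le (by positivity) (h1.trans h3)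
    have h2 : g u ≤ ((⌊T * g u⌋₊ : ℝ) + 1) / T := by
      rw [le_div_iff₀ hT', mul_comm (g u)]
      exact (Nat.lt_floor_add_one _).le
    rw [add_div] at h2
    linarith
  -- The shift `2 ε_M` pays one `ε_M` for moving to the grid point and one for rounding, so every
  -- round won by `g` is still won.
  have hge : g v ≤ thresholdBid T (gridOf T g M) v lam := by
    rw [hthr]
    exact le_min (by linarith) hb
  have hle : thresholdBid T (gridOf T g M) v lam ≤ g v + 3 * (1 / 2) ^ M := by
    rw [hthr]
    exact (min_le_left _ _).trans (by linarith)
  unfold primalReward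
  rw [if_pos (hm.trans hge)]
  nlinarith

/-! ### Regret of the primal player -/

/-- Telescoping along the path to the discretized comparator: climbing one level costs the regret of
one node. -/
theorem nodeReward_path {T : ℕ} (hT : 0 < T) {ρ : ℝ} (hρ : 0 < ρ) {lam v m : Fin T → ℝ}
    (hl0 : ∀ t, 0 ≤ lam t) (hl1 : ∀ t, lam t ≤ 1 / ρ) (hv0 : ∀ t, 0 ≤ v t) (hv1 : ∀ t, v t ≤ 1)
    {g : ℝ → ℝ} (hg : ∀ x y, |g x - g y| ≤ |x - y|) (hg0 : ∀ x, 0 ≤ g x) (hg1 : ∀ x, g x ≤ 1)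
    {c : ℕ → ℝ} {k : ℕ} (hk : k ≤ T)
    (hc : ∀ σ : GridPolicy, 8 * Real.log (edges T σ).card + 10 * Real.sqrt
      (Real.log (edges T σ).card * (4 * (1 + 1 / ρ) * (1 / 2) ^ σ.level) * (k + 1)) ≤ c σ.level)
    (n : ℕ) (hn : n ≤ levels T) :
    prefixSum k (fun t => primalReward T (pathNode T g (levels T)) (lam t) (v t) (m t))
      ≤ prefixSum k (fun t => nodeReward ρ lam v m n t (pathNode T g (levels T - n)))
        + ∑ l ∈ Finset.Ico (levels T - n) (levels T), c l := by
  induction n with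
  | zero =>
    simp only [nodeReward, nodeMixture_zero, expect_single, Nat.sub_zero, Finset.Ico_self,
      Finset.sum_empty, add_zero]
    exact le_rfl
  | succ n ih =>
    have h1 := ih (by omega)
    have e1 : levels T - n = levels T - (n + 1) + 1 := by omega
    have hlev : (pathNode T g (levels T - (n + 1))).level = levels T - (n + 1) :=
      pathNode_level _ _ _
    have hnode : IsNode T (n + 1) (pathNode T g (levels T - (n + 1))) := by
      refine ⟨Or.inl (by omega), fun h0 => ?_⟩
      unfold pathNode
      rw [if_pos (by omega)]
    have h2 := node_regret hT hρ hl0 hl1 hv0 hv1 hnode (by omega)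
      (pathNode_succ_mem_edges hT hg hg0 hg1 (l := levels T - (n + 1)) (by omega)) hk (m := m)
    have h3 := hc (pathNode T g (levels T - (n + 1)))
    rw [hlev] at h2 h3
    rw [e1] at h1
    rw [Finset.sum_eq_sum_Ico_succ_bot (by omega)]
    linarith

theorem levels_le_log {T : ℕ} (hT : 1 ≤ T) : (levels T : ℝ) ≤ Real.log T := by
  have hT1 : (1 : ℝ) ≤ T := by exact_mod_cast hT
  have h1 := Real.log_le_log (by positivity) (two_pow_levels_le hT)
  rw [Real.log_pow, Real.log_sqrt (by linarith)] at h1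
  have h2 : (1 / 2 : ℝ) ≤ Real.log 2 := by linarith [Real.log_two_gt_d9]
  have h3 : (0 : ℝ) ≤ levels T := Nat.cast_nonneg _
  nlinarith

/-- Regret of the primal player on every prefix of the rounds. -/
theorem primal_regret {V : Set ℝ} {T : ℕ} (hT : 2 ≤ T) {ρ : ℝ} (hρ : 0 < ρ) (hρ1 : ρ ≤ 1)
    {lam m : Fin T → ℝ} {v : Fin T → V} (hV : V ⊆ Set.Icc 0 1)
    (hl0 : ∀ t, 0 ≤ lam t) (hl1 : ∀ t, lam t ≤ 1 / ρ) (π : LipPolicy V) {k : ℕ} (hk : k ≤ T) :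
    prefixSum k (fun t => max 0 (utility (v t) (m t) (π.1 (v t))
        - lam t * payment (m t) (π.1 (v t))))
      ≤ prefixSum k (fun t => nodeReward ρ lam (fun t => v t) m (levels T) t (root T))
        + 200 / ρ * (Real.sqrt T * (Real.log T ^ 2 + 1)) := by
  have hT' : (2 : ℝ) ≤ T := by exact_mod_cast hT
  have hkT : (k : ℝ) ≤ T := by exact_mod_cast hk
  have hinv : 1 ≤ 1 / ρ := by rwa [one_le_div hρ]
  have hv0 : ∀ t, 0 ≤ (v t : ℝ) := fun t => (hV (v t).2).1
  have hv1 : ∀ t, (v t : ℝ) ≤ 1 := fun t => (hV (v t).2).2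
  obtain ⟨g, hg, hg0, hg1, hgV⟩ := exists_lipschitz_extension π
  set L := Real.log T with hL
  have hL0 : 0 ≤ L := Real.log_natCast_nonneg T
  set R := Real.sqrt T with hR
  have hRsq : R ^ 2 = T := Real.sq_sqrt (by linarith)
  have hR0 : 0 < R := Real.sqrt_pos.2 (by linarith)
  set N := prefixSum k (fun t => nodeReward ρ lam (fun t => v t) m (levels T) t (root T))
  have hN : 0 ≤ N := Finset.sum_nonneg fun t _ => by
    split_ifs
    · exact le_expect_nodeMixture _ _ _ _ _ _ _ fun x _ => primalReward_nonneg T x (hl0 t)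
    · exact le_rfl
  -- Here the node of level `0` is the root, not the discretization of `g`; but then `√T < 2`, and
  -- the trivial bound `T ≤ 2 √T` suffices.
  by_cases hM : levels T = 0
  · have h1 := sqrt_lt_two_pow_levels (T := T) (by omega)
    rw [hM, ← hR] at h1
    norm_num at h1
    have h2 : prefixSum k (fun t => max 0 (utility (v t) (m t) (π.1 (v t))
        - lam t * payment (m t) (π.1 (v t)))) ≤ k * 1 := by
      rw [← prefixSum_const hk]
      refine prefixSum_le_prefixSum fun t => max_le zero_le_one ?_
      unfold utility payment
      have hb := (π.1 (v t)).2.1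
      have := hl0 t
      have := mul_nonneg this hb
      have := hv1 t
      split_ifs
      · linarith
      · norm_num
    have h3 : (T : ℝ) ≤ 2 * R := by nlinarith
    have h4 : 200 * R ≤ 200 / ρ * (R * (L ^ 2 + 1)) := by
      have h5 : R ≤ R * (L ^ 2 + 1) := by nlinarith [sq_nonneg L]
      calc 200 * R ≤ 200 * (R * (L ^ 2 + 1)) := by linarith
        _ ≤ 200 / ρ * (R * (L ^ 2 + 1)) := by
          gcongr; rw [le_div_iff₀ hρ]; linarith
    linarith
  have hround : ∀ t, max 0 (utility (v t) (m t) (π.1 (v t)) - lam t * payment (m t) (π.1 (v t)))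
      ≤ primalReward T (pathNode T g (levels T)) (lam t) (v t) (m t)
        + 3 * (1 + 1 / ρ) * (1 / 2) ^ levels T := fun t => by
    rw [← hgV, pathNode, if_neg hM]
    exact le_primalReward_gridOf (by omega) hg hg0 (hl0 t) (hl1 t) (hv0 t) (hv1 t)
  have h1 := prefixSum_le_prefixSum (n := k) hround
  rw [prefixSum_add, prefixSum_const hk] at h1
  have hdisc : (k : ℝ) * (3 * (1 + 1 / ρ) * (1 / 2) ^ levels T) ≤ 12 / ρ * R := by
    have h2 := sqrt_lt_two_pow_levels (T := T) (by omega)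
    have h3 : (1 / 2 : ℝ) ^ levels T ≤ 2 / R := by
      rw [one_div_pow, div_le_div_iff₀ (by positivity) hR0]
      rw [pow_succ] at h2
      linarith
    calc (k : ℝ) * (3 * (1 + 1 / ρ) * (1 / 2) ^ levels T)
        ≤ T * (3 * (1 / ρ + 1 / ρ) * (2 / R)) := by gcongr
      _ = 12 / ρ * R := by rw [← hRsq]; field_simp; norm_num
  -- The first term sums geometrically to `O(L √T)`; the second is independent of the level and
  -- occurs at most `log T` times.
  set c : ℕ → ℝ := fun l => 64 * L * 2 ^ l + 10 * Real.sqrt (128 / ρ * L * T) with hc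
  have hcb : ∀ σ : GridPolicy, 8 * Real.log (edges T σ).card + 10 * Real.sqrt
      (Real.log (edges T σ).card * (4 * (1 + 1 / ρ) * (1 / 2) ^ σ.level) * (k + 1))
      ≤ c σ.level := by
    intro σ
    have h2 := log_card_edges_le hT σ
    have h3 : Real.log (edges T σ).card * (4 * (1 + 1 / ρ) * (1 / 2) ^ σ.level) * (k + 1)
        ≤ 128 / ρ * L * T := by
      calc _ ≤ 8 * 2 ^ σ.level * L * (4 * (1 / ρ + 1 / ρ) * (1 / 2) ^ σ.level) * (T + T) := by
            gcongr; linarith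
        _ = 128 / ρ * L * T * (2 ^ σ.level * (1 / 2) ^ σ.level) := by ring
        _ = _ := by rw [← mul_pow]; norm_num
    have h4 := Real.sqrt_le_sqrt h3
    simp only [hc]
    linarith
  have hpath := nodeReward_path (by omega) hρ hl0 hl1 hv0 hv1 hg hg0 hg1 hk hcb (levels T) le_rfl
    (m := m)
  rw [Nat.sub_self, show pathNode T g 0 = root T from rfl] at hpath
  have hsum : ∑ l ∈ Finset.Ico 0 (levels T), c l
      ≤ 64 * L * R + 10 * L * Real.sqrt (128 / ρ * L * T) := by
    rw [← Finset.range_eq_Ico]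
    simp only [hc]
    rw [Finset.sum_add_distrib, ← Finset.mul_sum, Finset.sum_const, Finset.card_range,
      nsmul_eq_mul]
    have h2 : ∑ l ∈ Finset.range (levels T), (2 : ℝ) ^ l ≤ R := by
      rw [geom_sum_eq (by norm_num)]
      have := two_pow_levels_le (T := T) (by omega)
      rw [← hR] at this
      norm_num
      linarith
    have h3 := levels_le_log (T := T) (by omega)
    have h4 := Real.sqrt_nonneg (128 / ρ * L * T)
    have h5 := mul_le_mul_of_nonneg_left h2 (show 0 ≤ 64 * L by positivity)
    have h6 := mul_le_mul_of_nonneg_right h3 h4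
    linarith
  have hsq : L * Real.sqrt (128 / ρ * L * T) ≤ 12 / ρ * (R * (L ^ 2 + 1)) := by
    have h2 : Real.sqrt (128 / ρ * L * T) ≤ 12 / ρ * R * Real.sqrt L := by
      rw [Real.sqrt_le_left (by positivity), mul_pow, mul_pow, hRsq, Real.sq_sqrt hL0]
      have h3 : 128 / ρ ≤ (12 / ρ) ^ 2 := by
        rw [div_pow, div_le_div_iff₀ hρ (by positivity)]
        nlinarith
      calc 128 / ρ * L * T = 128 / ρ * (T * L) := by ring
        _ ≤ (12 / ρ) ^ 2 * (T * L) := by gcongr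
        _ = _ := by ring
    have h3 : L * Real.sqrt L ≤ L ^ 2 + 1 := by
      have h4 := Real.sq_sqrt hL0
      have h5 := Real.sqrt_nonneg L
      nlinarith [sq_nonneg (Real.sqrt L - 1), sq_nonneg (L - Real.sqrt L)]
    calc L * Real.sqrt (128 / ρ * L * T) ≤ L * (12 / ρ * R * Real.sqrt L) := by gcongr
      _ = 12 / ρ * (R * (L * Real.sqrt L)) := by ring
      _ ≤ _ := by gcongr
  have hLR : 64 * L * R ≤ 32 / ρ * (R * (L ^ 2 + 1)) := by
    calc 64 * L * R = 32 * (R * (2 * L)) := by ring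
      _ ≤ 32 / ρ * (R * (L ^ 2 + 1)) := by
        gcongr
        · rw [le_div_iff₀ hρ]; linarith
        · nlinarith [sq_nonneg (L - 1)]
  have hR12 : 12 / ρ * R ≤ 12 / ρ * (R * (L ^ 2 + 1)) := by
    gcongr; nlinarith [sq_nonneg L]
  have hfin : 12 / ρ * (R * (L ^ 2 + 1)) + 32 / ρ * (R * (L ^ 2 + 1))
      + 10 * (12 / ρ * (R * (L ^ 2 + 1))) ≤ 200 / ρ * (R * (L ^ 2 + 1)) := by
    have : 0 ≤ 1 / ρ * (R * (L ^ 2 + 1)) := by positivity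
    calc _ = 164 * (1 / ρ * (R * (L ^ 2 + 1))) := by ring
      _ ≤ 200 * (1 / ρ * (R * (L ^ 2 + 1))) := by linarith
      _ = _ := by ring
  change _ ≤ N + _ at hpath
  linarith

/-! ### Concentration on product spaces -/

section Concentration

variable {Ω : Type*} [MeasurableSpace Ω]

/-- Resampling one coordinate preserves a product measure. -/
theorem map_update_pi {ι : Type*} [Fintype ι] [DecidableEq ι] (μ : ι → Measure Ω)
    [∀ i, IsProbabilityMeasure (μ i)] (t : ι) :
    ((Measure.pi μ).prod (μ t)).map (fun p : (ι → Ω) × Ω => Function.update p.1 t p.2)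
      = Measure.pi μ := by
  have hmeas : Measurable (fun p : (ι → Ω) × Ω => Function.update p.1 t p.2) := measurable_update'
  symm
  refine Measure.pi_eq fun s hs => ?_
  rw [Measure.map_apply hmeas (MeasurableSet.univ_pi hs)]
  have hpre : (fun p : (ι → Ω) × Ω => Function.update p.1 t p.2) ⁻¹' Set.univ.pi s
      = (Set.univ.pi (Function.update s t Set.univ)) ×ˢ (s t) := by
    ext p
    simp only [Set.mem_preimage, Set.mem_pi, Set.mem_univ, true_implies, Set.mem_prod]
    constructor
    · intro h
      refine ⟨fun i => ?_, by simpa using h t⟩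
      by_cases hi : i = t
      · subst hi; simp
      · simpa [hi] using h i
    · rintro ⟨h1, h2⟩ i
      by_cases hi : i = t
      · subst hi; simpa using h2
      · simpa [hi] using h1 i
  rw [hpre, Measure.prod_prod, Measure.pi_pi, ← Finset.mul_prod_erase _ _ (Finset.mem_univ t),
    ← Finset.mul_prod_erase (f := fun i => μ i (s i)) _ (Finset.mem_univ t)]
  simp only [Function.update_self, measure_univ, one_mul]
  rw [mul_comm]
  congr 1
  refine Finset.prod_congr rfl fun i hi => ?_
  rw [Function.update_of_ne (Finset.ne_of_mem_erase hi)]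

theorem lintegral_pi_update {ι : Type*} [Fintype ι] [DecidableEq ι] (μ : ι → Measure Ω)
    [∀ i, IsProbabilityMeasure (μ i)] (t : ι) {f : (ι → Ω) → ENNReal} (hf : Measurable f) :
    ∫⁻ ω, f ω ∂(Measure.pi μ)
      = ∫⁻ ω, ∫⁻ y, f (Function.update ω t y) ∂(μ t) ∂(Measure.pi μ) := by
  have hmeas : Measurable (fun p : (ι → Ω) × Ω => Function.update p.1 t p.2) := measurable_update'
  conv_lhs => rw [← map_update_pi μ t]
  rw [lintegral_map hf hmeas]
  exact lintegral_prod _ (hf.comp hmeas).aemeasurable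

/-- From `exp z ≤ 1 + z + z²` for `|z| ≤ 1`, where the linear term integrates to `0`. -/
theorem lintegral_exp_le (μ : Measure Ω) [IsProbabilityMeasure μ] {X : Ω → ℝ} (hX : Measurable X)
    {c s : ℝ} (hs : 0 ≤ s) (hsc : s * c ≤ 1) (hXc : ∀ ω, |X ω| ≤ c) (h0 : ∫ ω, X ω ∂μ = 0) :
    ∫⁻ ω, ENNReal.ofReal (Real.exp (s * X ω)) ∂μ ≤ ENNReal.ofReal (Real.exp (s ^ 2 * c ^ 2)) := by
  have hint : Integrable X μ := Integrable.of_bound hX.aestronglyMeasurable c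
    (Filter.Eventually.of_forall hXc)
  have hc : ∀ ω, |s * X ω| ≤ s * c := fun ω => by
    rw [abs_mul, abs_of_nonneg hs]; exact mul_le_mul_of_nonneg_left (hXc ω) hs
  have hb : ∀ ω, Real.exp (s * X ω) ≤ 1 + s * X ω + s ^ 2 * c ^ 2 := fun ω => by
    have h1 := (abs_le.1 (Real.abs_exp_sub_one_sub_id_le ((hc ω).trans hsc))).2
    have h2 : (s * X ω) ^ 2 ≤ (s * c) ^ 2 := sq_le_sq' (abs_le.1 (hc ω)).1 (abs_le.1 (hc ω)).2
    nlinarith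
  have hint2 : Integrable (fun ω => 1 + s * X ω + s ^ 2 * c ^ 2) μ :=
    ((integrable_const _).add (hint.const_mul s)).add (integrable_const _)
  have hint3 : Integrable (fun ω => Real.exp (s * X ω)) μ := by
    refine Integrable.of_bound (hX.const_mul s).exp.aestronglyMeasurable (Real.exp 1)
      (Filter.Eventually.of_forall fun ω => ?_)
    rw [Real.norm_eq_abs, Real.abs_exp]
    exact Real.exp_le_exp.2 (((abs_le.1 (hc ω)).2).trans hsc)
  rw [← ofReal_integral_eq_lintegral_ofReal hint3
    (Filter.Eventually.of_forall fun ω => (Real.exp_pos _).le)]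
  refine ENNReal.ofReal_le_ofReal ((integral_mono hint3 hint2 hb).trans ?_)
  have h3 : ∫ ω, (1 + s * X ω + s ^ 2 * c ^ 2) ∂μ = 1 + s ^ 2 * c ^ 2 := by
    have h4 : ∫ ω, (1 + s * X ω) ∂μ = 1 := by
      rw [integral_add (integrable_const _) (hint.const_mul s), integral_const_mul, h0]
      simp
    have h5 : Integrable (fun ω => 1 + s * X ω) μ := (integrable_const _).add (hint.const_mul s)
    rw [integral_add h5 (integrable_const _), h4]
    simp
  rw [h3, add_comm]
  exact Real.add_one_le_exp _

variable {T : ℕ}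

theorem measurable_prefixSum {X : Fin T → (Fin T → Ω) → ℝ} (hX : ∀ t, Measurable (X t)) (n : ℕ) :
    Measurable fun ω => prefixSum n fun t => X t ω := by
  unfold prefixSum
  refine Finset.measurable_sum _ fun t _ => ?_
  split_ifs
  exacts [hX t, measurable_const]

/-- Exponential moment of a sum of bounded martingale differences on a product space. -/
theorem lintegral_exp_prefixSum_le (μ : Fin T → Measure Ω) [∀ t, IsProbabilityMeasure (μ t)]
    {X : Fin T → (Fin T → Ω) → ℝ} (hX : ∀ t, Measurable (X t)) {c s : ℝ} (hs : 0 ≤ s)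
    (hsc : s * c ≤ 1) (hXc : ∀ t ω, |X t ω| ≤ c)
    (hadapt : ∀ t k, t < k → ∀ ω y, X t (Function.update ω k y) = X t ω)
    (h0 : ∀ t ω, ∫ y, X t (Function.update ω t y) ∂(μ t) = 0) {n : ℕ} (hn : n ≤ T) :
    ∫⁻ ω, ENNReal.ofReal (Real.exp (s * prefixSum n fun t => X t ω)) ∂(Measure.pi μ)
      ≤ ENNReal.ofReal (Real.exp (n * (s ^ 2 * c ^ 2))) := by
  induction n with
  | zero => simp [prefixSum_zero]
  | succ n ih =>
    -- Resampling coordinate `n` leaves the earlier terms unchanged by `hadapt`, while the last term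
    -- has mean `0` in it.
    rw [lintegral_pi_update μ ⟨n, hn⟩
      ((measurable_prefixSum hX _).const_mul s).exp.ennreal_ofReal]
    have hstep : ∀ ω, ∫⁻ y, ENNReal.ofReal (Real.exp (s * prefixSum (n + 1)
        fun t => X t (Function.update ω ⟨n, hn⟩ y))) ∂(μ ⟨n, hn⟩)
        ≤ ENNReal.ofReal (Real.exp (s * prefixSum n fun t => X t ω))
          * ENNReal.ofReal (Real.exp (s ^ 2 * c ^ 2)) := by
      intro ω
      have hpre : ∀ y, prefixSum n (fun t => X t (Function.update ω ⟨n, hn⟩ y))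
          = prefixSum n fun t => X t ω := fun y => by
        unfold prefixSum
        refine Finset.sum_congr rfl fun t _ => ?_
        split_ifs with ht
        · exact hadapt t ⟨n, hn⟩ (Fin.lt_def.2 ht) ω y
        · rfl
      have hrw : ∀ y, ENNReal.ofReal (Real.exp (s * prefixSum (n + 1)
          fun t => X t (Function.update ω ⟨n, hn⟩ y)))
          = ENNReal.ofReal (Real.exp (s * prefixSum n fun t => X t ω))
            * ENNReal.ofReal (Real.exp (s * X ⟨n, hn⟩ (Function.update ω ⟨n, hn⟩ y))) := fun y => by
        rw [prefixSum_succ _ hn, hpre, mul_add, Real.exp_add,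
          ENNReal.ofReal_mul (Real.exp_pos _).le]
      simp only [hrw]
      have hXm : Measurable fun y => X ⟨n, hn⟩ (Function.update ω ⟨n, hn⟩ y) :=
        (hX _).comp (measurable_update ω)
      rw [lintegral_const_mul _ (hXm.const_mul s).exp.ennreal_ofReal]
      gcongr
      exact lintegral_exp_le _ hXm hs hsc (fun y => hXc _ _) (h0 _ ω)
    refine (lintegral_mono hstep).trans ?_
    rw [lintegral_mul_const _ ((measurable_prefixSum hX n).const_mul s).exp.ennreal_ofReal]
    refine (mul_le_mul_left (ih (by omega)) _).trans_eq ?_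
    rw [← ENNReal.ofReal_mul (Real.exp_pos _).le, ← Real.exp_add]
    congr 2
    push_cast
    ring

/-- Union bound over the `T + 1` prefixes: the factor `8` in the deviation makes each failure
probability of order `(δ / T) ^ 8`. -/
theorem log_ratio_bound {δ : ℝ} (hT : 2 ≤ T) (hδ : 0 < δ) (hδ1 : δ ≤ 1) :
    (T + 1 : ℝ) * Real.exp (1 - 8 * Real.log (T / δ)) ≤ δ / 4 := by
  have hT' : (2 : ℝ) ≤ T := by exact_mod_cast hT
  have hT0 : (0 : ℝ) < T := by linarith
  have h1 : Real.exp (1 - 8 * Real.log (T / δ)) = Real.exp 1 * (δ / T) ^ 8 := by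
    rw [sub_eq_add_neg, Real.exp_add]
    congr 1
    have : -(8 * Real.log (T / δ)) = Real.log ((δ / T) ^ 8) := by
      rw [Real.log_pow, ← inv_div, Real.log_inv]; push_cast; ring
    rw [this, Real.exp_log (by positivity)]
  rw [h1, div_pow]
  have h2 : Real.exp 1 ≤ 3 := by linarith [Real.exp_one_lt_d9]
  have h3 : δ ^ 8 ≤ δ := pow_le_of_le_one hδ.le hδ1 (by norm_num)
  have h4 : (T + 1 : ℝ) * 3 * 4 ≤ T ^ 8 := by
    have h5 : (2 : ℝ) ^ 7 ≤ T ^ 7 := by gcongr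
    have h6 : (T : ℝ) ^ 8 = T * T ^ 7 := by ring
    rw [h6]; nlinarith
  calc (T + 1 : ℝ) * (Real.exp 1 * (δ ^ 8 / T ^ 8)) ≤ (T + 1 : ℝ) * (3 * (δ / T ^ 8)) := by gcongr
    _ = ((T + 1 : ℝ) * 3 * 4) * δ / (4 * T ^ 8) := by field_simp
    _ ≤ T ^ 8 * δ / (4 * T ^ 8) := by gcongr
    _ = δ / 4 := by field_simp

/-- With high probability all prefix sums of bounded martingale differences are small. -/
theorem prefix_concentration (μ : Fin T → Measure Ω) [∀ t, IsProbabilityMeasure (μ t)]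
    {X : Fin T → (Fin T → Ω) → ℝ} (hX : ∀ t, Measurable (X t)) {c : ℝ} (hc : 0 < c)
    (hXc : ∀ t ω, |X t ω| ≤ c)
    (hadapt : ∀ t k, t < k → ∀ ω y, X t (Function.update ω k y) = X t ω)
    (h0 : ∀ t ω, ∫ y, X t (Function.update ω t y) ∂(μ t) = 0) (hT : 2 ≤ T) {δ : ℝ} (hδ : 0 < δ)
    (hδ1 : δ ≤ 1) :
    Measure.pi μ {ω | ∃ n ≤ T, 8 * c * Real.sqrt T * Real.log (T / δ)
      < prefixSum n fun t => X t ω} ≤ ENNReal.ofReal (δ / 4) := by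
  have hT0 : (0 : ℝ) < T := by exact_mod_cast (by omega : 0 < T)
  set R := Real.sqrt T with hR
  have hR0 : 0 < R := Real.sqrt_pos.2 hT0
  have hR1 : 1 ≤ R := Real.one_le_sqrt.2 (by exact_mod_cast (by omega : 1 ≤ T))
  have hRsq : R ^ 2 = T := Real.sq_sqrt hT0.le
  -- With this choice the exponent `n * (s ^ 2 * c ^ 2)` is `n / T ≤ 1`.
  set s := 1 / (c * R) with hs
  have hs0 : 0 < s := by positivity
  have hsc : s * c ≤ 1 := by
    rw [hs, one_div_mul_eq_div, div_le_one (by positivity)]; nlinarith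
  have hone : ∀ n ≤ T, Measure.pi μ {ω | 8 * c * R * Real.log (T / δ)
      < prefixSum n fun t => X t ω} ≤ ENNReal.ofReal (Real.exp (1 - 8 * Real.log (T / δ))) := by
    intro n hn
    have h1 := lintegral_exp_prefixSum_le μ hX hs0.le hsc hXc hadapt h0 hn
    have h2 := mul_meas_ge_le_lintegral (μ := Measure.pi μ)
      ((measurable_prefixSum hX n).const_mul s).exp.ennreal_ofReal
      (ENNReal.ofReal (Real.exp (8 * Real.log (T / δ))))
    have hsub : {ω | 8 * c * R * Real.log (T / δ) < prefixSum n fun t => X t ω} ⊆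
        {ω | ENNReal.ofReal (Real.exp (8 * Real.log (T / δ)))
          ≤ ENNReal.ofReal (Real.exp (s * prefixSum n fun t => X t ω))} := by
      intro ω hω
      refine ENNReal.ofReal_le_ofReal (Real.exp_le_exp.2 ?_)
      have h3 := mul_le_mul_of_nonneg_left (le_of_lt hω) hs0.le
      have h4 : s * (8 * c * R * Real.log (T / δ)) = 8 * Real.log (T / δ) := by
        rw [hs]; field_simp
      linarith
    have h5 : Real.exp (n * (s ^ 2 * c ^ 2)) ≤ Real.exp 1 := by
      refine Real.exp_le_exp.2 ?_
      have h6 : s ^ 2 * c ^ 2 = 1 / T := by rw [hs, ← hRsq]; field_simp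
      rw [h6, mul_one_div, div_le_one hT0]
      exact_mod_cast hn
    have h7 := (mul_le_mul_right (measure_mono hsub)
      (ENNReal.ofReal (Real.exp (8 * Real.log (T / δ))))).trans
      (h2.trans (h1.trans (ENNReal.ofReal_le_ofReal h5)))
    rw [Real.exp_sub, ENNReal.ofReal_div_of_pos (Real.exp_pos _),
      ENNReal.le_div_iff_mul_le (Or.inl (by simp [Real.exp_pos])) (Or.inl ENNReal.ofReal_ne_top),
      mul_comm]
    exact h7
  have hsub : {ω | ∃ n ≤ T, 8 * c * R * Real.log (T / δ) < prefixSum n fun t => X t ω} ⊆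
      ⋃ n ∈ Finset.range (T + 1), {ω | 8 * c * R * Real.log (T / δ)
        < prefixSum n fun t => X t ω} := by
    rintro ω ⟨n, hn, h⟩
    simp only [Set.mem_iUnion]
    exact ⟨n, Finset.mem_range.2 (Nat.lt_succ_of_le hn), h⟩
  refine (measure_mono hsub).trans ((measure_biUnion_finset_le _ _).trans ?_)
  refine (Finset.sum_le_sum fun n hn =>
    hone n (Nat.lt_succ_iff.1 (Finset.mem_range.1 hn))).trans ?_
  rw [Finset.sum_const, Finset.card_range, nsmul_eq_mul]
  refine le_trans (le_of_eq ?_) (ENNReal.ofReal_le_ofReal (log_ratio_bound hT hδ hδ1))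
  rw [ENNReal.ofReal_mul (by positivity)]
  congr 1
  rw [← Nat.cast_succ, ENNReal.ofReal_natCast]

end Concentration

/-! ### Static mixtures from dynamic policies -/

section Dynamic

variable {V : Set ℝ}

/-- Utility of a Lipschitz policy for a request. -/
def policyUtility (p : LipPolicy V × Request V) : ℝ := utility p.2.1 p.2.2 (p.1.1 p.2.1)

/-- Payment of a Lipschitz policy for a request. -/
def policyPayment (p : LipPolicy V × Request V) : ℝ := payment p.2.2 (p.1.1 p.2.1)

theorem continuous_eval (v : V) : Continuous fun π : LipPolicy V => π.1 v :=
  (continuous_apply v).comp continuous_subtype_val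

/-- Carathéodory: continuous in the valuation, measurable in the policy. -/
theorem measurable_eval : Measurable fun p : LipPolicy V × V => ((p.1.1 p.2 : unitInterval) : ℝ) := by
  have h : Measurable (Function.uncurry fun (v : V) (π : LipPolicy V) => π.1 v) :=
    measurable_uncurry_of_continuous_of_measurable (fun π => π.2.continuous)
      (fun v => (continuous_eval v).measurable)
  exact measurable_subtype_coe.comp (h.comp measurable_swap)

theorem measurable_policyBid :
    Measurable fun p : LipPolicy V × Request V => ((p.1.1 p.2.1 : unitInterval) : ℝ) :=
  measurable_eval.comp (measurable_fst.prodMk (measurable_fst.comp measurable_snd))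

theorem measurable_competingBid :
    Measurable fun p : LipPolicy V × Request V => (p.2.2 : ℝ) :=
  measurable_subtype_coe.comp (measurable_snd.comp measurable_snd)

theorem measurable_policyUtility : Measurable (policyUtility (V := V)) :=
  Measurable.ite (measurableSet_le measurable_competingBid measurable_policyBid)
    ((measurable_subtype_coe.comp (measurable_fst.comp measurable_snd)).sub measurable_policyBid)
    measurable_const

theorem measurable_policyPayment : Measurable (policyPayment (V := V)) :=
  Measurable.ite (measurableSet_le measurable_competingBid measurable_policyBid)
    measurable_policyBid measurable_const

theorem abs_policyUtility_le (hV : V ⊆ Set.Icc 0 1) (p : LipPolicy V × Request V) :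
    |policyUtility p| ≤ 1 := by
  unfold policyUtility utility
  have h1 := hV p.2.1.2
  have h2 := (p.1.1 p.2.1).2
  split_ifs
  · rw [abs_le]; constructor <;> linarith [h1.1, h1.2, h2.1, h2.2]
  · simp

theorem policyPayment_mem (p : LipPolicy V × Request V) : policyPayment p ∈ Set.Icc 0 1 := by
  unfold policyPayment payment
  split_ifs
  · exact (p.1.1 p.2.1).2
  · simp

theorem abs_policyPayment_le (p : LipPolicy V × Request V) : |policyPayment p| ≤ 1 := by
  rw [abs_of_nonneg (policyPayment_mem p).1]; exact (policyPayment_mem p).2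

instance (ψ : DynamicPolicy V) (t : ℕ) : IsMarkovKernel (ψ.mixture t) := ψ.isMarkov t

theorem measurable_snoc {α : Type*} [MeasurableSpace α] (t : ℕ) :
    Measurable fun p : (Fin t → α) × α => (Fin.snoc (α := fun _ => α) p.1 p.2 : Fin (t + 1) → α) := by
  refine measurable_pi_iff.2 fun i => ?_
  induction i using Fin.lastCases with
  | last => simpa using measurable_snd
  | cast i => simpa [Function.comp_def] using (measurable_pi_apply i).comp measurable_fst

instance historyLaw_prob (𝒟 : Measure (Request V)) [IsProbabilityMeasure 𝒟] (ψ : DynamicPolicy V)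
    (t : ℕ) : IsProbabilityMeasure (historyLaw 𝒟 ψ t) := by
  induction t with
  | zero => rw [historyLaw]; infer_instance
  | succ t ih =>
    rw [historyLaw]
    exact Measure.isProbabilityMeasure_map (measurable_snoc t).aemeasurable

/-- Histories after which the budget is not exceeded. -/
def alive (V : Set ℝ) (B : ℝ) (t : ℕ) : Set (Fin t → LipPolicy V × Request V) :=
  {h | ∑ s, policyPayment (h s) ≤ B}

theorem measurableSet_alive (B : ℝ) (t : ℕ) : MeasurableSet (alive V B t) :=
  measurableSet_le (Finset.measurable_sum _ fun s _ =>
    measurable_policyPayment.comp (measurable_pi_apply s)) measurable_const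

/-- Law of the policy of round `t` on the event that the budget is not exceeded before. -/
def roundPolicyLaw (𝒟 : Measure (Request V)) (ψ : DynamicPolicy V) (B : ℝ) (t : ℕ) :
    Measure (LipPolicy V) :=
  ((historyLaw 𝒟 ψ t ⊗ₘ ψ.mixture t).restrict (Prod.fst ⁻¹' alive V B t)).map Prod.snd

theorem roundPolicyLaw_univ_le (𝒟 : Measure (Request V)) [IsProbabilityMeasure 𝒟]
    (ψ : DynamicPolicy V) (B : ℝ) (t : ℕ) : roundPolicyLaw 𝒟 ψ B t Set.univ ≤ 1 := by
  rw [roundPolicyLaw, Measure.map_apply measurable_snd MeasurableSet.univ]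
  exact (Measure.restrict_apply_le _ _).trans prob_le_one

instance (𝒟 : Measure (Request V)) [IsProbabilityMeasure 𝒟] (ψ : DynamicPolicy V) (B : ℝ) (t : ℕ) :
    IsFiniteMeasure (roundPolicyLaw 𝒟 ψ B t) :=
  ⟨(roundPolicyLaw_univ_le 𝒟 ψ B t).trans_lt ENNReal.one_lt_top⟩

theorem integrable_of_abs_le_one {α : Type*} [MeasurableSpace α] {μ : Measure α} [IsFiniteMeasure μ]
    {f : α → ℝ} (hf : Measurable f) (hb : ∀ x, |f x| ≤ 1) : Integrable f μ :=
  Integrable.of_bound hf.aestronglyMeasurable 1 (Filter.Eventually.of_forall hb)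

theorem abs_integral_le_one {α : Type*} [MeasurableSpace α] {μ : Measure α} (hμ : μ Set.univ ≤ 1)
    {f : α → ℝ} (hb : ∀ x, |f x| ≤ 1) : |∫ x, f x ∂μ| ≤ 1 := by
  have : IsFiniteMeasure μ := ⟨hμ.trans_lt ENNReal.one_lt_top⟩
  have h1 : μ.real Set.univ ≤ 1 :=
    ENNReal.toReal_le_of_le_ofReal zero_le_one (by simpa using hμ)
  have h2 := norm_integral_le_of_norm_le_const (μ := μ) (f := f) (C := 1)
    (Filter.Eventually.of_forall hb)
  rw [Real.norm_eq_abs] at h2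
  linarith

/-- The request of a round is independent of its policy and of the past. -/
theorem integral_round (𝒟 : Measure (Request V)) [IsProbabilityMeasure 𝒟] (ψ : DynamicPolicy V)
    (B : ℝ) (t : ℕ) {f : LipPolicy V × Request V → ℝ} (hf : Measurable f)
    (hb : ∀ x, |f x| ≤ 1) :
    ∫ p, (alive V B t).indicator (fun _ => f p.2) p.1
        ∂(historyLaw 𝒟 ψ t ⊗ₘ (ψ.mixture t ×ₖ Kernel.const _ 𝒟))
      = ∫ q, ∫ π, f (π, q) ∂(roundPolicyLaw 𝒟 ψ B t) ∂𝒟 := by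
  have hA := measurableSet_alive (V := V) B t
  have hind : ∀ p : (Fin t → LipPolicy V × Request V) × LipPolicy V × Request V,
      (alive V B t).indicator (fun _ => f p.2) p.1
        = (Prod.fst ⁻¹' alive V B t).indicator (fun p => f p.2) p := fun p => rfl
  have hint : Integrable (fun p : (Fin t → LipPolicy V × Request V) × LipPolicy V × Request V =>
      (alive V B t).indicator (fun _ => f p.2) p.1)
      (historyLaw 𝒟 ψ t ⊗ₘ (ψ.mixture t ×ₖ Kernel.const _ 𝒟)) := by
    refine integrable_of_abs_le_one ?_ fun p => ?_
    · simp only [hind]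
      exact (hf.comp measurable_snd).indicator (measurable_fst hA)
    · by_cases hp : p.1 ∈ alive V B t <;> simp [hp, hb]
  have hU : Measurable fun π => ∫ q, f (π, q) ∂𝒟 :=
    (hf.stronglyMeasurable.integral_prod_right').measurable
  have hUb : ∀ π, |∫ q, f (π, q) ∂𝒟| ≤ 1 := fun π =>
    abs_integral_le_one prob_le_one fun q => hb (π, q)
  have hswap : ∫ q, ∫ π, f (π, q) ∂(roundPolicyLaw 𝒟 ψ B t) ∂𝒟
      = ∫ π, ∫ q, f (π, q) ∂𝒟 ∂(roundPolicyLaw 𝒟 ψ B t) :=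
    integral_integral_swap (f := fun q π => f (π, q))
      (integrable_of_abs_le_one (hf.comp measurable_swap) fun x => hb _)
  rw [hswap, roundPolicyLaw, integral_map measurable_snd.aemeasurable hU.aestronglyMeasurable,
    ← integral_indicator (measurable_fst hA), Measure.integral_compProd hint,
    Measure.integral_compProd]
  · refine integral_congr_ae (Filter.Eventually.of_forall fun h => ?_)
    simp only [Kernel.prod_apply, Kernel.const_apply]
    by_cases hh : h ∈ alive V B t
    · simp only [Set.indicator, Set.mem_preimage, hh, if_true]
      exact integral_prod _ (integrable_of_abs_le_one hf hb)
    · simp [Set.indicator, hh]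
  · refine integrable_of_abs_le_one ((hU.comp measurable_snd).indicator (measurable_fst hA))
      fun p => ?_
    by_cases hp : p.1 ∈ alive V B t <;> simp [Set.indicator, hp, hUb]

/-- Sum of `f` over the rounds before which the budget is not exceeded. -/
def aliveSum (B : ℝ) (f : LipPolicy V × Request V → ℝ) {T : ℕ}
    (h : Fin T → LipPolicy V × Request V) : ℝ :=
  ∑ t : Fin T, if prefixSum t (fun s => policyPayment (h s)) ≤ B then f (h t) else 0

theorem prefixSum_castSucc {T n : ℕ} (hn : n ≤ T) (f : Fin (T + 1) → ℝ) :
    prefixSum n f = prefixSum n fun t : Fin T => f t.castSucc := by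
  rw [prefixSum, prefixSum, Fin.sum_univ_castSucc]
  simp [hn.not_gt]

theorem aliveSum_snoc (B : ℝ) (f : LipPolicy V × Request V → ℝ) {T : ℕ}
    (h : Fin T → LipPolicy V × Request V) (x : LipPolicy V × Request V) :
    aliveSum B f (Fin.snoc (α := fun _ => LipPolicy V × Request V) h x)
      = aliveSum B f h + (alive V B T).indicator (fun _ => f x) h := by
  rw [aliveSum, Fin.sum_univ_castSucc]
  congr 1
  · refine Finset.sum_congr rfl fun t _ => ?_
    rw [Fin.val_castSucc, prefixSum_castSucc t.2.le]
    simp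
  · rw [prefixSum_castSucc (by simp)]
    simp only [Fin.snoc_castSucc, Fin.snoc_last, prefixSum, Fin.val_last, Fin.is_lt, if_true]
    by_cases hB : ∑ s, policyPayment (h s) ≤ B
    · rw [if_pos hB, Set.indicator_of_mem (show h ∈ alive V B T from hB)]
    · rw [if_neg hB, Set.indicator_of_notMem (show h ∉ alive V B T from hB)]

theorem measurable_prefixPayment {T : ℕ} (n : ℕ) :
    Measurable fun h : Fin T → LipPolicy V × Request V =>
      prefixSum n fun s => policyPayment (h s) := by
  unfold prefixSum
  refine Finset.measurable_sum _ fun t _ => ?_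
  split_ifs
  exacts [measurable_policyPayment.comp (measurable_pi_apply t), measurable_const]

theorem measurable_aliveSum (B : ℝ) {f : LipPolicy V × Request V → ℝ} (hf : Measurable f) (T : ℕ) :
    Measurable (aliveSum (T := T) B f) := by
  unfold aliveSum
  exact Finset.measurable_sum _ fun t _ =>
    Measurable.ite (measurableSet_le (measurable_prefixPayment t) measurable_const)
      (hf.comp (measurable_pi_apply t)) measurable_const

theorem abs_aliveSum_le (B : ℝ) {f : LipPolicy V × Request V → ℝ} (hb : ∀ x, |f x| ≤ 1) {T : ℕ}
    (h : Fin T → LipPolicy V × Request V) : |aliveSum B f h| ≤ T := by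
  refine (Finset.abs_sum_le_sum_abs _ _).trans ?_
  refine (Finset.sum_le_sum (g := fun _ => (1 : ℝ)) fun t _ => ?_).trans_eq (by simp)
  split_ifs
  exacts [hb _, by simp]

theorem integrable_aliveSum (𝒟 : Measure (Request V)) [IsProbabilityMeasure 𝒟]
    (ψ : DynamicPolicy V) (B : ℝ) {f : LipPolicy V × Request V → ℝ} (hf : Measurable f)
    (hb : ∀ x, |f x| ≤ 1) (T : ℕ) : Integrable (aliveSum B f) (historyLaw 𝒟 ψ T) :=
  Integrable.of_bound (measurable_aliveSum B hf T).aestronglyMeasurable T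
    (Filter.Eventually.of_forall fun h => abs_aliveSum_le B hb h)

/-- Whether the budget is exceeded before round `t` depends on the past only, and the request is
independent of the past and of the policy. So only the law of each round's policy matters and the
dynamics disappear. -/
theorem integral_aliveSum (𝒟 : Measure (Request V)) [IsProbabilityMeasure 𝒟] (ψ : DynamicPolicy V)
    (B : ℝ) {f : LipPolicy V × Request V → ℝ} (hf : Measurable f) (hb : ∀ x, |f x| ≤ 1) (T : ℕ) :
    ∫ h, aliveSum B f h ∂(historyLaw 𝒟 ψ T)
      = ∑ t ∈ Finset.range T, ∫ q, ∫ π, f (π, q) ∂(roundPolicyLaw 𝒟 ψ B t) ∂𝒟 := by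
  induction T with
  | zero => simp [aliveSum]
  | succ T ih =>
    rw [Finset.sum_range_succ, ← ih, ← integral_round 𝒟 ψ B T hf hb, historyLaw,
      integral_map (measurable_snoc T).aemeasurable
        (measurable_aliveSum B hf _).aestronglyMeasurable]
    simp only [aliveSum_snoc]
    have hfst : Integrable (fun p : (Fin T → LipPolicy V × Request V) × LipPolicy V × Request V =>
        aliveSum B f p.1) (historyLaw 𝒟 ψ T ⊗ₘ (ψ.mixture T ×ₖ Kernel.const _ 𝒟)) :=
      Integrable.of_bound
        ((measurable_aliveSum B hf T).comp measurable_fst).aestronglyMeasurable T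
        (Filter.Eventually.of_forall fun h => abs_aliveSum_le B hb h.1)
    rw [integral_add hfst]
    · congr 1
      rw [Measure.integral_compProd hfst]
      simp
    · have hA := measurableSet_alive (V := V) B T
      have hm : Measurable ((Prod.fst ⁻¹' alive V B T).indicator
          (fun p : (Fin T → LipPolicy V × Request V) × LipPolicy V × Request V => f p.2)) :=
        (hf.comp measurable_snd).indicator (measurable_fst hA)
      refine integrable_of_abs_le_one hm fun p => ?_
      by_cases hp : p.1 ∈ alive V B T <;> simp [hp, hb]

theorem sum_Iic_eq_prefixSum {T : ℕ} (f : Fin T → ℝ) (t : Fin T) :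
    ∑ s ∈ Finset.Iic t, f s = prefixSum (t + 1) f := by
  rw [prefixSum, ← Finset.sum_filter]
  refine Finset.sum_congr ?_ fun _ _ => rfl
  ext s
  simp

/-- Counting also the round in which the budget is exceeded changes the utility by at most `1`. -/
theorem budgetedReward_le {T : ℕ} {B : ℝ} {v m b : Fin T → ℝ}
    (hu : ∀ t, -1 ≤ utility (v t) (m t) (b t)) (hp : ∀ t, 0 ≤ payment (m t) (b t)) :
    budgetedReward B v m b ≤ 1 + ∑ t : Fin T,
      if prefixSum t (fun s => payment (m s) (b s)) ≤ B then utility (v t) (m t) (b t) else 0 := by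
  set P : ℕ → ℝ := fun n => prefixSum n fun s => payment (m s) (b s) with hP
  set u : Fin T → ℝ := fun t => utility (v t) (m t) (b t)
  -- The two sums differ in at most one round, the one that exceeds the budget, and its utility is
  -- at least `-1`.
  have key : ∀ n ≤ T, prefixSum n (fun t => if P (t + 1) ≤ B then u t else 0)
      - prefixSum n (fun t => if P t ≤ B then u t else 0) ≤ if P n ≤ B then 0 else 1 := by
    intro n
    induction n with
    | zero => intro _; rw [prefixSum_zero, prefixSum_zero]; split_ifs <;> norm_num
    | succ n ih =>
      intro hn
      have h1 := ih (by omega)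
      have h2 : P (n + 1) = P n + payment (m ⟨n, hn⟩) (b ⟨n, hn⟩) := prefixSum_succ _ hn
      have h3 := hp ⟨n, hn⟩
      have h4 : -1 ≤ u ⟨n, hn⟩ := hu ⟨n, hn⟩
      rw [prefixSum_succ _ hn, prefixSum_succ _ hn]
      simp only
      by_cases ha : P n ≤ B <;> by_cases hb : P (n + 1) ≤ B
      · simp only [ha, hb, if_true] at h1 ⊢; linarith
      · simp only [ha, hb, if_true, if_false] at h1 ⊢; linarith
      · exact absurd (by linarith) ha
      · simp only [ha, hb, if_false] at h1 ⊢; linarith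
  have h1 := key T le_rfl
  rw [prefixSum_full, prefixSum_full] at h1
  have h2 : budgetedReward B v m b = ∑ t : Fin T, if P (t + 1) ≤ B then u t else 0 := by
    unfold budgetedReward
    simp only [sum_Iic_eq_prefixSum]
    rfl
  rw [h2]
  have h3 : (if P T ≤ B then (0 : ℝ) else 1) ≤ 1 := by split_ifs <;> norm_num
  linarith

/-- Before the last counted round at most `B` has been paid, and that round pays at most `1`. -/
theorem sum_alive_payment_le {T : ℕ} {B : ℝ} (hB : 0 ≤ B) {p : Fin T → ℝ}
    (hp : ∀ t, p t ∈ Set.Icc 0 1) :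
    ∑ t : Fin T, (if prefixSum t p ≤ B then p t else 0) ≤ B + 1 := by
  have hle : ∀ n, prefixSum n (fun t : Fin T => if prefixSum t p ≤ B then p t else 0)
      ≤ prefixSum n p := fun n => prefixSum_le_prefixSum fun t => by
    split_ifs
    exacts [le_rfl, (hp t).1]
  have key : ∀ n ≤ T, prefixSum n (fun t : Fin T => if prefixSum t p ≤ B then p t else 0)
      ≤ B + 1 := by
    intro n
    induction n with
    | zero => intro _; rw [prefixSum_zero]; linarith
    | succ n ih =>
      intro hn
      have h1 := ih (by omega)
      have h2 := hle n
      have h3 := (hp ⟨n, hn⟩).2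
      rw [prefixSum_succ _ hn]
      simp only
      split_ifs <;> linarith
  have := key T le_rfl
  rwa [prefixSum_full] at this

instance (V : Set ℝ) : Nonempty (LipPolicy V) := ⟨⟨fun _ => 0, LipschitzWith.const' 0⟩⟩

instance (V : Set ℝ) : Nonempty (DynamicPolicy V) :=
  ⟨⟨fun _ => Kernel.const _ (Measure.dirac (Classical.arbitrary _)), fun _ => inferInstance⟩⟩

theorem measurable_budgetedReward (B : ℝ) (T : ℕ) :
    Measurable fun h : Fin T → LipPolicy V × Request V =>
      budgetedReward B (fun t => (h t).2.1) (fun t => (h t).2.2)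
        (fun t => (h t).1.1 (h t).2.1) := by
  unfold budgetedReward
  refine Finset.measurable_sum _ fun t _ => ?_
  simp only [sum_Iic_eq_prefixSum]
  exact Measurable.ite (measurableSet_le (measurable_prefixPayment (t + 1)) measurable_const)
    (measurable_policyUtility.comp (measurable_pi_apply t)) measurable_const

/-- A near-optimal dynamic policy yields a static sub-probability mixture of policies. -/
theorem exists_static_mixture (hV : V ⊆ Set.Icc 0 1) {T : ℕ} (hT : 0 < T) {ρ : ℝ} (hρ : 0 < ρ)
    (𝒟 : Measure (Request V)) [IsProbabilityMeasure 𝒟] :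
    ∃ ν : Measure (LipPolicy V), ν Set.univ ≤ 1 ∧
      optDP V T ρ 𝒟 - 2 ≤ T * ∫ q, ∫ π, policyUtility (π, q) ∂ν ∂𝒟 ∧
      T * ∫ q, ∫ π, policyPayment (π, q) ∂ν ∂𝒟 ≤ ρ * T + 1 := by
  have hT' : (0 : ℝ) < T := by exact_mod_cast hT
  -- One unit of `optDP - 2` is the suboptimality of `ψ`, the other the round that exceeds the
  -- budget.
  obtain ⟨ψ, hψ⟩ := exists_lt_of_lt_ciSup (sub_one_lt (optDP V T ρ 𝒟))
  -- The mass missing to `1` is the average probability that the budget has already been exceeded;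
  -- it acts as a void action.
  set ν : Measure (LipPolicy V) :=
    (T : ENNReal)⁻¹ • ∑ t ∈ Finset.range T, roundPolicyLaw 𝒟 ψ (ρ * T) t with hν
  have hTe : (T : ENNReal) ≠ 0 := by exact_mod_cast hT.ne'
  have hmass : ν Set.univ ≤ 1 := by
    rw [hν, Measure.smul_apply, Measure.finsetSum_apply, smul_eq_mul]
    calc _ ≤ (T : ENNReal)⁻¹ * ∑ t ∈ Finset.range T, 1 := by
          gcongr; exact roundPolicyLaw_univ_le _ _ _ _
      _ = 1 := by
        simp [ENNReal.inv_mul_cancel hTe (ENNReal.natCast_ne_top T)]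
  have hlin : ∀ f : LipPolicy V × Request V → ℝ, Measurable f → (∀ x, |f x| ≤ 1) →
      T * ∫ q, ∫ π, f (π, q) ∂ν ∂𝒟 = ∫ h, aliveSum (ρ * T) f h ∂(historyLaw 𝒟 ψ T) := by
    intro f hf hb
    rw [integral_aliveSum 𝒟 ψ (ρ * T) hf hb T]
    have h1 : ∀ q, ∫ π, f (π, q) ∂ν
        = (T : ℝ)⁻¹ * ∑ t ∈ Finset.range T, ∫ π, f (π, q) ∂(roundPolicyLaw 𝒟 ψ (ρ * T) t) := by
      intro q
      rw [hν, integral_smul_measure, integral_finsetSum_measure]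
      · simp
      · exact fun t _ => integrable_of_abs_le_one (hf.comp measurable_prodMk_right) fun π => hb _
    simp only [h1]
    rw [integral_const_mul, ← mul_assoc, mul_inv_cancel₀ hT'.ne', one_mul,
      integral_finsetSum]
    intro t _
    refine integrable_of_abs_le_one
      (hf.stronglyMeasurable.integral_prod_left').measurable fun q => ?_
    exact abs_integral_le_one (roundPolicyLaw_univ_le 𝒟 ψ (ρ * T) t) fun π => hb (π, q)
  refine ⟨ν, hmass, ?_, ?_⟩
  · rw [hlin _ measurable_policyUtility (abs_policyUtility_le hV)]
    have hle : ∀ h : Fin T → LipPolicy V × Request V,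
        budgetedReward (ρ * T) (fun t => (h t).2.1) (fun t => (h t).2.2)
          (fun t => (h t).1.1 (h t).2.1) ≤ 1 + aliveSum (ρ * T) policyUtility h := fun h =>
      budgetedReward_le (fun t => (abs_le.1 (abs_policyUtility_le hV (h t))).1)
        (fun t => (policyPayment_mem (h t)).1)
    have hint : Integrable (fun h : Fin T → LipPolicy V × Request V =>
        budgetedReward (ρ * T) (fun t => (h t).2.1) (fun t => (h t).2.2)
          (fun t => (h t).1.1 (h t).2.1)) (historyLaw 𝒟 ψ T) := by
      refine Integrable.of_bound (measurable_budgetedReward _ _).aestronglyMeasurable T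
        (Filter.Eventually.of_forall fun h => ?_)
      refine (Finset.abs_sum_le_sum_abs _ _).trans ?_
      refine (Finset.sum_le_sum (g := fun _ => (1 : ℝ)) fun t _ => ?_).trans_eq (by simp)
      split_ifs
      exacts [abs_policyUtility_le hV (h t), by simp]
    have h2 := integral_aliveSum 𝒟 ψ (ρ * T) measurable_policyUtility (abs_policyUtility_le hV) T
    have hi := integrable_aliveSum 𝒟 ψ (ρ * T) measurable_policyUtility (abs_policyUtility_le hV) T
    have h3 := integral_mono hint ((integrable_const 1).add hi) hle
    have h4 : ∫ h, (1 + aliveSum (ρ * T) policyUtility h) ∂(historyLaw 𝒟 ψ T)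
        = 1 + ∫ h, aliveSum (ρ * T) policyUtility h ∂(historyLaw 𝒟 ψ T) := by
      rw [integral_add (integrable_const 1) hi]; simp
    have h5 := h3.trans_eq h4
    linarith
  · rw [hlin _ measurable_policyPayment abs_policyPayment_le]
    have hi := integrable_aliveSum 𝒟 ψ (ρ * T) measurable_policyPayment abs_policyPayment_le T
    have := integral_mono hi (integrable_const (ρ * T + 1)) fun h =>
      sum_alive_payment_le (by positivity) fun t => policyPayment_mem (h t)
    simpa using this

/-- Utilities and payments of a static mixture dominating the best dynamic policy. -/
theorem exists_mixture_functionals (hV : V ⊆ Set.Icc 0 1) {T : ℕ} (hT : 0 < T) {ρ : ℝ} (hρ : 0 < ρ)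
    (𝒟 : Measure (Request V)) [IsProbabilityMeasure 𝒟] :
    ∃ F G : Request V → ℝ, Measurable F ∧ Measurable G ∧ (∀ q, |F q| ≤ 1) ∧ (∀ q, |G q| ≤ 1) ∧
      optDP V T ρ 𝒟 - 2 ≤ T * ∫ q, F q ∂𝒟 ∧ T * ∫ q, G q ∂𝒟 ≤ ρ * T + 1 ∧
      ∀ (n : ℕ) (q : Fin T → Request V) (lam : Fin T → ℝ) (b : ℝ), 0 ≤ b →
        (∀ π, prefixSum n (fun t => policyUtility (π, q t) - lam t * policyPayment (π, q t)) ≤ b) →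
        prefixSum n (fun t => F (q t) - lam t * G (q t)) ≤ b := by
  obtain ⟨ν, hν, h1, h2⟩ := exists_static_mixture hV hT hρ 𝒟
  have : IsFiniteMeasure ν := ⟨hν.trans_lt ENNReal.one_lt_top⟩
  have hνr : ν.real Set.univ ≤ 1 :=
    ENNReal.toReal_le_of_le_ofReal zero_le_one (by simpa using hν)
  have hbd : ∀ f : LipPolicy V × Request V → ℝ, (∀ x, |f x| ≤ 1) →
      ∀ q, |∫ π, f (π, q) ∂ν| ≤ 1 := fun f hb q =>
    abs_integral_le_one hν fun π => hb (π, q)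
  have hiU : ∀ q, Integrable (fun π => policyUtility (V := V) (π, q)) ν := fun q =>
    integrable_of_abs_le_one (measurable_policyUtility.comp measurable_prodMk_right)
      fun π => abs_policyUtility_le hV _
  have hiP : ∀ q, Integrable (fun π => policyPayment (V := V) (π, q)) ν := fun q =>
    integrable_of_abs_le_one (measurable_policyPayment.comp measurable_prodMk_right)
      fun π => abs_policyPayment_le _
  refine ⟨fun q => ∫ π, policyUtility (π, q) ∂ν, fun q => ∫ π, policyPayment (π, q) ∂ν,
    (measurable_policyUtility.stronglyMeasurable.integral_prod_left').measurable,
    (measurable_policyPayment.stronglyMeasurable.integral_prod_left').measurable,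
    hbd _ (abs_policyUtility_le hV), hbd _ abs_policyPayment_le, h1, h2, ?_⟩
  intro n q lam b hb hπ
  have hti : ∀ t : Fin T, Integrable (fun π => if (t : ℕ) < n then
      policyUtility (π, q t) - lam t * policyPayment (π, q t) else 0) ν := fun t => by
    split_ifs
    · exact (hiU _).sub ((hiP _).const_mul _)
    · exact integrable_zero _ _ _
  have h3 : prefixSum n (fun t => ∫ π, policyUtility (π, q t) ∂ν
      - lam t * ∫ π, policyPayment (π, q t) ∂ν)
      = ∫ π, prefixSum n (fun t => policyUtility (π, q t) - lam t * policyPayment (π, q t)) ∂ν := by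
    unfold prefixSum
    rw [integral_finsetSum _ fun t _ => hti t]
    refine Finset.sum_congr rfl fun t _ => ?_
    split_ifs
    · rw [integral_sub (hiU _) ((hiP _).const_mul _), integral_const_mul]
    · simp
  rw [h3]
  have h4 : Integrable (fun π => prefixSum n (fun t => policyUtility (π, q t)
      - lam t * policyPayment (π, q t))) ν := integrable_finsetSum _ fun t _ => hti t
  refine (integral_mono h4 (integrable_const b) hπ).trans ?_
  -- Since `ν` may have mass below `1`, the nonnegativity of `b` is what allows integrating the
  -- bound.
  rw [integral_const, smul_eq_mul]
  nlinarith

end Dynamic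

/-! ### Measurability of the run -/

section Measurability

variable {α : Type*} [MeasurableSpace α]

theorem measurable_thresholdBid (T : ℕ) (x : GridPolicy) {lam v : α → ℝ} (hl : Measurable lam)
    (hv : Measurable v) : Measurable fun a => thresholdBid T x (v a) (lam a) := by
  simp only [thresholdBid_eq]
  have h1 : Measurable fun a => (bidAt x ⌊v a * 2 ^ x.level⌋₊ : ℝ) :=
    (measurable_from_nat (f := fun k => (bidAt x k : ℝ))).comp
      (Nat.measurable_floor.comp (hv.mul_const _))
  exact ((h1.div_const _).add_const _).min (hv.div (hl.const_add 1))

theorem measurable_primalReward (T : ℕ) (x : GridPolicy) {lam v m : α → ℝ} (hl : Measurable lam)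
    (hv : Measurable v) (hm : Measurable m) :
    Measurable fun a => primalReward T x (lam a) (v a) (m a) := by
  have hb := measurable_thresholdBid T x hl hv
  exact Measurable.ite (measurableSet_le hm hb) (hv.sub ((hl.const_add 1).mul hb)) measurable_const

theorem measurable_expect_nodeMixture {T : ℕ} (ρ : ℝ) {lam v m : α → Fin T → ℝ}
    (hl : ∀ t, Measurable fun a => lam a t) (hv : ∀ t, Measurable fun a => v a t)
    (hm : ∀ t, Measurable fun a => m a t) (n : ℕ) (t : Fin T) (σ : GridPolicy)
    {g : α → GridPolicy → ℝ} (hg : ∀ x, Measurable fun a => g a x) :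
    Measurable fun a => expect (nodeMixture ρ (lam a) (v a) (m a) n t σ) (g a) := by
  induction n generalizing t σ g with
  | zero => simpa only [nodeMixture_zero, expect_single] using hg σ
  | succ n ih =>
    by_cases hσ : σ.level = levels T
    · simpa only [nodeMixture_terminal _ _ _ _ _ _ hσ, expect_single] using hg σ
    · simp only [nodeMixture_succ _ _ _ _ _ _ hσ, expect_sum_smul]
      have hc : ∀ π, Measurable fun a => cumReward ρ (lam a) (v a) (m a) n t π := fun π =>
        Finset.measurable_sum _ fun s _ =>
          ih s π fun x => measurable_primalReward T x (hl s) (hv s) (hm s)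
      refine Finset.measurable_sum _ fun π _ => ?_
      refine Measurable.mul ?_ (ih t π hg)
      exact ((hc π).const_mul _).exp.div
        (Finset.measurable_sum _ fun π' _ => ((hc π').const_mul _).exp)

/-- For random requests the dual variables are random and enter the martingale differences. -/
theorem measurable_dualVar {T : ℕ} (ρ : ℝ) {v m : α → Fin T → ℝ}
    (hv : ∀ t, Measurable fun a => v a t) (hm : ∀ t, Measurable fun a => m a t) (t : Fin T) :
    Measurable fun a => dualVar ρ (v a) (m a) t := by
  have key : ∀ n (t : Fin T), Measurable fun a => dualPath ρ (v a) (m a) n t := by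
    intro n
    induction n with
    | zero => exact fun t => measurable_const
    | succ n ih =>
      intro t
      simp only [dualPath]
      split_ifs with h
      · by_cases ht : t = ⟨n + 1, h⟩
        · subst ht
          simp only [Function.update_self]
          have hp : Measurable fun a => expectedPayment ρ (dualPath ρ (v a) (m a) n) (v a) (m a)
              ⟨n, Nat.lt_of_succ_lt h⟩ :=
            measurable_expect_nodeMixture ρ ih hv hm _ _ _ fun x => by
              have hb := measurable_thresholdBid T x (ih ⟨n, Nat.lt_of_succ_lt h⟩)
                (hv ⟨n, Nat.lt_of_succ_lt h⟩)
              exact Measurable.ite (measurableSet_le (hm _) hb) hb measurable_const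
          have he := ((hp.const_sub ρ).const_mul (dualRate T)).neg.exp
          have hd := ih ⟨n, Nat.lt_of_succ_lt h⟩
          exact ((hd.mul he).const_mul _).div ((hd.mul he).add (hd.const_sub _))
        · simpa only [Function.update_of_ne ht] using ih t
      · exact ih t
  exact key T t

end Measurability

/-! ### The draws of the meta-algorithm -/

section Draws

variable {T : ℕ} (ρ : ℝ) (v m : Fin T → ℝ)

theorem measurable_gridPolicy {β : Type*} [MeasurableSpace β] (g : GridPolicy → β) : Measurable g :=
  fun _ _ => trivial

theorem rootMixture_nonneg (lam : Fin T → ℝ) (t : Fin T) (x : GridPolicy) :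
    0 ≤ rootMixture ρ lam v m t x :=
  nodeMixture_nonneg _ _ _ _ _ _ _ _

instance (t : Fin T) : IsProbabilityMeasure (roundLaw ρ v m t) := by
  constructor
  rw [roundLaw, Finsupp.sum, Measure.finsetSum_apply]
  simp only [Measure.smul_apply, measure_univ, smul_eq_mul, mul_one]
  rw [← ENNReal.ofReal_sum_of_nonneg fun x _ => rootMixture_nonneg ρ v m _ t x]
  have h := expect_nodeMixture_const ρ (dualVar ρ v m) v m t (levels T) (root T) 1
  simp only [expect, Finsupp.sum, mul_one] at h
  rw [rootMixture, h, ENNReal.ofReal_one]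

theorem integral_roundLaw (t : Fin T) (g : GridPolicy → ℝ) :
    ∫ π, g π ∂(roundLaw ρ v m t) = expect (rootMixture ρ (dualVar ρ v m) v m t) g := by
  have hg : StronglyMeasurable g := (measurable_gridPolicy g).stronglyMeasurable
  rw [roundLaw, Finsupp.sum, integral_finsetSum_measure]
  · simp only [integral_smul_measure, integral_dirac' _ _ hg, smul_eq_mul]
    refine Finset.sum_congr rfl fun x _ => ?_
    rw [ENNReal.toReal_ofReal (rootMixture_nonneg ρ v m _ t x)]
  · intro x _
    exact (integrable_dirac' hg (by simp)).smul_measure ENNReal.ofReal_ne_top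

/-- With high probability the realized sums are close to their expectations on all prefixes. -/
theorem draws_concentration (hT : 2 ≤ T) {g : Fin T → GridPolicy → ℝ} (hg : ∀ t x, |g t x| ≤ 1)
    {δ : ℝ} (hδ : 0 < δ) (hδ1 : δ ≤ 1) :
    runLaw ρ v m {ω | ∃ n ≤ T, 16 * Real.sqrt T * Real.log (T / δ) < prefixSum n fun t =>
      expect (rootMixture ρ (dualVar ρ v m) v m t) (g t) - g t (ω t)} ≤ ENNReal.ofReal (δ / 4) := by
  have hm : ∀ t, Measurable (g t) := fun t => measurable_gridPolicy _
  have hE : ∀ t, |expect (rootMixture ρ (dualVar ρ v m) v m t) (g t)| ≤ 1 := fun t => by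
    rw [← integral_roundLaw]
    exact abs_integral_le_one prob_le_one (hg t)
  have h0 : ∀ (t : Fin T) (ω : Fin T → GridPolicy),
      ∫ y, (expect (rootMixture ρ (dualVar ρ v m) v m t) (g t) - g t (Function.update ω t y t))
        ∂(roundLaw ρ v m t) = 0 := fun t ω => by
    simp only [Function.update_self]
    rw [integral_sub (integrable_const _) (integrable_of_abs_le_one (hm t) (hg t)),
      integral_const, integral_roundLaw]
    simp
  have h := prefix_concentration (fun t => roundLaw ρ v m t)
    (X := fun t ω => expect (rootMixture ρ (dualVar ρ v m) v m t) (g t) - g t (ω t))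
    (fun t => ((hm t).comp (measurable_pi_apply t)).const_sub _) (c := 2) (by norm_num)
    (fun t ω => by
      have h1 := abs_le.1 (hE t)
      have h2 := abs_le.1 (hg t (ω t))
      rw [abs_le]; constructor <;> linarith)
    (fun t k htk ω y => by rw [Function.update_of_ne htk.ne])
    h0 hT hδ hδ1
  have e : (8 : ℝ) * 2 = 16 := by norm_num
  rwa [e] at h

end Draws

/-! ### Reward of the meta-algorithm -/

/-- Reward of the run in terms of the rewards of the primal player. -/
theorem runReward_lower_bound {T : ℕ} (hT : 2 ≤ T) {ρ : ℝ} (hρ : 0 < ρ) (hρ1 : ρ ≤ 1)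
    {v m : Fin T → ℝ} (hv0 : ∀ t, 0 ≤ v t) (hv1 : ∀ t, v t ≤ 1) {ω : Fin T → GridPolicy} {x : ℝ}
    (hu : ∀ n ≤ T, prefixSum n (fun t => expect (rootMixture ρ (dualVar ρ v m) v m t)
      (fun π => utility (v t) (m t) (thresholdBid T π (v t) (dualVar ρ v m t)))
      - utility (v t) (m t) (runBid ρ v m ω t)) ≤ x)
    (hp : ∀ n ≤ T, prefixSum n (fun t => payment (m t) (runBid ρ v m ω t)
      - expectedPayment ρ (dualVar ρ v m) v m t) ≤ x) :
    ∃ n ≤ T, prefixSum n (fun t => nodeReward ρ (dualVar ρ v m) v m (levels T) t (root T))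
        + ρ * prefixSum n (dualVar ρ v m) + (T - n)
        - (1 / ρ + (1 + 1 / ρ) * x + 2 / ρ * Real.sqrt T) ≤ runReward ρ v m ω := by
  set lam := dualVar ρ v m with hlam
  have hl := fun t => dualVar_mem hρ v m t
  have hl0 : ∀ t, 0 ≤ lam t := fun t => (hl t).1.le
  have hinv : 0 < 1 / ρ := by positivity
  have hx : 0 ≤ x := by simpa [prefixSum_zero] using hu 0 (by omega)
  have hsT : 0 ≤ Real.sqrt T := Real.sqrt_nonneg _
  have hpay : ∀ t π, payment (m t) (thresholdBid T π (v t) (lam t)) ∈ Set.Icc 0 1 := fun t π => by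
    unfold payment
    split_ifs
    · exact ⟨thresholdBid_nonneg T π (hv0 t) (hl0 t),
        (thresholdBid_le T π (hv0 t) (hl0 t)).trans (hv1 t)⟩
    · simp
  have hutil : ∀ t π, 0 ≤ utility (v t) (m t) (thresholdBid T π (v t) (lam t)) := fun t π => by
    unfold utility
    split_ifs
    · linarith [thresholdBid_le T π (hv0 t) (hl0 t)]
    · exact le_rfl
  have hg : ∀ t, |ρ - expectedPayment ρ lam v m t| ≤ 1 := fun t => by
    have h1 : 0 ≤ expectedPayment ρ lam v m t :=
      le_expect_nodeMixture _ _ _ _ _ _ _ fun π _ => (hpay t π).1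
    have h2 : expectedPayment ρ lam v m t ≤ 1 :=
      expect_nodeMixture_le _ _ _ _ _ _ _ fun π _ => (hpay t π).2
    rw [abs_le]; constructor <;> linarith
  have homd := fun n hn => omd_regret hT hinv lam (fun t => ρ - expectedPayment ρ lam v m t)
    (by rw [hlam, dualVar_zero]; field_simp) (fun n h => dualVar_succ ρ v m h) hg n hn
  -- Utility is penalized reward plus `lam` times payment; inserting `ρ * lam` isolates the quantity
  -- controlled by the dual regret.
  have hsplit : ∀ n, prefixSum n (fun t => expect (rootMixture ρ lam v m t)
      (fun π => utility (v t) (m t) (thresholdBid T π (v t) (lam t))))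
      = prefixSum n (fun t => nodeReward ρ lam v m (levels T) t (root T))
        + ρ * prefixSum n lam
        - prefixSum n (fun t => lam t * (ρ - expectedPayment ρ lam v m t)) := fun n => by
    rw [← prefixSum_mul, ← prefixSum_add, ← prefixSum_sub]
    refine prefixSum_congr fun t => ?_
    have h1 : nodeReward ρ lam v m (levels T) t (root T)
        = expect (rootMixture ρ lam v m t)
            (fun π => utility (v t) (m t) (thresholdBid T π (v t) (lam t)))
          - lam t * expectedPayment ρ lam v m t := by
      unfold nodeReward expectedPayment
      simp only [primalReward_eq]
      rw [expect_sub, expect_const_mul]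
      rfl
    rw [h1]; ring
  have hrew : ∀ n ≤ T, (∀ t : Fin T, (t : ℕ) < n →
      1 ≤ ρ * T - ∑ s ∈ Finset.Iio t, payment (m s) (runBid ρ v m ω s)) →
      prefixSum n (fun t => utility (v t) (m t) (runBid ρ v m ω t)) ≤ runReward ρ v m ω := by
    intro n _ h
    refine Finset.sum_le_sum fun t _ => ?_
    by_cases ht : (t : ℕ) < n
    · rw [if_pos ht, if_pos (h t ht)]
    · rw [if_neg ht]
      split_ifs
      exacts [hutil t (ω t), le_rfl]
  -- If the budget lasts, the dual comparator `0` suffices.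
  by_cases hall : ∀ t : Fin T, 1 ≤ ρ * T - ∑ s ∈ Finset.Iio t, payment (m s) (runBid ρ v m ω s)
  · refine ⟨T, le_rfl, ?_⟩
    have h1 := hrew T le_rfl fun t _ => hall t
    have h2 := hu T le_rfl
    rw [prefixSum_sub, hsplit] at h2
    have h3 := (homd T le_rfl).1
    have h4 : 2 * (1 / ρ) * Real.sqrt T = 2 / ρ * Real.sqrt T := by ring
    have h5 : 0 ≤ 1 / ρ * x := by positivity
    linarith
  · push Not at hall
    obtain ⟨t₀, ht₀⟩ := hall
    -- More than `ρ T - 1` is spent before the first depleted round `t`. Against the comparator `1 /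
    -- ρ` this yields a gain of `T - t` up to errors, which compensates for the lost rounds.
    obtain ⟨t, ht, hmin⟩ := WellFounded.has_min (wellFounded_lt (α := Fin T))
      {t | ρ * T - ∑ s ∈ Finset.Iio t, payment (m s) (runBid ρ v m ω s) < 1} ⟨t₀, ht₀⟩
    refine ⟨t, t.2.le, ?_⟩
    have h1 := hrew t t.2.le fun s hs => not_lt.1 fun h => hmin s h (Fin.lt_def.2 hs)
    have h2 := hu t t.2.le
    rw [prefixSum_sub, hsplit] at h2
    have h3 := (homd t t.2.le).2
    have h4 := hp t t.2.le
    have ht' : ρ * T - ∑ s ∈ Finset.Iio t, payment (m s) (runBid ρ v m ω s) < 1 := ht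
    rw [sum_Iio_eq_prefixSum] at ht'
    rw [prefixSum_sub] at h4
    rw [prefixSum_sub (t : ℕ) (fun _ => ρ), prefixSum_const t.2.le] at h3
    have h5 : (t : ℝ) * ρ - prefixSum t (expectedPayment ρ lam v m) ≤ t * ρ - ρ * T + 1 + x := by
      linarith
    have h6 := mul_le_mul_of_nonneg_left h5 hinv.le
    have h7 : 1 / ρ * ((t : ℝ) * ρ - ρ * T + 1 + x) = t - T + 1 / ρ + 1 / ρ * x := by
      field_simp
    have h8 : 2 * (1 / ρ) * Real.sqrt T = 2 / ρ * Real.sqrt T := by ring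
    linarith

/-! ### The static baseline -/

/-- The best fixed mixture is at most the best policy without budget and with nonnegative
utilities. -/
theorem optFD_le {V : Set ℝ} (hV : V ⊆ Set.Icc 0 1) {T : ℕ} {ρ : ℝ} {γ : Fin T → Request V} {K : ℝ}
    (hK : ∀ π : LipPolicy V, ∑ t, max 0 (policyUtility (π, γ t)) ≤ K) : optFD V T ρ γ ≤ K := by
  have : Nonempty (ProbabilityMeasure (LipPolicy V)) :=
    ⟨⟨Measure.dirac (Classical.arbitrary _), inferInstance⟩⟩
  refine ciSup_le fun ξ => ?_
  set μ : Measure (Fin T → LipPolicy V) := Measure.pi fun _ => (ξ : Measure (LipPolicy V))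
  have hm : ∀ t, Measurable fun π : LipPolicy V => max 0 (policyUtility (π, γ t)) := fun t =>
    measurable_const.max (measurable_policyUtility.comp measurable_prodMk_right)
  have hb : ∀ t (π : LipPolicy V), |max 0 (policyUtility (π, γ t))| ≤ 1 := fun t π => by
    have h1 := abs_le.1 (abs_policyUtility_le hV (π, γ t))
    rw [abs_of_nonneg (le_max_left _ _)]
    exact max_le zero_le_one h1.2
  have hi : ∀ t, Integrable (fun x : Fin T → LipPolicy V => max 0 (policyUtility (x t, γ t))) μ :=
    fun t => integrable_of_abs_le_one ((hm t).comp (measurable_pi_apply t)) fun x => hb t (x t)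
  have hle : ∀ x : Fin T → LipPolicy V,
      budgetedReward (ρ * T) (fun t => (γ t).1) (fun t => (γ t).2) (fun t => (x t).1 (γ t).1)
        ≤ ∑ t, max 0 (policyUtility (x t, γ t)) := fun x => by
    refine Finset.sum_le_sum fun t _ => ?_
    split_ifs
    exacts [le_max_right _ _, le_max_left _ _]
  have hint : Integrable (fun x : Fin T → LipPolicy V =>
      budgetedReward (ρ * T) (fun t => (γ t).1) (fun t => (γ t).2)
        (fun t => (x t).1 (γ t).1)) μ := by
    have hmeas : Measurable fun x : Fin T → LipPolicy V => fun t => (x t, γ t) :=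
      measurable_pi_iff.2 fun t => (measurable_pi_apply t).prodMk measurable_const
    refine Integrable.of_bound
      ((measurable_budgetedReward (ρ * T) T).comp hmeas).aestronglyMeasurable T
      (Filter.Eventually.of_forall fun x => ?_)
    refine (Finset.abs_sum_le_sum_abs _ _).trans ?_
    refine (Finset.sum_le_sum (g := fun _ => (1 : ℝ)) fun t _ => ?_).trans_eq (by simp)
    split_ifs
    exacts [abs_policyUtility_le hV (x t, γ t), by simp]
  refine (integral_mono hint (integrable_finsetSum _ fun t _ => hi t) hle).trans ?_
  rw [integral_finsetSum _ fun t _ => hi t]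
  have he : ∀ t, ∫ x, max 0 (policyUtility (x t, γ t)) ∂μ
      = ∫ π, max 0 (policyUtility (π, γ t)) ∂(ξ : Measure (LipPolicy V)) := fun t =>
    integral_comp_eval (μ := fun _ : Fin T => (ξ : Measure (LipPolicy V)))
      (f := fun π : LipPolicy V => max 0 (policyUtility (π, γ t))) (hm t).aestronglyMeasurable
  simp only [he]
  have hi' : ∀ t, Integrable (fun π : LipPolicy V => max 0 (policyUtility (π, γ t)))
      (ξ : Measure (LipPolicy V)) := fun t => integrable_of_abs_le_one (hm t) (hb t)
  rw [← integral_finsetSum _ fun t _ => hi' t]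
  refine (integral_mono (integrable_finsetSum _ fun t _ => hi' t) (integrable_const K) hK).trans ?_
  simp

/-! ### The two guarantees -/

/-- As `log (T / δ) ≥ log 2`, constants and first powers of the logarithm are absorbed by its
square. -/
theorem log_bounds {T : ℕ} (hT : 2 ≤ T) {δ : ℝ} (hδ : 0 < δ) (hδ1 : δ ≤ 1) :
    Real.log T ≤ Real.log (T / δ) ∧ 1 ≤ 3 * Real.log (T / δ) ^ 2
      ∧ Real.log (T / δ) ≤ 2 * Real.log (T / δ) ^ 2 ∧ 0 ≤ Real.log (T / δ) := by
  have hT' : (2 : ℝ) ≤ T := by exact_mod_cast hT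
  have h1 : (T : ℝ) ≤ T / δ := by rw [le_div_iff₀ hδ]; nlinarith
  have h2 := Real.log_le_log (by linarith) h1
  have h3 := Real.log_le_log (by norm_num) hT'
  have h4 := Real.log_two_gt_d9
  exact ⟨h2, by nlinarith, by nlinarith, by linarith⟩

/-- Regret against all policies and the remaining budget terms hold with high probability over the
draws. -/
theorem run_good {V : Set ℝ} (hV : V ⊆ Set.Icc 0 1) {T : ℕ} (hT : 2 ≤ T) {ρ : ℝ} (hρ : 0 < ρ)
    (hρ1 : ρ ≤ 1) {δ : ℝ} (hδ : 0 < δ) (hδ1 : δ ≤ 1) (γ : Fin T → Request V) :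
    ENNReal.ofReal (1 - δ / 2) ≤ runLaw ρ (fun t => ((γ t).1 : ℝ)) (fun t => ((γ t).2 : ℝ))
      {ω | ∃ n ≤ T, ∃ N, 0 ≤ N ∧
        (∀ π : LipPolicy V, prefixSum n (fun t => max 0 (policyUtility (π, γ t)
            - dualVar ρ (fun t => ((γ t).1 : ℝ)) (fun t => ((γ t).2 : ℝ)) t
              * policyPayment (π, γ t)))
          ≤ N + 800 / ρ * (Real.sqrt T * Real.log (T / δ) ^ 2)) ∧
        N + ρ * prefixSum n (dualVar ρ (fun t => ((γ t).1 : ℝ)) (fun t => ((γ t).2 : ℝ)))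
          + (T - n) - 80 / ρ * (Real.sqrt T * Real.log (T / δ) ^ 2)
          ≤ runReward ρ (fun t => ((γ t).1 : ℝ)) (fun t => ((γ t).2 : ℝ)) ω} := by
  set v : Fin T → ℝ := fun t => ((γ t).1 : ℝ) with hv
  set m : Fin T → ℝ := fun t => ((γ t).2 : ℝ) with hm
  set lam := dualVar ρ v m with hlam
  have hv0 : ∀ t, 0 ≤ v t := fun t => (hV (γ t).1.2).1
  have hv1 : ∀ t, v t ≤ 1 := fun t => (hV (γ t).1.2).2
  have hl := fun t => dualVar_mem hρ v m t
  have hl0 : ∀ t, 0 ≤ lam t := fun t => (hl t).1.le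
  obtain ⟨hL, hone, hlin, hlog0⟩ := log_bounds hT hδ hδ1
  have hR1 : 1 ≤ Real.sqrt T := Real.one_le_sqrt.2 (by exact_mod_cast (by omega : 1 ≤ T))
  set ℓ := Real.log (T / δ)
  set R := Real.sqrt T
  set x := 16 * R * ℓ with hx
  have hb : ∀ t π, thresholdBid T π (v t) (lam t) ∈ Set.Icc 0 (v t) := fun t π =>
    ⟨thresholdBid_nonneg T π (hv0 t) (hl0 t), thresholdBid_le T π (hv0 t) (hl0 t)⟩
  have c1 := draws_concentration ρ v m hT
    (g := fun t π => utility (v t) (m t) (thresholdBid T π (v t) (lam t)))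
    (fun t π => by
      have h1 := hb t π
      have h2 := hv1 t
      unfold utility
      split_ifs
      · rw [abs_le]; constructor <;> linarith [h1.1, h1.2]
      · simp) hδ hδ1
  -- Payments must be bounded from above, the opposite direction to utilities, hence the sign.
  have c2 := draws_concentration ρ v m hT
    (g := fun t π => -1 * payment (m t) (thresholdBid T π (v t) (lam t)))
    (fun t π => by
      have h1 := hb t π
      have h2 := hv1 t
      unfold payment
      split_ifs
      · rw [abs_le]; constructor <;> linarith [h1.1, h1.2]
      · simp) hδ hδ1
  set bad1 := {ω : Fin T → GridPolicy | ∃ n ≤ T, 16 * R * ℓ < prefixSum n fun t =>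
    expect (rootMixture ρ lam v m t)
      (fun π => utility (v t) (m t) (thresholdBid T π (v t) (lam t)))
    - utility (v t) (m t) (thresholdBid T (ω t) (v t) (lam t))} with hbad1
  set bad2 := {ω : Fin T → GridPolicy | ∃ n ≤ T, 16 * R * ℓ < prefixSum n fun t =>
    expect (rootMixture ρ lam v m t)
      (fun π => -1 * payment (m t) (thresholdBid T π (v t) (lam t)))
    - -1 * payment (m t) (thresholdBid T (ω t) (v t) (lam t))} with hbad2
  set good := {ω | ∃ n ≤ T, ∃ N, 0 ≤ N ∧ (∀ π : LipPolicy V,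
    prefixSum n (fun t => max 0 (policyUtility (π, γ t) - lam t * policyPayment (π, γ t)))
      ≤ N + 800 / ρ * (R * ℓ ^ 2)) ∧
    N + ρ * prefixSum n lam + (T - n) - 80 / ρ * (R * ℓ ^ 2) ≤ runReward ρ v m ω} with hgood
  have hcover : Set.univ ⊆ good ∪ (bad1 ∪ bad2) := by
    intro ω _
    by_contra hω
    simp only [Set.mem_union, not_or] at hω
    obtain ⟨hng, hn1, hn2⟩ := hω
    apply hng
    simp only [hbad1, Set.mem_ofPred_eq, not_exists, not_and, not_lt] at hn1
    simp only [hbad2, Set.mem_ofPred_eq, not_exists, not_and, not_lt] at hn2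
    obtain ⟨n, hn, h1⟩ := runReward_lower_bound hT hρ hρ1 hv0 hv1 (ω := ω) (x := x) hn1
      (fun n hn => by
        refine le_trans (le_of_eq ?_) (hn2 n hn)
        refine prefixSum_congr fun t => ?_
        rw [expect_const_mul, expectedPayment, runBid]
        ring)
    have hN : 0 ≤ prefixSum n (fun t => nodeReward ρ lam v m (levels T) t (root T)) :=
      Finset.sum_nonneg fun t _ => by
        split_ifs
        · exact le_expect_nodeMixture _ _ _ _ _ _ _ fun y _ => primalReward_nonneg T y (hl0 t)
        · exact le_rfl
    refine ⟨n, hn, _, hN, fun π => ?_, ?_⟩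
    · have h2 := primal_regret hT hρ hρ1 (lam := lam) (m := m) (v := fun t => (γ t).1) hV hl0
        (fun t => (hl t).2.le) π hn
      refine h2.trans (add_le_add le_rfl ?_)
      have h3 : Real.log T ^ 2 ≤ ℓ ^ 2 := by
        have := Real.log_natCast_nonneg T
        gcongr
      calc 200 / ρ * (R * (Real.log T ^ 2 + 1)) ≤ 200 / ρ * (R * (ℓ ^ 2 + 3 * ℓ ^ 2)) := by gcongr
        _ = _ := by ring
    · refine le_trans ?_ h1
      have hi1 : 1 ≤ 1 / ρ := by rwa [one_le_div hρ]
      have hRl : 0 ≤ R * ℓ ^ 2 := by positivity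
      have e1 : 1 / ρ ≤ 3 / ρ * (R * ℓ ^ 2) := by
        calc 1 / ρ = 1 / ρ * (1 * 1) := by ring
          _ ≤ 1 / ρ * (R * (3 * ℓ ^ 2)) := by gcongr
          _ = _ := by ring
      have e2 : (1 + 1 / ρ) * x ≤ 64 / ρ * (R * ℓ ^ 2) := by
        calc (1 + 1 / ρ) * x ≤ (1 / ρ + 1 / ρ) * (16 * R * (2 * ℓ ^ 2)) := by
              rw [hx]; gcongr
          _ = _ := by ring
      have e3 : 2 / ρ * R ≤ 6 / ρ * (R * ℓ ^ 2) := by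
        calc 2 / ρ * R = 2 / ρ * (R * 1) := by ring
          _ ≤ 2 / ρ * (R * (3 * ℓ ^ 2)) := by gcongr
          _ = _ := by ring
      have e4 : 3 / ρ * (R * ℓ ^ 2) + 64 / ρ * (R * ℓ ^ 2) + 6 / ρ * (R * ℓ ^ 2)
          ≤ 80 / ρ * (R * ℓ ^ 2) := by
        have : 0 ≤ 1 / ρ * (R * ℓ ^ 2) := by positivity
        calc _ = 73 * (1 / ρ * (R * ℓ ^ 2)) := by ring
          _ ≤ 80 * (1 / ρ * (R * ℓ ^ 2)) := by linarith
          _ = _ := by ring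
      linarith
  have : IsProbabilityMeasure (runLaw ρ v m) := by unfold runLaw; infer_instance
  have h1 : 1 ≤ runLaw ρ v m good + ENNReal.ofReal (δ / 2) := by
    calc 1 = runLaw ρ v m Set.univ := measure_univ.symm
      _ ≤ runLaw ρ v m good + (runLaw ρ v m bad1 + runLaw ρ v m bad2) :=
        (measure_mono hcover).trans ((measure_union_le _ _).trans (by
          gcongr; exact measure_union_le _ _))
      _ ≤ runLaw ρ v m good + (ENNReal.ofReal (δ / 4) + ENNReal.ofReal (δ / 4)) := by gcongr
      _ = _ := by
        rw [← ENNReal.ofReal_add (by positivity) (by positivity)]; congr 2; ring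
  rw [ENNReal.ofReal_sub _ (by positivity), ENNReal.ofReal_one]
  exact tsub_le_iff_right.2 h1

/-- Before round `n` the comparator earns at most `N + ∑ λ_t` up to regret; times `ρ ≤ 1` this is at
most `N + ρ ∑ λ_t`. The later rounds add at most `ρ (T - n) ≤ T - n`. Both are covered by the reward
bound, which explains the ratio `1 / ρ`. -/
theorem adversarial_guarantee {V : Set ℝ} (hV : V ⊆ Set.Icc 0 1) {T : ℕ} (hT : 2 ≤ T) {ρ : ℝ}
    (hρ : 0 < ρ) (hρ1 : ρ ≤ 1) {δ : ℝ} (hδ : 0 < δ) (hδ1 : δ ≤ 1) (γ : Fin T → Request V) :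
    ENNReal.ofReal (1 - δ) ≤ runLaw ρ (fun t => ((γ t).1 : ℝ)) (fun t => ((γ t).2 : ℝ))
      {π | optFD V T ρ γ - (1 / ρ) * runReward ρ (fun t => ((γ t).1 : ℝ))
          (fun t => ((γ t).2 : ℝ)) π
        ≤ 1000 * ((1 / ρ) ^ 2 * (Real.sqrt T * Real.log (T / δ) ^ 2))} := by
  refine (ENNReal.ofReal_le_ofReal (by linarith)).trans
    ((run_good hV hT hρ hρ1 hδ hδ1 γ).trans (measure_mono ?_))
  rintro ω ⟨n, hn, N, hN, hπ, hrew⟩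
  have hinv : 1 ≤ 1 / ρ := by rwa [one_le_div hρ]
  set lam := dualVar ρ (fun t => ((γ t).1 : ℝ)) (fun t => ((γ t).2 : ℝ)) with hlam
  have hl : ∀ t, 0 < lam t := fun t => (dualVar_mem hρ _ _ t).1
  set REW := runReward ρ (fun t => ((γ t).1 : ℝ)) (fun t => ((γ t).2 : ℝ)) ω
  set Q := Real.sqrt T * Real.log (T / δ) ^ 2
  have hQ : 0 ≤ Q := by positivity
  suffices h : optFD V T ρ γ ≤ 1 / ρ * REW + 1000 * ((1 / ρ) ^ 2 * Q) by
    rw [Set.mem_ofPred_eq]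
    linarith
  refine optFD_le hV fun π => ?_
  set w : Fin T → ℝ := fun t => max 0 (policyUtility (π, γ t)) with hw
  have hw1 : ∀ t, w t ≤ 1 := fun t =>
    max_le zero_le_one (abs_le.1 (abs_policyUtility_le hV (π, γ t))).2
  have hround : ∀ t, w t - lam t
      ≤ max 0 (policyUtility (π, γ t) - lam t * policyPayment (π, γ t)) := fun t => by
    have h1 := policyPayment_mem (π, γ t)
    have h2 := hl t
    have h3 : lam t * policyPayment (π, γ t) ≤ lam t := by nlinarith [h1.2]
    rcases max_cases 0 (policyUtility (π, γ t)) with h | h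
    · exact le_trans (by simp only [hw, h.1]; linarith) (le_max_left _ _)
    · exact le_trans (by simp only [hw, h.1]; linarith) (le_max_right _ _)
  have h1 := (prefixSum_le_prefixSum (n := n) hround).trans (hπ π)
  rw [prefixSum_sub] at h1
  have h2 : ∑ t, w t ≤ prefixSum n w + (T - n) := by
    have h4 : ∑ t, w t - prefixSum n w ≤ ∑ t : Fin T, (1 : ℝ) - prefixSum n fun _ : Fin T => 1 := by
      unfold prefixSum
      rw [← Finset.sum_sub_distrib, ← Finset.sum_sub_distrib]
      refine Finset.sum_le_sum fun t _ => ?_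
      split_ifs
      · simp
      · linarith [hw1 t]
    rw [prefixSum_const hn] at h4
    simp at h4
    linarith
  have hnT : (n : ℝ) ≤ T := by exact_mod_cast hn
  have h5 : ρ * ∑ t, w t ≤ REW + 800 * Q + 80 / ρ * Q := by
    have h6 : ρ * ∑ t, w t ≤ ρ * (prefixSum n w + (T - n)) := by gcongr
    have h7 : ρ * (prefixSum n w - prefixSum n lam) ≤ ρ * (N + 800 / ρ * Q) := by gcongr
    have h8 : ρ * (800 / ρ * Q) = 800 * Q := by field_simp
    nlinarith
  have h9 : ∑ t, w t ≤ 1 / ρ * (REW + 800 * Q + 80 / ρ * Q) := by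
    rw [one_div_mul_eq_div, le_div_iff₀ hρ]; linarith
  have h10 : 1 / ρ * (REW + 800 * Q + 80 / ρ * Q)
      ≤ 1 / ρ * REW + 1000 * ((1 / ρ) ^ 2 * Q) := by
    have h11 : 1 / ρ * Q ≤ (1 / ρ) ^ 2 * Q := by gcongr; nlinarith
    have h12 : 1 / ρ * (REW + 800 * Q + 80 / ρ * Q)
      = 1 / ρ * REW + 800 * (1 / ρ * Q) + 80 * ((1 / ρ) ^ 2 * Q) := by ring
    have h13 : 0 ≤ (1 / ρ) ^ 2 * Q := by positivity
    linarith
  exact h9.trans h10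

/-- The static mixture inherits the primal regret bound by linearity. As `λ_t` precedes request `t`,
`F - λ_t G` may be replaced by `f - λ_t g` up to a martingale, and `g ≤ ρ + 1 / T` makes the price
terms cancel: no competitive ratio is lost. -/
theorem stochastic_guarantee {V : Set ℝ} (hV : V ⊆ Set.Icc 0 1) {T : ℕ} (hT : 2 ≤ T) {ρ : ℝ}
    (hρ : 0 < ρ) (hρ1 : ρ ≤ 1) {δ : ℝ} (hδ : 0 < δ) (hδ1 : δ ≤ 1) (𝒟 : Measure (Request V))
    [IsProbabilityMeasure 𝒟] :
    ENNReal.ofReal (1 - δ) ≤ ∫⁻ γ : Fin T → Request V,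
      runLaw ρ (fun t => ((γ t).1 : ℝ)) (fun t => ((γ t).2 : ℝ))
        {π | optDP V T ρ 𝒟 - runReward ρ (fun t => ((γ t).1 : ℝ)) (fun t => ((γ t).2 : ℝ)) π
          ≤ 1000 * (Real.sqrt T * Real.log (T / δ) ^ 2 / ρ)}
      ∂(Measure.pi fun _ => 𝒟) := by
  have hT0 : (0 : ℝ) < T := by exact_mod_cast (by omega : 0 < T)
  have hinv : 1 ≤ 1 / ρ := by rwa [one_le_div hρ]
  obtain ⟨F, G, hF, hG, hFb, hGb, hopt, hbud, htransfer⟩ :=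
    exists_mixture_functionals hV (T := T) (by omega) hρ 𝒟
  obtain ⟨hL, hone, hlin, hlog0⟩ := log_bounds hT hδ hδ1
  have hR1 : 1 ≤ Real.sqrt T := Real.one_le_sqrt.2 (by exact_mod_cast (by omega : 1 ≤ T))
  set ℓ := Real.log (T / δ)
  set R := Real.sqrt T
  set f := ∫ q, F q ∂𝒟 with hf
  set g := ∫ q, G q ∂𝒟 with hg
  have hf1 : |f| ≤ 1 := abs_integral_le_one prob_le_one hFb
  have hg1 : |g| ≤ 1 := abs_integral_le_one prob_le_one hGb
  set lam : (Fin T → Request V) → Fin T → ℝ := fun γ =>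
    dualVar ρ (fun t => ((γ t).1 : ℝ)) (fun t => ((γ t).2 : ℝ)) with hlam
  have hl : ∀ γ t, lam γ t ∈ Set.Ioo 0 (1 / ρ) := fun γ t => dualVar_mem hρ _ _ t
  set X : Fin T → (Fin T → Request V) → ℝ := fun t γ =>
    (f - F (γ t)) - lam γ t * (g - G (γ t)) with hX
  have hlm : ∀ t, Measurable fun γ => lam γ t := fun t =>
    measurable_dualVar ρ (fun t => measurable_subtype_coe.comp
      (measurable_fst.comp (measurable_pi_apply t)))
      (fun t => measurable_subtype_coe.comp (measurable_snd.comp (measurable_pi_apply t))) t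
  have hXm : ∀ t, Measurable (X t) := fun t =>
    ((hF.comp (measurable_pi_apply t)).const_sub f).sub
      ((hlm t).mul ((hG.comp (measurable_pi_apply t)).const_sub g))
  have hlu : ∀ t k, t ≤ k → ∀ γ y, lam (Function.update γ k y) t = lam γ t := by
    intro t k htk γ y
    refine dualVar_congr ρ t fun s hs => ?_
    rw [Function.update_of_ne (hs.trans_le htk).ne]
    exact ⟨rfl, rfl⟩
  have hconc := prefix_concentration (fun _ : Fin T => 𝒟) hXm (c := 4 / ρ) (by positivity)
    (fun t γ => by
      have h1 := abs_le.1 hf1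
      have h2 := abs_le.1 hg1
      have h3 := abs_le.1 (hFb (γ t))
      have h4 := abs_le.1 (hGb (γ t))
      have h5 := hl γ t
      have h6 : |f - F (γ t)| ≤ 2 := by rw [abs_le]; constructor <;> linarith
      have h7 : |g - G (γ t)| ≤ 2 := by rw [abs_le]; constructor <;> linarith
      calc |X t γ| ≤ |f - F (γ t)| + |lam γ t * (g - G (γ t))| := abs_sub _ _
        _ ≤ 2 + 1 / ρ * 2 := by
          rw [abs_mul, abs_of_pos h5.1]
          gcongr
          exact h5.2.le
        _ ≤ 4 / ρ := by
          have : 4 / ρ = 4 * (1 / ρ) := by ring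
          linarith)
    (fun t k htk γ y => by
      simp only [hX]
      rw [hlu t k htk.le, Function.update_of_ne htk.ne])
    (fun t γ => by
      simp only [hX, hlu t t le_rfl, Function.update_self]
      have hiF : Integrable F 𝒟 := integrable_of_abs_le_one hF hFb
      have hiG : Integrable G 𝒟 := integrable_of_abs_le_one hG hGb
      have h1 : Integrable (fun y => f - F y) 𝒟 := (integrable_const f).sub hiF
      have h2 : Integrable (fun y => lam γ t * (g - G y)) 𝒟 :=
        ((integrable_const g).sub hiG).const_mul _
      rw [integral_sub h1 h2, integral_const_mul, integral_sub (integrable_const f) hiF,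
        integral_sub (integrable_const g) hiG]
      simp [← hf, ← hg]) hT hδ hδ1
  set bad := {γ : Fin T → Request V | ∃ n ≤ T, 8 * (4 / ρ) * R * ℓ
    < prefixSum n fun t => X t γ} with hbad
  have hbadm : MeasurableSet bad := by
    have : bad = ⋃ n ∈ Finset.range (T + 1), {γ | 8 * (4 / ρ) * R * ℓ
        < prefixSum n fun t => X t γ} := by
      ext γ
      simp [hbad]
    rw [this]
    exact Finset.measurableSet_biUnion _ fun n _ =>
      measurableSet_lt measurable_const (measurable_prefixSum hXm n)
  have hpoint : ∀ γ ∈ badᶜ, ENNReal.ofReal (1 - δ / 2) ≤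
      runLaw ρ (fun t => ((γ t).1 : ℝ)) (fun t => ((γ t).2 : ℝ))
        {π | optDP V T ρ 𝒟 - runReward ρ (fun t => ((γ t).1 : ℝ)) (fun t => ((γ t).2 : ℝ)) π
          ≤ 1000 * (R * ℓ ^ 2 / ρ)} := by
    intro γ hγ
    simp only [hbad, Set.mem_compl_iff, Set.mem_ofPred_eq, not_exists, not_and, not_lt] at hγ
    refine (run_good hV hT hρ hρ1 hδ hδ1 γ).trans (measure_mono ?_)
    rintro ω ⟨n, hn, N, hN, hπ, hrew⟩
    rw [Set.mem_ofPred_eq]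
    set REW := runReward ρ (fun t => ((γ t).1 : ℝ)) (fun t => ((γ t).2 : ℝ)) ω
    change N + ρ * prefixSum n (lam γ) + (T - n) - 80 / ρ * (R * ℓ ^ 2) ≤ REW at hrew
    set Q := R * ℓ ^ 2 with hQdef
    have hQ : 0 ≤ Q := by positivity
    have hQ1 : 1 ≤ 3 * Q := by
      calc (1 : ℝ) = 1 * 1 := by ring
        _ ≤ R * (3 * ℓ ^ 2) := by gcongr
        _ = 3 * Q := by rw [hQdef]; ring
    have h1 := htransfer n γ (lam γ) (N + 800 / ρ * Q) (by positivity) fun π =>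
      (prefixSum_le_prefixSum fun t => le_max_right _ _).trans (hπ π)
    have h2 := hγ n hn
    have hnT : (n : ℝ) ≤ T := by exact_mod_cast hn
    have h3 : prefixSum n (fun t => X t γ) = n * f - g * prefixSum n (lam γ)
        - prefixSum n (fun t => F (γ t) - lam γ t * G (γ t)) := by
      rw [← prefixSum_const hn, ← prefixSum_mul, ← prefixSum_sub, ← prefixSum_sub]
      exact prefixSum_congr fun t => by simp only [hX]; ring
    have h4 : prefixSum n (lam γ) ≤ n * (1 / ρ) := by
      rw [← prefixSum_const hn]
      exact prefixSum_le_prefixSum fun t => (hl γ t).2.le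
    have h5 : 0 ≤ prefixSum n (lam γ) := Finset.sum_nonneg fun t _ => by
      split_ifs
      exacts [(hl γ t).1.le, le_rfl]
    -- Overspending is at most `1 / T` per round, while the dual variables sum to at most `T / ρ`.
    have h6 : (g - ρ) * prefixSum n (lam γ) ≤ 1 / ρ := by
      have h7 : g - ρ ≤ 1 / T := by rw [le_div_iff₀ hT0]; linarith
      calc (g - ρ) * prefixSum n (lam γ) ≤ 1 / T * (T * (1 / ρ)) := by
            refine mul_le_mul h7 (h4.trans (by gcongr)) h5 (by positivity)
        _ = 1 / ρ := by field_simp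
    have h8 : (T - n) * f ≤ T - n := by
      have := (abs_le.1 hf1).2
      nlinarith
    have h9 : 8 * (4 / ρ) * R * ℓ ≤ 64 * (Q / ρ) := by
      calc 8 * (4 / ρ) * R * ℓ ≤ 8 * (4 / ρ) * R * (2 * ℓ ^ 2) := by gcongr
        _ = 64 * (Q / ρ) := by rw [hQdef]; ring
    have h10 : 800 / ρ * Q = 800 * (Q / ρ) := by ring
    have h11 : 80 / ρ * Q = 80 * (Q / ρ) := by ring
    have h12 : 1 / ρ ≤ 3 * (Q / ρ) := by
      calc 1 / ρ ≤ 3 * Q / ρ := by gcongr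
        _ = _ := by ring
    have h13 : 0 ≤ Q / ρ := by positivity
    linarith
  have hbadp : Measure.pi (fun _ : Fin T => 𝒟) badᶜ ≥ ENNReal.ofReal (1 - δ / 4) := by
    rw [prob_compl_eq_one_sub hbadm, ENNReal.ofReal_sub _ (by positivity), ENNReal.ofReal_one]
    exact tsub_le_tsub_left hconc 1
  -- The requests fail with probability at most `δ / 4`, the draws given good requests with at most
  -- `δ / 2`.
  calc ENNReal.ofReal (1 - δ) ≤ ENNReal.ofReal ((1 - δ / 2) * (1 - δ / 4)) :=
        ENNReal.ofReal_le_ofReal (by nlinarith)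
    _ = ENNReal.ofReal (1 - δ / 2) * ENNReal.ofReal (1 - δ / 4) :=
        ENNReal.ofReal_mul (by linarith)
    _ ≤ ENNReal.ofReal (1 - δ / 2) * Measure.pi (fun _ : Fin T => 𝒟) badᶜ := by gcongr
    _ = ∫⁻ _ in badᶜ, ENNReal.ofReal (1 - δ / 2) ∂(Measure.pi fun _ => 𝒟) := by
        rw [setLIntegral_const]
    _ ≤ ∫⁻ γ in badᶜ, runLaw ρ (fun t => ((γ t).1 : ℝ)) (fun t => ((γ t).2 : ℝ))
        {π | optDP V T ρ 𝒟 - runReward ρ (fun t => ((γ t).1 : ℝ)) (fun t => ((γ t).2 : ℝ)) π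
          ≤ 1000 * (R * ℓ ^ 2 / ρ)} ∂(Measure.pi fun _ => 𝒟) :=
        setLIntegral_mono' hbadm.compl hpoint
    _ ≤ _ := setLIntegral_le_lintegral _ _

end

end FirstPrice

theorem mainTheorem8 :
    ∃ C : ℝ, 0 < C ∧
      ∀ (V : Set ℝ), V ⊆ Set.Icc 0 1 →
      ∀ (T : ℕ), 2 ≤ T →
      ∀ (ρ : ℝ), 0 < ρ → ρ ≤ 1 →
      ∀ (δ : ℝ), 0 < δ →
        (∀ γ : Fin T → FirstPrice.Request V,
          ENNReal.ofReal (1 - δ) ≤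
            FirstPrice.runLaw ρ (fun t => ((γ t).1 : ℝ)) (fun t => ((γ t).2 : ℝ))
              {π | FirstPrice.optFD V T ρ γ
                  - (1 / ρ) * FirstPrice.runReward ρ (fun t => ((γ t).1 : ℝ))
                      (fun t => ((γ t).2 : ℝ)) π
                ≤ C * ((1 / ρ) ^ 2 * (Real.sqrt T * Real.log (T / δ) ^ 2))}) ∧
        (∀ (𝒟 : MeasureTheory.Measure (FirstPrice.Request V)),
          MeasureTheory.IsProbabilityMeasure 𝒟 →
          ENNReal.ofReal (1 - δ) ≤
            ∫⁻ γ : Fin T → FirstPrice.Request V,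
              FirstPrice.runLaw ρ (fun t => ((γ t).1 : ℝ)) (fun t => ((γ t).2 : ℝ))
                {π | FirstPrice.optDP V T ρ 𝒟
                    - FirstPrice.runReward ρ (fun t => ((γ t).1 : ℝ))
                        (fun t => ((γ t).2 : ℝ)) π
                  ≤ C * (Real.sqrt T * Real.log (T / δ) ^ 2 / ρ)}
              ∂(MeasureTheory.Measure.pi fun _ => 𝒟)) := by
  refine ⟨1000, by norm_num, fun V hV T hT ρ hρ hρ1 δ hδ => ?_⟩
  rcases le_or_gt δ 1 with hδ1 | hδ1
  · exact ⟨fun γ => FirstPrice.adversarial_guarantee hV hT hρ hρ1 hδ hδ1 γ, fun 𝒟 h𝒟 =>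
      FirstPrice.stochastic_guarantee hV hT hρ hρ1 hδ hδ1 𝒟⟩
  -- For `δ > 1` the required probability truncates to `0`.
  · have h0 : ENNReal.ofReal (1 - δ) = 0 := ENNReal.ofReal_of_nonpos (by linarith)
    rw [h0]
    exact ⟨fun _ => zero_le, fun _ _ => zero_le⟩
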